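/- **Conventions.** Algorithms are randomized random access machine programs with finitely many integer variables and integer arrays, at logarithmic cost (every operation is charged by the bit lengths of its operands, multiplication and division at the schoolbook rate), which can draw a uniformly random integer from $\{0,\dots,v\}$ and can query an oracle on the contents of an array. Graphs are given by adjacency matrices. The program is one and the same for all $n$; besides the graph it receives $n$, the clique size (sizes larger than $n$ are handed over as $n+1$) and the integer $\lceil(1/2+\epsilon(n))2^{\binom n2}\rceil$. Elements of $\mathbb D$ are encoded by natural numbers through a fixed injection. **Theorem.** Let $k=k(n)$ be any sequence of natural numbers (not necessarily constant), and let $\epsilon=\epsilon(n)$ be a sequence of reals with $0<\epsilon(n)\le 1/2$ for all large $n$ and $\epsilon(n)=\omega\left(n^{3/2}/\sqrt{n!}\right)$. For every $n$ let $H_n$ be a function from the simple graphs on the vertex set $\{1,\dots,n\}$ to $\mathbb D$ that is invariant under graph isomorphism, and suppose that some deterministic program (without oracle) computes $H_n(G)$, for all large $n$ and all $G$, from $G$ (with the parameters above) and the number of $k(n)$-cliques of $G$ in time $O\left(n^{8+o(1)}/\epsilon^{4+o(1)}\right)$. Then for every constant $\delta>0$ there are a randomized oracle program $P$ and a constant $c>0$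 such that for all sufficiently large $n$ the following holds with probability at least $1-2^{-cn^2}$ over a uniformly random set $S$ of $\lceil(1/2+\epsilon(n))2^{\binom n2}\rceil$ graphs on $\{1,\dots,n\}$. For every oracle $O$ from the graphs on $\{1,\dots,n\}$ to $\mathbb D$ with $O(G)=H_n(G)$ for all $G\in S$ (its answers outside $S$ being arbitrary), every $T_O$ that is an upper bound on the running time of some deterministic program that simulates $O$ on graphs with $n$ vertices, and every graph $G$ on $\{1,\dots,n\}$, the program $P$ with access to $O$, each query being charged $T_O$ (and the time to write down the answer), outputs $H_n(G)$ with probability at least $1-\delta$, and for all outcomes of its random draws it halts in time $$O\left(\frac{n^{8+o(1)}/\epsilon^{2+o(1)}+T_O}{\epsilon^2}\right),$$ where the implied constant and the $o(1)$ terms do not depend on $S$, $O$, $T_O$ or $G$. -/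

import Mathlib

open Filter Asymptotics Topology

/-!  ## Randomized random access machines with an oracle, at logarithmic cost

Programs are structured programs over finitely many integer variables and integer arrays.
Every operation is charged by the bit lengths (`Nat.size`) of the numbers that it handles;
multiplication and division are charged at the schoolbook rate. -/

namespace RAM

/-- A memory: integer variables, integer arrays, and the time spent so far. -/
structure State where
  var : ℕ → ℕ
  arr : ℕ → ℕ → ℕ
  cost : ℕ

namespace State

/-- Spend `c` units of time. -/
def tick (s : State) (c : ℕ) : State := { s with cost := s.cost + c }

/-- Assign `v` to the variable `x`. -/
def setVar (s : State) (x v : ℕ) : State := { s with var := Function.update s.var x v }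

/-- Assign `v` to the cell `i` of the array `a`. -/
def setArr (s : State) (a i v : ℕ) : State :=
  { s with arr := Function.update s.arr a (Function.update (s.arr a) i v) }

end State

/-- Binary operations; `sub` is truncated and `lt`, `eq` return `1` or `0`. -/
inductive Op where
  | add | sub | mul | div | mod | lt | eq

/-- The value of a binary operation. -/
def Op.eval : Op → ℕ → ℕ → ℕ
  | .add, u, v => u + v
  | .sub, u, v => u - v
  | .mul, u, v => u * v
  | .div, u, v => u / v
  | .mod, u, v => u % v
  | .lt, u, v => if u < v then 1 else 0
  | .eq, u, v => if u = v then 1 else 0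

/-- The time of a binary operation, its operands being already available. -/
def Op.cost : Op → ℕ → ℕ → ℕ
  | .mul, u, v => u.size * v.size + 1
  | .div, u, v => u.size * v.size + 1
  | .mod, u, v => u.size * v.size + 1
  | _, u, v => u.size + v.size + 1

/-- Expressions: constants, variables, array cells `a[e]`, binary operations. -/
inductive Exp where
  | const (c : ℕ)
  | var (x : ℕ)
  | read (a : ℕ) (e : Exp)
  | op (o : Op) (e f : Exp)

/-- The value of an expression. -/
def Exp.eval (s : State) : Exp → ℕ
  | .const c => c
  | .var x => s.var x
  | .read a e => s.arr a (e.eval s)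
  | .op o e f => o.eval (e.eval s) (f.eval s)

/-- The time to evaluate an expression. -/
def Exp.cost (s : State) : Exp → ℕ
  | .const c => c.size + 1
  | .var x => (s.var x).size + 1
  | .read a e => e.cost s + (e.eval s).size + (s.arr a (e.eval s)).size + 1
  | .op o e f => e.cost s + f.cost s + o.cost (e.eval s) (f.eval s)

/-- Programs. `set x e` is `x := e`, `put a e f` is `a[e] := f`, `cond e p q` runs `p` if `e` is
nonzero and `q` otherwise, `loop e p` repeats `p` while `e` is nonzero, `rand x e` draws `x`
uniformly from `{0, …, e}`, and `query x a` stores in `x` the answer of the oracle on the contents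
of the array `a`. -/
inductive Prog where
  | skip
  | set (x : ℕ) (e : Exp)
  | put (a : ℕ) (e f : Exp)
  | rand (x : ℕ) (e : Exp)
  | query (x a : ℕ)
  | seq (p q : Prog)
  | cond (e : Exp) (p q : Prog)
  | loop (e : Exp) (p : Prog)

/-- An oracle: its answer on the contents of an array, and the time charged for one call. -/
structure Oracle where
  answer : (ℕ → ℕ) → ℕ
  time : ℕ

/-- `Exec orc p s μ`: started in `s`, the program `p` halts for all outcomes of its random draws,
and `μ` is the distribution of the final state. Without an oracle (`orc = none`), a program that
reaches a `query` has no execution. -/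
inductive Exec (orc : Option Oracle) : Prog → State → PMF State → Prop
  | skip (s : State) : Exec orc .skip s (PMF.pure (s.tick 1))
  | set (x : ℕ) (e : Exp) (s : State) :
      Exec orc (.set x e) s
        (PMF.pure ((s.setVar x (e.eval s)).tick (e.cost s + (e.eval s).size + 1)))
  | put (a : ℕ) (e f : Exp) (s : State) :
      Exec orc (.put a e f) s
        (PMF.pure ((s.setArr a (e.eval s) (f.eval s)).tick
          (e.cost s + f.cost s + (e.eval s).size + (f.eval s).size + 1)))
  | rand (x : ℕ) (e : Exp) (s : State) :
      Exec orc (.rand x e) s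
        ((PMF.uniformOfFintype (Fin (e.eval s + 1))).map fun r : Fin (e.eval s + 1) =>
          (s.setVar x (r : ℕ)).tick (e.cost s + (e.eval s).size + 1))
  | query (o : Oracle) (x a : ℕ) (s : State) (h : orc = some o) :
      Exec orc (.query x a) s
        (PMF.pure ((s.setVar x (o.answer (s.arr a))).tick
          (o.time + (o.answer (s.arr a)).size + 1)))
  | seq (p q : Prog) (s : State) (μ : PMF State) (κ : State → PMF State)
      (hp : Exec orc p s μ) (hq : ∀ s' ∈ μ.support, Exec orc q s' (κ s')) :
      Exec orc (.seq p q) s (μ.bind κ)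
  | cond_true (e : Exp) (p q : Prog) (s : State) (μ : PMF State) (he : e.eval s ≠ 0)
      (hp : Exec orc p (s.tick (e.cost s + 1)) μ) : Exec orc (.cond e p q) s μ
  | cond_false (e : Exp) (p q : Prog) (s : State) (μ : PMF State) (he : e.eval s = 0)
      (hq : Exec orc q (s.tick (e.cost s + 1)) μ) : Exec orc (.cond e p q) s μ
  | loop_true (e : Exp) (p : Prog) (s : State) (μ : PMF State) (he : e.eval s ≠ 0)
      (hp : Exec orc (.seq p (.loop e p)) (s.tick (e.cost s + 1)) μ) : Exec orc (.loop e p) s μ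
  | loop_false (e : Exp) (p : Prog) (s : State) (he : e.eval s = 0) :
      Exec orc (.loop e p) s (PMF.pure (s.tick (e.cost s + 1)))

/-- The result of a computation is found in the variable `4`. -/
def State.output (s : State) : ℕ := s.var 4

end RAM

/-!  ## Graphs as inputs, and the problem -/

open Classical in
/-- The adjacency matrix of a graph on `n` vertices, row after row, as the contents of an array. -/
noncomputable def adjArray {n : ℕ} (G : SimpleGraph (Fin n)) (m : ℕ) : ℕ :=
  if ∃ i j : Fin n, m = i * n + j ∧ G.Adj i j then 1 else 0

/-- The graph on `n` vertices that the contents of an array describe. -/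
def graphOfArray (n : ℕ) (A : ℕ → ℕ) : SimpleGraph (Fin n) :=
  SimpleGraph.fromRel fun i j => A (i * n + j) ≠ 0

/-- The number of `k`-cliques of a graph. -/
noncomputable def cliqueCount {n : ℕ} (G : SimpleGraph (Fin n)) (k : ℕ) : ℕ :=
  {t : Finset (Fin n) | G.IsNClique k t}.ncard

/-- The initial memory on a graph `G` with `n` vertices: the variables `0`, `1`, `2`, `3` hold `n`
and three parameters, the array `0` holds the adjacency matrix, and everything else is `0`. -/
noncomputable def initState {n : ℕ} (G : SimpleGraph (Fin n)) (k m c : ℕ) : RAM.State where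
  var x := if x = 0 then n else if x = 1 then k else if x = 2 then m else if x = 3 then c else 0
  arr a := if a = 0 then adjArray G else fun _ => 0
  cost := 0

/-- The clique size as it is handed to a program. No graph on `n` vertices has a clique with more
than `n` vertices, and all these sizes are handed over as `n + 1`. -/
def cliqueParam (n k : ℕ) : ℕ := min k (n + 1)

/-- The oracle that answers queries about graphs on `n` vertices by `O`, one call taking time
`T`. -/
def graphOracle {𝔻 : Type*} (enc : 𝔻 ↪ ℕ) {n : ℕ} (O : SimpleGraph (Fin n) → 𝔻) (T : ℕ) :
    RAM.Oracle where
  answer A := enc (O (graphOfArray n A))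
  time := T

/-- `T` is an upper bound on the running time of a program that simulates `O`: without randomness
in its result and without an oracle, it computes `O G` on every graph `G` on `n` vertices. -/
def SimulatedInTime {𝔻 : Type*} (enc : 𝔻 ↪ ℕ) {n : ℕ} (O : SimpleGraph (Fin n) → 𝔻) (T : ℕ) :
    Prop :=
  ∃ Q : RAM.Prog, ∀ G : SimpleGraph (Fin n), ∃ s : RAM.State,
    RAM.Exec none Q (initState G 0 0 0) (PMF.pure s) ∧ s.output = enc (O G) ∧ s.cost ≤ T

/-- The size of a set that contains a fraction `1 / 2 + ε` of the graphs on `n` vertices, rounded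
up to an integer. -/
noncomputable def setSize (ε : ℕ → ℝ) (n : ℕ) : ℕ := ⌈(1 / 2 + ε n) * 2 ^ n.choose 2⌉₊

/-- There is a program (no oracle, no randomness in its result) that, for all large `n`, computes
`H n G` when it is given `G` and the number of `k n`-cliques of `G`, in time
`O(n ^ (8 + o(1)) / ε ^ (4 + o(1)))`. It may also use the numbers `n`, `k n` and `setSize ε n`. -/
def ComputableFromCliqueCount {𝔻 : Type*} (enc : 𝔻 ↪ ℕ) (k : ℕ → ℕ) (ε : ℕ → ℝ)
    (H : ∀ n, SimpleGraph (Fin n) → 𝔻) : Prop :=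
  ∃ (P : RAM.Prog) (C : ℝ) (a b : ℕ → ℝ), Tendsto a atTop (𝓝 0) ∧ Tendsto b atTop (𝓝 0) ∧
    ∀ᶠ n : ℕ in atTop, ∀ G : SimpleGraph (Fin n), ∃ s : RAM.State,
      RAM.Exec none P
        (initState G (cliqueParam n (k n)) (setSize ε n) (cliqueCount G (k n))) (PMF.pure s) ∧
      s.output = enc (H n G) ∧
      (s.cost : ℝ) ≤ C * ((n : ℝ) ^ (8 + a n) / ε n ^ (4 + b n))

/-- The program `P` with the oracle `orc`, on the graph `G` and the parameters `k` and `m`, always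
halts within time `τ`, and outputs `v` with probability at least `p`. -/
def ComputesInTime (P : RAM.Prog) (orc : RAM.Oracle) {n : ℕ} (G : SimpleGraph (Fin n)) (k m v : ℕ)
    (p τ : ℝ) : Prop :=
  ∃ μ : PMF RAM.State, RAM.Exec (some orc) P (initState G k m 0) μ ∧
    (∀ s ∈ μ.support, (s.cost : ℝ) ≤ τ) ∧
    ENNReal.ofReal p ≤ (μ.map RAM.State.output) v

/-- The probability that a uniformly random set of `m` graphs on `n` vertices satisfies `E`. -/
noncomputable def probOfSet (n m : ℕ) (E : Set (SimpleGraph (Fin n)) → Prop) : ℝ :=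
  ({S : Set (SimpleGraph (Fin n)) | S.ncard = m ∧ E S}.ncard : ℝ) /
    ({S : Set (SimpleGraph (Fin n)) | S.ncard = m}.ncard : ℝ)

/-!
Two vertices of a graph are *twins* if they have the same neighbours apart from themselves. Being
twins is an equivalence relation; let `r` be the number of its classes. The program finds the twin
classes and then proceeds in one of two ways, depending on `r`.

If `r` is large, the isomorphism class of `G` is large. Take one vertex from each class. By an
argument of Bochert (`exists_autFree`), at least half of these vertices form a set on which no
automorphism other than the identity is supported: otherwise there would be two nontrivial
automorphisms whose supports share a single vertex, and their commutator would be an automorphism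
that is a 3-cycle on these vertices, which makes two of them twins. So `G` has at least
`((r + 1) / 2)!` relabellings (`factorial_le_card_relabellings`). As soon as this number is at
least `16 n² / ε²`, a random set `S` of the prescribed size contains a fraction of at least
`(1 + ε) / 2` of the relabellings of `G`, up to a probability `exp (-2 n²)`
(`card_filter_card_inter_lt_le`, a Chernoff bound for sampling without replacement); this is small
enough for a union bound over all graphs (`one_sub_le_probOfSet`). Asking the oracle for `O(1 / ε²)`
random relabellings and taking the majority then gives the right answer with probability at least
`1 - δ` (`card_voteBalance_pos_ge`, `RAM.exec_vote_of_oracle`). The majority is found with a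
candidate and a counter, by the algorithm of Boyer and Moore. All the randomness comes from one
number below `(n!) ^ t`, for `t` samples: its digits to the base `n!` are the samples, and the
digits of a sample in the factorial number system are the choices in a Fisher–Yates shuffle.

If `r` is small, that is, if `((r + 1) / 2)!` is less than about `144 n² / ε²`, the cliques can be
counted, and the given program computes the invariant from their number. A vertex `v` is adjacent
to an earlier vertex `u` if and only if it is adjacent to the representative of the class of `u`, so
whether `v` extends a clique of earlier vertices depends only on the set of classes which that
clique meets. Dynamic programming over these `2 ^ r` sets (`RAM.maskedCliques_succ`) counts the
cliques in time `O(2 ^ r n^7)`. Since factorials grow faster than exponentials, `2 ^ r` is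
`(n / ε) ^ o(1)` (`exists_tendsto_four_pow_le`).

The program does not know `ε`, but computes `2 ^ N / (2 m - 2 ^ N) + 1` for the number `N` of pairs
of vertices and the size `m` of `S`; this is between `1 / (3 ε)` and `1 / ε` (`RAM.invGap_bounds`).

Running times are bounded by a program logic (`RAM.Runs`). If all numbers that occur are below
`2 ^ W`, every node of an expression is evaluated in time `(W + 1) ^ 2`, and here `W = O(n²)`. Only
the numbers from which the samples are drawn are longer; they have `O(t W)` bits. Each part of the
program has variables and arrays of its own, and since the lists of those to which it assigns are
computable, it is decidable that one part leaves the data of another alone. The given program is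
moved to the variables and arrays from `100` on.
-/

namespace RAM

/-! ### A program logic for deterministic programs -/

/-- The variables to which a program assigns. -/
def Prog.wv : Prog → List ℕ
  | .skip => []
  | .set x _ => [x]
  | .put _ _ _ => []
  | .rand x _ => [x]
  | .query x _ => [x]
  | .seq p q => p.wv ++ q.wv
  | .cond _ p q => p.wv ++ q.wv
  | .loop _ p => p.wv

/-- The arrays to which a program assigns. -/
def Prog.wa : Prog → List ℕ
  | .skip => []
  | .set _ _ => []
  | .put a _ _ => [a]
  | .rand _ _ => []
  | .query _ _ => []
  | .seq p q => p.wa ++ q.wa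
  | .cond _ p q => p.wa ++ q.wa
  | .loop _ p => p.wa

/-- A program changes only the variables and arrays to which it assigns. -/
theorem Exec.frame {orc : Option Oracle} {p : Prog} {s : State} {μ : PMF State}
    (h : Exec orc p s μ) : ∀ s' ∈ μ.support,
      (∀ x, x ∉ p.wv → s'.var x = s.var x) ∧ (∀ b, b ∉ p.wa → s'.arr b = s.arr b) := by
  induction h with
  | skip s => simp [State.tick]
  | set x e s =>
    simp only [PMF.support_pure, Set.mem_singleton_iff, forall_eq, Prog.wv, Prog.wa,
      State.tick, State.setVar, List.mem_singleton]
    exact ⟨fun y hy => Function.update_of_ne hy _ _, fun _ _ => trivial⟩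
  | put a e f s =>
    simp only [PMF.support_pure, Set.mem_singleton_iff, forall_eq, Prog.wv, Prog.wa,
      State.tick, State.setArr, List.mem_singleton]
    exact ⟨fun _ _ => trivial, fun y hy => Function.update_of_ne hy _ _⟩
  | rand x e s =>
    intro s' hs'
    rw [PMF.support_map] at hs'
    obtain ⟨r, -, rfl⟩ := hs'
    simp only [Prog.wv, Prog.wa, State.tick, State.setVar, List.mem_singleton]
    exact ⟨fun y hy => Function.update_of_ne hy _ _, fun _ _ => trivial⟩
  | query o x a s h =>
    simp only [PMF.support_pure, Set.mem_singleton_iff, forall_eq, Prog.wv, Prog.wa,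
      State.tick, State.setVar, List.mem_singleton]
    exact ⟨fun y hy => Function.update_of_ne hy _ _, fun _ _ => trivial⟩
  | seq p q s μ κ hp hq ihp ihq =>
    intro s' hs'
    rw [PMF.mem_support_bind_iff] at hs'
    obtain ⟨s₁, h₁, h₂⟩ := hs'
    have a₁ := ihp s₁ h₁
    have a₂ := ihq s₁ h₁ s' h₂
    simp only [Prog.wv, Prog.wa, List.mem_append, not_or]
    exact ⟨fun x hx => (a₂.1 x hx.2).trans (a₁.1 x hx.1),
      fun x hx => (a₂.2 x hx.2).trans (a₁.2 x hx.1)⟩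
  | cond_true e p q s μ he hp ih =>
    intro s' hs'
    have := ih s' hs'
    simp only [Prog.wv, Prog.wa, List.mem_append, not_or]
    exact ⟨fun x hx => this.1 x hx.1, fun x hx => this.2 x hx.1⟩
  | cond_false e p q s μ he hp ih =>
    intro s' hs'
    have := ih s' hs'
    simp only [Prog.wv, Prog.wa, List.mem_append, not_or]
    exact ⟨fun x hx => this.1 x hx.2, fun x hx => this.2 x hx.2⟩
  | loop_true e p s μ he hp ih =>
    intro s' hs'
    have := ih s' hs'
    simp only [Prog.wv, Prog.wa, List.mem_append, not_or] at this ⊢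
    exact ⟨fun x hx => this.1 x ⟨hx, hx⟩, fun x hx => this.2 x ⟨hx, hx⟩⟩
  | loop_false e p s he => simp [State.tick]

/-- A number is written down at a cost at least its length: what a computation leaves in a
variable is no longer than what was there before or than the time spent. -/
theorem Exec.size_var_le {orc : Option Oracle} {p : Prog} {s : State} {μ : PMF State}
    (h : Exec orc p s μ) : ∀ s' ∈ μ.support, s.cost ≤ s'.cost ∧
      ∀ x, (s'.var x).size ≤ max (s.var x).size (s'.cost - s.cost) := by
  induction h with
  | skip s => simp [State.tick]
  | set x e s =>
    simp only [PMF.support_pure, Set.mem_singleton_iff, forall_eq, State.tick, State.setVar]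
    refine ⟨by omega, fun y => ?_⟩
    by_cases hy : y = x
    · subst hy; rw [Function.update_self]; omega
    · rw [Function.update_of_ne hy]; omega
  | put a e f s =>
    simp only [PMF.support_pure, Set.mem_singleton_iff, forall_eq, State.tick, State.setArr]
    exact ⟨by omega, fun y => by omega⟩
  | rand x e s =>
    intro s' hs'
    rw [PMF.support_map] at hs'
    obtain ⟨r, -, rfl⟩ := hs'
    simp only [State.tick, State.setVar]
    refine ⟨by omega, fun y => ?_⟩
    by_cases hy : y = x
    · subst hy; rw [Function.update_self]
      have := Nat.size_le_size (Nat.lt_succ_iff.1 r.2)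
      omega
    · rw [Function.update_of_ne hy]; omega
  | query o x a s h =>
    simp only [PMF.support_pure, Set.mem_singleton_iff, forall_eq, State.tick, State.setVar]
    refine ⟨by omega, fun y => ?_⟩
    by_cases hy : y = x
    · subst hy; rw [Function.update_self]; omega
    · rw [Function.update_of_ne hy]; omega
  | seq p q s μ κ hp hq ihp ihq =>
    intro s' hs'
    rw [PMF.mem_support_bind_iff] at hs'
    obtain ⟨s₁, h₁, h₂⟩ := hs'
    have a₁ := ihp s₁ h₁
    have a₂ := ihq s₁ h₁ s' h₂
    refine ⟨a₁.1.trans a₂.1, fun x => ?_⟩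
    have b₁ := a₁.2 x
    have b₂ := a₂.2 x
    omega
  | cond_true e p q s μ he hp ih =>
    intro s' hs'
    obtain ⟨h₁, h₂⟩ := ih s' hs'
    simp only [State.tick] at h₁ h₂
    exact ⟨by omega, fun x => by have := h₂ x; omega⟩
  | cond_false e p q s μ he hp ih =>
    intro s' hs'
    obtain ⟨h₁, h₂⟩ := ih s' hs'
    simp only [State.tick] at h₁ h₂
    exact ⟨by omega, fun x => by have := h₂ x; omega⟩
  | loop_true e p s μ he hp ih =>
    intro s' hs'
    obtain ⟨h₁, h₂⟩ := ih s' hs'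
    simp only [State.tick] at h₁ h₂
    exact ⟨by omega, fun x => by have := h₂ x; omega⟩
  | loop_false e p s he => simp [State.tick]

/-- The value of an expression in a memory with variables `v` and arrays `a`. -/
def Exp.val (v : ℕ → ℕ) (a : ℕ → ℕ → ℕ) : Exp → ℕ
  | .const c => c
  | .var x => v x
  | .read b e => a b (e.val v a)
  | .op o e f => o.eval (e.val v a) (f.val v a)

theorem Exp.eval_eq (s : State) (e : Exp) : e.eval s = e.val s.var s.arr := by
  induction e <;> simp_all [Exp.eval, Exp.val]

theorem Exp.cost_congr (s s' : State) (hv : s.var = s'.var) (ha : s.arr = s'.arr) (e : Exp) :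
    e.cost s = e.cost s' := by
  induction e <;> simp_all [Exp.cost, Exp.eval_eq]

/-- The time to evaluate an expression in a memory with variables `v` and arrays `a`. -/
def Exp.time (v : ℕ → ℕ) (a : ℕ → ℕ → ℕ) (e : Exp) : ℕ := e.cost ⟨v, a, 0⟩

/-- The number of nodes of an expression. -/
def Exp.len : Exp → ℕ
  | .const _ => 1
  | .var _ => 1
  | .read _ e => e.len + 1
  | .op _ e f => e.len + f.len + 1

/-- All the values that occur in the evaluation of an expression are less than `M`. For the
operations other than `add` and `mul` this follows from the bounds on the operands. -/
def Exp.Fits (v : ℕ → ℕ) (a : ℕ → ℕ → ℕ) (M : ℕ) : Exp → Prop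
  | .const c => c < M
  | .var x => v x < M
  | .read b e => e.Fits v a M ∧ a b (e.val v a) < M
  | .op .add e f => (e.Fits v a M ∧ f.Fits v a M) ∧ e.val v a + f.val v a < M
  | .op .mul e f => (e.Fits v a M ∧ f.Fits v a M) ∧ e.val v a * f.val v a < M
  | .op _ e f => e.Fits v a M ∧ f.Fits v a M

theorem Exp.Fits.val_lt {v : ℕ → ℕ} {a : ℕ → ℕ → ℕ} {M : ℕ} (hM : 1 < M) {e : Exp}
    (h : e.Fits v a M) : e.val v a < M := by
  induction e with
  | const c => exact h
  | var x => exact h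
  | read b e ih => exact h.2
  | op o e f ihe ihf =>
    cases o with
    | add => exact h.2
    | mul => exact h.2
    | sub => exact (Nat.sub_le _ _).trans_lt (ihe h.1)
    | div => exact (Nat.div_le_self _ _).trans_lt (ihe h.1)
    | mod => exact (Nat.mod_le _ _).trans_lt (ihe h.1)
    | lt => simp only [Exp.val, Op.eval]; split <;> omega
    | eq => simp only [Exp.val, Op.eval]; split <;> omega

/-- Schoolbook arithmetic with numbers of at most `W` bits takes time at most `(W + 1) ^ 2` for each
operation. -/
theorem Exp.Fits.time_le {v : ℕ → ℕ} {a : ℕ → ℕ → ℕ} {W : ℕ} (hW : 1 ≤ W) {e : Exp}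
    (h : e.Fits v a (2 ^ W)) : e.time v a ≤ e.len * (W + 1) ^ 2 := by
  have hM : 1 < 2 ^ W := Nat.one_lt_two_pow (by omega)
  induction e with
  | const c =>
    have : c.size ≤ W := Nat.size_le.2 h
    simp only [Exp.time, Exp.cost, Exp.len]; nlinarith
  | var x =>
    have : (v x).size ≤ W := Nat.size_le.2 h
    simp only [Exp.time, Exp.cost, Exp.len]; nlinarith
  | read b e ih =>
    have h1 := ih h.1
    have h2 : (e.val v a).size ≤ W := Nat.size_le.2 (h.1.val_lt hM)
    have h3 : (a b (e.val v a)).size ≤ W := Nat.size_le.2 h.2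
    simp only [Exp.time, Exp.cost, Exp.len, Exp.eval_eq] at h1 ⊢
    nlinarith
  | op o e f ihe ihf =>
    have he : e.Fits v a (2 ^ W) := by cases o <;> first | exact h.1 | exact h.1.1
    have hf : f.Fits v a (2 ^ W) := by cases o <;> first | exact h.2 | exact h.1.2
    have h1 := ihe he
    have h2 := ihf hf
    have h3 : (e.val v a).size ≤ W := Nat.size_le.2 (he.val_lt hM)
    have h4 : (f.val v a).size ≤ W := Nat.size_le.2 (hf.val_lt hM)
    have h5 : (e.val v a).size * (f.val v a).size ≤ W * W := Nat.mul_le_mul h3 h4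
    simp only [Exp.time, Exp.cost, Exp.len, Exp.eval_eq] at h1 h2 ⊢
    have h6 : o.cost (e.val v a) (f.val v a) ≤ (W + 1) ^ 2 := by
      cases o <;> simp only [Op.cost] <;> nlinarith
    linarith

/-- `Runs orc p v a t Q`: started with variables `v` and arrays `a`, the program `p` halts within
`t` units of time in a single memory (that is, whatever its random draws), which satisfies `Q`. -/
def Runs (orc : Option Oracle) (p : Prog) (v : ℕ → ℕ) (a : ℕ → ℕ → ℕ) (t : ℕ)
    (Q : (ℕ → ℕ) → (ℕ → ℕ → ℕ) → Prop) : Prop :=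
  ∀ c, ∃ v' a' c', Exec orc p ⟨v, a, c⟩ (PMF.pure ⟨v', a', c'⟩) ∧ c' ≤ c + t ∧ Q v' a'

section Rules

variable {orc : Option Oracle} {p q : Prog} {v : ℕ → ℕ} {a : ℕ → ℕ → ℕ} {t t₁ t₂ W : ℕ}
  {Q R : (ℕ → ℕ) → (ℕ → ℕ → ℕ) → Prop}

theorem Runs.mono (ht : t₁ ≤ t₂) (h : Runs orc p v a t₁ Q) : Runs orc p v a t₂ Q := by
  intro c
  obtain ⟨v', a', c', h₁, h₂, h₃⟩ := h c
  exact ⟨v', a', c', h₁, by omega, h₃⟩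

theorem Runs.imp (h : Runs orc p v a t Q) (hQ : ∀ v' a', Q v' a' → R v' a') :
    Runs orc p v a t R := by
  intro c
  obtain ⟨v', a', c', h₁, h₂, h₃⟩ := h c
  exact ⟨v', a', c', h₁, h₂, hQ _ _ h₃⟩

theorem Runs.frame (h : Runs orc p v a t Q) :
    Runs orc p v a t fun v' a' =>
      Q v' a' ∧ (∀ x, x ∉ p.wv → v' x = v x) ∧ ∀ b, b ∉ p.wa → a' b = a b := by
  intro c
  obtain ⟨v', a', c', h₁, h₂, h₃⟩ := h c
  exact ⟨v', a', c', h₁, h₂, h₃, h₁.frame ⟨v', a', c'⟩ (by rw [PMF.support_pure]; rfl)⟩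

theorem Runs.skip (h : Q v a) : Runs orc .skip v a 1 Q :=
  fun c => ⟨v, a, c + 1, Exec.skip _, le_rfl, h⟩

theorem Runs.seq (h : Runs orc p v a t₁ fun v' a' => Runs orc q v' a' t₂ Q) :
    Runs orc (.seq p q) v a (t₁ + t₂) Q := by
  intro c
  obtain ⟨v₁, a₁, c₁, e₁, hc₁, h₁⟩ := h c
  obtain ⟨v₂, a₂, c₂, e₂, hc₂, h₂⟩ := h₁ c₁
  refine ⟨v₂, a₂, c₂, ?_, by omega, h₂⟩
  have := Exec.seq p q ⟨v, a, c⟩ (PMF.pure ⟨v₁, a₁, c₁⟩) (fun _ => PMF.pure ⟨v₂, a₂, c₂⟩) e₁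
    (by intro s' hs'
        rw [PMF.support_pure, Set.mem_singleton_iff] at hs'
        subst hs'
        exact e₂)
  rwa [PMF.pure_bind] at this

/-- Sequential composition, where the second program may rely on everything that the first one
does not change. -/
theorem Runs.seq_frame (h : Runs orc p v a t₁ R)
    (hR : ∀ v' a', R v' a' → (∀ x, x ∉ p.wv → v' x = v x) → (∀ b, b ∉ p.wa → a' b = a b) →
      Runs orc q v' a' t₂ Q) :
    Runs orc (.seq p q) v a (t₁ + t₂) Q :=
  Runs.seq (h.frame.imp fun v' a' h' => hR v' a' h'.1 h'.2.1 h'.2.2)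

theorem Runs.set_of_time {x : ℕ} {e : Exp} (ht : e.time v a + (e.val v a).size + 1 ≤ t)
    (h : Q (Function.update v x (e.val v a)) a) : Runs orc (.set x e) v a t Q := by
  intro c
  refine ⟨_, _, _, Exec.set x e ⟨v, a, c⟩, ?_, ?_⟩
  · simp only [State.setVar, Exp.eval_eq, Exp.cost_congr ⟨v, a, c⟩ ⟨v, a, 0⟩ rfl rfl]
    simp only [Exp.time] at ht
    omega
  · simpa only [State.setVar, Exp.eval_eq] using h

theorem Runs.set {x : ℕ} {e : Exp} (hW : 1 ≤ W) (hf : e.Fits v a (2 ^ W))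
    (h : Q (Function.update v x (e.val v a)) a) :
    Runs orc (.set x e) v a ((e.len + 1) * (W + 1) ^ 2) Q := by
  refine Runs.set_of_time ?_ h
  have h1 := hf.time_le hW
  have h2 : (e.val v a).size ≤ W := Nat.size_le.2 (hf.val_lt (Nat.one_lt_two_pow (by omega)))
  nlinarith

theorem Runs.put {b : ℕ} {e f : Exp} (hW : 1 ≤ W) (he : e.Fits v a (2 ^ W))
    (hf : f.Fits v a (2 ^ W))
    (h : Q v (Function.update a b (Function.update (a b) (e.val v a) (f.val v a)))) :
    Runs orc (.put b e f) v a ((e.len + f.len + 1) * (W + 1) ^ 2) Q := by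
  intro c
  refine ⟨_, _, _, Exec.put b e f ⟨v, a, c⟩, ?_, ?_⟩
  · have h1 := he.time_le hW
    have h2 := hf.time_le hW
    have hM : 1 < 2 ^ W := Nat.one_lt_two_pow (by omega)
    have h3 : (e.val v a).size ≤ W := Nat.size_le.2 (he.val_lt hM)
    have h4 : (f.val v a).size ≤ W := Nat.size_le.2 (hf.val_lt hM)
    simp only [State.setArr, Exp.eval_eq, Exp.cost_congr ⟨v, a, c⟩ ⟨v, a, 0⟩ rfl rfl]
    simp only [Exp.time] at h1 h2
    nlinarith
  · simpa only [State.setArr, Exp.eval_eq] using h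

theorem Runs.query {o : Oracle} {x b : ℕ} (h : Q (Function.update v x (o.answer (a b))) a) :
    Runs (some o) (.query x b) v a (o.time + (o.answer (a b)).size + 1) Q :=
  fun c => ⟨_, _, _, Exec.query o x b ⟨v, a, c⟩ rfl, by simp only [State.setVar]; omega, h⟩

theorem Runs.cond_of_time {e : Exp} (ht : e.time v a + 1 ≤ t₁)
    (hp : e.val v a ≠ 0 → Runs orc p v a t₂ Q) (hq : e.val v a = 0 → Runs orc q v a t₂ Q) :
    Runs orc (.cond e p q) v a (t₁ + t₂) Q := by
  intro c
  simp only [Exp.time] at ht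
  have hc := Exp.cost_congr ⟨v, a, c⟩ ⟨v, a, 0⟩ rfl rfl e
  by_cases h0 : e.val v a = 0
  · obtain ⟨v', a', c', h₁, h₂, h₃⟩ := hq h0 (c + (e.cost ⟨v, a, c⟩ + 1))
    exact ⟨v', a', c', Exec.cond_false e p q ⟨v, a, c⟩ _ (by rwa [Exp.eval_eq]) h₁, by omega, h₃⟩
  · obtain ⟨v', a', c', h₁, h₂, h₃⟩ := hp h0 (c + (e.cost ⟨v, a, c⟩ + 1))
    exact ⟨v', a', c', Exec.cond_true e p q ⟨v, a, c⟩ _ (by rwa [Exp.eval_eq]) h₁, by omega, h₃⟩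

theorem Runs.cond {e : Exp} (hW : 1 ≤ W) (hf : e.Fits v a (2 ^ W))
    (hp : e.val v a ≠ 0 → Runs orc p v a t₂ Q) (hq : e.val v a = 0 → Runs orc q v a t₂ Q) :
    Runs orc (.cond e p q) v a ((e.len + 1) * (W + 1) ^ 2 + t₂) Q := by
  refine Runs.cond_of_time ?_ hp hq
  have h1 := hf.time_le hW
  nlinarith

/-- `forLoop i y p` runs `p` with `i = 0, 1, …` as long as `i` is less than the variable `y`. -/
def Prog.forLoop (i y : ℕ) (p : Prog) : Prog :=
  .seq (.set i (.const 0)) (.loop (.op .lt (.var i) (.var y))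
    (.seq p (.set i (.op .add (.var i) (.const 1)))))

theorem Runs.forLoop_aux {i y : ℕ} {N : ℕ} (hW : 1 ≤ W) (hNW : N < 2 ^ W)
    (hi : i ∉ p.wv) (hy : y ∉ p.wv) (hyi : y ≠ i)
    (I : ℕ → (ℕ → ℕ) → (ℕ → ℕ → ℕ) → Prop) (v₀ : ℕ → ℕ) (a₀ : ℕ → ℕ → ℕ) (hN : v₀ y = N)
    (hs : ∀ k < N, ∀ v' a', v' i = k → (∀ x, x ∉ p.wv → x ≠ i → v' x = v₀ x) →
      (∀ b, b ∉ p.wa → a' b = a₀ b) → I k v' a' →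
      Runs orc p v' a' t fun v'' a'' => I (k + 1) (Function.update v'' i (k + 1)) a'')
    (d : ℕ) : ∀ k, k + d = N → ∀ v a, v i = k → (∀ x, x ∉ p.wv → x ≠ i → v x = v₀ x) →
      (∀ b, b ∉ p.wa → a b = a₀ b) → I k v a →
      Runs orc (.loop (.op .lt (.var i) (.var y))
        (.seq p (.set i (.op .add (.var i) (.const 1))))) v a
        (d * (t + 8 * (W + 1) ^ 2) + 4 * (W + 1) ^ 2)
        fun v' a' => v' i = N ∧ (∀ x, x ∉ p.wv → x ≠ i → v' x = v₀ x) ∧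
          (∀ b, b ∉ p.wa → a' b = a₀ b) ∧ I N v' a' := by
  have hM : 1 < 2 ^ W := Nat.one_lt_two_pow (by omega)
  induction d with
  | zero =>
    intro k hk v a hvi hv ha hI c
    have hvy : v y = N := (hv y hy hyi).trans hN
    obtain rfl : k = N := by omega
    have hf : (Exp.op .lt (.var i) (.var y)).Fits v a (2 ^ W) := by
      simp only [Exp.Fits]; omega
    have ht := hf.time_le hW
    refine ⟨v, a, _, Exec.loop_false _ _ ⟨v, a, c⟩ ?_, ?_, hvi, hv, ha, hI⟩
    · simp [Exp.eval, Op.eval, hvi, hvy]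
    · simp only [Exp.time, Exp.len] at ht
      rw [Exp.cost_congr ⟨v, a, c⟩ ⟨v, a, 0⟩ rfl rfl]
      simp only
      nlinarith
  | succ d ih =>
    intro k hk v a hvi hv ha hI c
    have hvy : v y = N := (hv y hy hyi).trans hN
    have hf : (Exp.op .lt (.var i) (.var y)).Fits v a (2 ^ W) := by
      simp only [Exp.Fits]; omega
    have ht := hf.time_le hW
    have key : Runs orc (.seq (.seq p (.set i (.op .add (.var i) (.const 1))))
        (.loop (.op .lt (.var i) (.var y)) (.seq p (.set i (.op .add (.var i) (.const 1))))))
        v a (t + 4 * (W + 1) ^ 2 + (d * (t + 8 * (W + 1) ^ 2) + 4 * (W + 1) ^ 2))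
        fun v' a' => v' i = N ∧ (∀ x, x ∉ p.wv → x ≠ i → v' x = v₀ x) ∧
          (∀ b, b ∉ p.wa → a' b = a₀ b) ∧ I N v' a' := by
      refine Runs.seq ?_
      refine Runs.seq ?_
      refine (hs k (by omega) v a hvi hv ha hI).frame.imp ?_
      rintro v' a' ⟨h₁, h₂, h₃⟩
      have hvi' : v' i = k := by rw [h₂ i hi, hvi]
      refine Runs.set hW ?_ ?_
      · simp only [Exp.Fits, Exp.val]; omega
      · simp only [Exp.val, Op.eval, hvi']
        refine ih (k + 1) (by omega) _ _ (by simp) ?_ ?_ h₁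
        · intro x hx hxi
          rw [Function.update_of_ne hxi, h₂ x hx, hv x hx hxi]
        · intro b hb
          rw [h₃ b hb, ha b hb]
    obtain ⟨v', a', c', h₁, h₂, h₃⟩ :=
      key (c + (Exp.cost ⟨v, a, c⟩ (.op .lt (.var i) (.var y)) + 1))
    refine ⟨v', a', c', Exec.loop_true _ _ ⟨v, a, c⟩ _ ?_ h₁, ?_, h₃⟩
    · simp only [Exp.eval, Op.eval, hvi, hvy]; rw [if_pos (by omega)]; exact one_ne_zero
    · simp only [Exp.time, Exp.len] at ht
      rw [Exp.cost_congr ⟨v, a, c⟩ ⟨v, a, 0⟩ rfl rfl] at h₂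
      nlinarith

/-- The invariant rule for `forLoop`. The body of the loop, and what follows it, may rely on
everything that the body does not change. -/
theorem Runs.forLoop {i y : ℕ} {N : ℕ} (hW : 1 ≤ W) (hNW : N < 2 ^ W) (hN : v y = N)
    (hi : i ∉ p.wv) (hy : y ∉ p.wv) (hyi : y ≠ i)
    (I : ℕ → (ℕ → ℕ) → (ℕ → ℕ → ℕ) → Prop) (h0 : I 0 (Function.update v i 0) a)
    (hs : ∀ k < N, ∀ v' a', v' i = k → (∀ x, x ∉ p.wv → x ≠ i → v' x = v x) →
      (∀ b, b ∉ p.wa → a' b = a b) → I k v' a' →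
      Runs orc p v' a' t fun v'' a'' => I (k + 1) (Function.update v'' i (k + 1)) a'')
    (hQ : ∀ v' a', (∀ x, x ∉ p.wv → x ≠ i → v' x = v x) →
      (∀ b, b ∉ p.wa → a' b = a b) → I N v' a' → Q v' a') :
    Runs orc (.forLoop i y p) v a (N * (t + 8 * (W + 1) ^ 2) + 6 * (W + 1) ^ 2) Q := by
  have hM : 1 < 2 ^ W := Nat.one_lt_two_pow (by omega)
  refine Runs.mono (t₁ := 2 * (W + 1) ^ 2 + (N * (t + 8 * (W + 1) ^ 2) + 4 * (W + 1) ^ 2))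
    (by linarith) ?_
  refine Runs.seq (Runs.set hW ?_ ?_)
  · simp only [Exp.Fits]; omega
  · simp only [Exp.val]
    refine (Runs.forLoop_aux hW hNW hi hy hyi I v a hN hs N 0 (by omega) _ _ (by simp) ?_
      (fun _ _ => rfl) h0).imp fun v' a' h => hQ v' a' h.2.1 h.2.2.1 h.2.2.2
    intro x _ hx
    rw [Function.update_of_ne hx]

end Rules

/-- `x` is the truth value of `P`. -/
def IsFlag (x : ℕ) (P : Prop) : Prop := (P ∧ x = 1) ∨ (¬ P ∧ x = 0)

theorem IsFlag.le_one {x : ℕ} {P : Prop} (h : IsFlag x P) : x ≤ 1 := by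
  unfold IsFlag at h; omega

theorem IsFlag.congr {x : ℕ} {P Q : Prop} (h : IsFlag x P) (hPQ : P ↔ Q) : IsFlag x Q := by
  rwa [IsFlag, ← hPQ]

theorem IsFlag.and {x y : ℕ} {P Q : Prop} (h : IsFlag x P) (h' : IsFlag y Q) :
    IsFlag (x * y) (P ∧ Q) := by
  rcases h with ⟨hP, rfl⟩ | ⟨hP, rfl⟩ <;> rcases h' with ⟨hQ, rfl⟩ | ⟨hQ, rfl⟩ <;>
    simp [IsFlag, hP, hQ]

theorem isFlag_ite (P : Prop) [Decidable P] : IsFlag (if P then 1 else 0) P := by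
  unfold IsFlag; split <;> simp_all

theorem ite_le_one (P : Prop) [Decidable P] : (if P then 1 else 0) ≤ 1 := by split <;> omega

/-! ### Twin classes -/

/-- The vertices `u` and `v` have the same neighbours apart from themselves, in the graph on
`{0, …, n - 1}` with adjacency matrix `A`. -/
def Twins (n : ℕ) (A : ℕ → ℕ) (u v : ℕ) : Prop :=
  ∀ w < n, w = v ∨ w = u ∨ A (v * n + w) = A (u * n + w)

/-- `rep 0, …, rep (r - 1)` are pairwise non-twin vertices less than `m`, and each vertex `v < m`
is a twin of the vertex `rep (cls v) ≤ v`. -/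
structure TwinClasses (n : ℕ) (A : ℕ → ℕ) (m r : ℕ) (rep cls : ℕ → ℕ) : Prop where
  card_le : r ≤ m
  rep_lt : ∀ c < r, rep c < m
  not_twins : ∀ c' < r, ∀ c < c', ¬ Twins n A (rep c) (rep c')
  cls_lt : ∀ v < m, cls v < r
  twins : ∀ v < m, Twins n A (rep (cls v)) v
  rep_le : ∀ v < m, rep (cls v) ≤ v

/-- Variable `14` tests whether the vertices in the variable `11` and in the cell `13` of the array
`1` are twins. -/
def twinTest : Prog :=
  .seq (.set 14 (.const 1))
    (.forLoop 15 0 (.set 14 (.op .mul (.var 14) (.op .lt (.const 0)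
      (.op .add (.op .eq (.var 15) (.var 11)) (.op .add (.op .eq (.var 15) (.read 1 (.var 13)))
        (.op .eq (.read 0 (.op .add (.op .mul (.var 11) (.var 0)) (.var 15)))
          (.read 0 (.op .add (.op .mul (.read 1 (.var 13)) (.var 0)) (.var 15))))))))))

theorem runs_twinTest {orc : Option Oracle} {v : ℕ → ℕ} {a : ℕ → ℕ → ℕ} {W n : ℕ} (hW : 2 ≤ W)
    (hn : n * n + n < 2 ^ W) (h0 : v 0 = n) (h11 : v 11 < n) (h13 : v 13 < n)
    (hr : a 1 (v 13) < n) (hA : ∀ i, a 0 i < 2) :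
    Runs orc twinTest v a ((38 * n + 20) * (W + 1) ^ 2)
      fun v' _ => IsFlag (v' 14) (Twins n (a 0) (a 1 (v 13)) (v 11)) := by
  have h4 : 2 ^ 2 ≤ 2 ^ W := Nat.pow_le_pow_right (by norm_num) hW
  refine Runs.mono ?_ (Runs.seq_frame (R := fun v' _ => v' 14 = 1)
    (Runs.set (W := W) (by omega) ?_ (by simp [Exp.val])) fun v' a' h14 hv ha =>
    Runs.forLoop (W := W) (t := 30 * (W + 1) ^ 2) (by omega) (N := n) ?_ ?_
    (by decide) (by decide) (by decide)
    (fun k v' _ => IsFlag (v' 14) (∀ w < k, w = v 11 ∨ w = a 1 (v 13) ∨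
      a 0 (v 11 * n + w) = a 0 (a 1 (v 13) * n + w))) ?_ ?_ ?_)
  · simp only [Exp.len]
    nlinarith [sq_nonneg (W + 1)]
  · simp only [Exp.Fits]; omega
  · omega
  · rw [hv 0 (by decide)]; exact h0
  · simp [IsFlag, h14]
  · intro k hk v'' a'' hk' hv' ha' hI
    have e0 : v'' 0 = n := by rw [hv' 0 (by decide) (by decide), hv 0 (by decide), h0]
    have e11 : v'' 11 = v 11 := by rw [hv' 11 (by decide) (by decide), hv 11 (by decide)]
    have e13 : v'' 13 = v 13 := by rw [hv' 13 (by decide) (by decide), hv 13 (by decide)]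
    have ea : a'' = a := funext fun b => by rw [ha' b (by simp [Prog.wa]), ha b (by simp [Prog.wa])]
    subst ea
    have hle := hI.le_one
    have b1 : v 11 * n + k < n * n + n := by nlinarith
    have b2 : a'' 1 (v 13) * n + k < n * n + n := by nlinarith
    refine Runs.mono (Nat.mul_le_mul_right _ (by decide)) (Runs.set (W := W) (by omega) ?_ ?_)
    · simp only [Exp.Fits, Exp.val, Op.eval, e0, e11, e13, hk']
      have := hA (v 11 * n + k)
      have := hA (a'' 1 (v 13) * n + k)
      have := ite_le_one (k = v 11)
      have := ite_le_one (k = a'' 1 (v 13))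
      have := ite_le_one (a'' 0 (v 11 * n + k) = a'' 0 (a'' 1 (v 13) * n + k))
      and_intros <;> first | omega | exact (Nat.mul_le_mul hle (ite_le_one _)).trans_lt (by omega)
    · simp only [Exp.val, Op.eval, e0, e11, e13, hk']
      rw [Function.update_of_ne (by decide), Function.update_self]
      refine (hI.and (isFlag_ite _)).congr (Iff.trans (and_congr Iff.rfl ?_)
        Nat.forall_lt_succ_right.symm)
      by_cases c1 : k = v 11 <;> by_cases c2 : k = a'' 1 (v 13) <;>
      by_cases c3 : a'' 0 (v 11 * n + k) = a'' 0 (a'' 1 (v 13) * n + k) <;>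
      simp [c1, c2, c3]
  · intro v'' a'' _ _ hI
    exact hI

/-- Determines the twin classes: their number is the variable `10`, their representatives are in
the array `1`, and the numbers of the classes of the vertices are in the array `2`. -/
def findTwinClasses : Prog :=
  .seq (.set 10 (.const 0))
    (.forLoop 11 0 (.seq (.set 12 (.var 10))
      (.seq (.forLoop 13 10 (.seq twinTest (.cond (.var 14) (.set 12 (.var 13)) .skip)))
        (.seq (.put 2 (.var 11) (.var 12))
          (.cond (.op .eq (.var 12) (.var 10))
            (.seq (.put 1 (.var 10) (.var 11)) (.set 10 (.op .add (.var 10) (.const 1))))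
            .skip)))))

theorem runs_findTwinClasses {orc : Option Oracle} {v : ℕ → ℕ} {a : ℕ → ℕ → ℕ} {W n : ℕ}
    (hW : 2 ≤ W) (hn : n * n + n < 2 ^ W) (h0 : v 0 = n) (hA : ∀ i, a 0 i < 2) :
    Runs orc findTwinClasses v a ((n * (n * (38 * n + 40) + 40) + 10) * (W + 1) ^ 2)
      fun v' a' => TwinClasses n (a 0) n (v' 10) (a' 1) (a' 2) := by
  have h4 : 2 ^ 2 ≤ 2 ^ W := Nat.pow_le_pow_right (by norm_num) hW
  have h1W : 1 ≤ W := by omega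
  refine Runs.mono ?_ (Runs.seq_frame (R := fun v' _ => v' 10 = 0)
    (Runs.set (W := W) h1W ?_ (by simp [Exp.val])) fun v₁ a₁ h10 hv₁ ha₁ =>
    Runs.forLoop (W := W) (t := (n * (38 * n + 40) + 30) * (W + 1) ^ 2) h1W (N := n) ?_ ?_
    (by decide) (by decide) (by decide)
    (fun k v' a' => TwinClasses n (a 0) k (v' 10) (a' 1) (a' 2)) ?_ ?_ ?_)
  · simp only [Exp.len]
    nlinarith [sq_nonneg (W + 1)]
  · simp only [Exp.Fits]; omega
  · omega
  · rw [hv₁ 0 (by decide)]; exact h0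
  · rw [Function.update_of_ne (by decide), h10]
    constructor <;> simp
  · intro k hk v₂ a₂ hk' hv₂ ha₂ hI
    have e0 : v₂ 0 = n := by rw [hv₂ 0 (by decide) (by decide), hv₁ 0 (by decide), h0]
    have ea : a₂ 0 = a 0 := by rw [ha₂ 0 (by decide), ha₁ 0 (by decide)]
    have hr := hI.card_le
    refine Runs.mono ?_ (Runs.seq_frame (R := fun v' _ => v' 12 = v₂ 10)
      (t₂ := (v₂ 10 * ((38 * n + 30) * (W + 1) ^ 2 + 8 * (W + 1) ^ 2) + 6 * (W + 1) ^ 2) +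
        20 * (W + 1) ^ 2) (Runs.set (W := W) h1W ?_ (by simp [Exp.val]))
        fun v₃ a₃ h12 hv₃ ha₃ => ?_)
    · simp only [Exp.len]
      have : v₂ 10 * ((38 * n + 30) * (W + 1) ^ 2 + 8 * (W + 1) ^ 2) ≤
          n * ((38 * n + 38) * (W + 1) ^ 2) := by
        refine Nat.mul_le_mul (by omega) (by linarith)
      nlinarith [sq_nonneg (W + 1), Nat.zero_le (n * (W + 1) ^ 2)]
    · simp only [Exp.Fits]; omega
    · refine Runs.seq_frame (t₂ := 20 * (W + 1) ^ 2) (R := fun v' _ =>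
          (v' 12 = v₂ 10 ∧ ∀ c < v₂ 10, ¬ Twins n (a 0) (a₂ 1 c) k) ∨
          (v' 12 < v₂ 10 ∧ Twins n (a 0) (a₂ 1 (v' 12)) k))
        (Runs.forLoop (W := W) (t := (38 * n + 30) * (W + 1) ^ 2) h1W (N := v₂ 10)
          (by omega) ?_ (by decide) (by decide) (by decide)
          (fun c v' _ => (v' 12 = v₂ 10 ∧ ∀ c' < c, ¬ Twins n (a 0) (a₂ 1 c') k) ∨
          (v' 12 < v₂ 10 ∧ Twins n (a 0) (a₂ 1 (v' 12)) k)) ?_ ?_ ?_) ?_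
      · rw [hv₃ 10 (by decide)]
      · left; simpa using h12
      · intro c hc v₄ a₄ hc' hv₄ ha₄ hI₄
        have e0' : v₄ 0 = n := by rw [hv₄ 0 (by decide) (by decide), hv₃ 0 (by decide), e0]
        have e11 : v₄ 11 = k := by rw [hv₄ 11 (by decide) (by decide), hv₃ 11 (by decide), hk']
        have e1 : a₄ 1 = a₂ 1 := by rw [ha₄ 1 (by decide), ha₃ 1 (by decide)]
        have ea₄ : a₄ 0 = a 0 := by rw [ha₄ 0 (by decide), ha₃ 0 (by decide), ea]
        refine Runs.mono ?_ (Runs.seq_frame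
          (runs_twinTest hW hn e0' (by omega) (by omega) ?_ (by rwa [ea₄])) fun v₅ a₅ hI₅ hv₅ ha₅ =>
          Runs.cond (W := W) (t₂ := 2 * (W + 1) ^ 2) h1W ?_ (fun h => ?_) (fun h => ?_))
        · simp only [Exp.len]; nlinarith [sq_nonneg (W + 1)]
        · rw [hc', e1]; exact (hI.rep_lt c hc).trans hk
        · simp only [Exp.Fits]
          have := hI₅.le_one
          omega
        · have e13 : v₅ 13 = c := by rw [hv₅ 13 (by decide), hc']
          refine Runs.mono (Nat.mul_le_mul_right _ (by decide)) (Runs.set (W := W) h1W ?_ ?_)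
          · simp only [Exp.Fits]; omega
          · right
            simp only [Exp.val] at h
            simp only [IsFlag, e1, hc', e11, ea₄] at hI₅
            simp only [Exp.val, e13]
            rw [Function.update_of_ne (by decide), Function.update_self]
            exact ⟨hc, (hI₅.resolve_right fun h' => h h'.2).1⟩
        · simp only [Exp.val] at h
          simp only [IsFlag, e1, hc', e11, ea₄] at hI₅
          refine Runs.mono ?_ (Runs.skip ?_)
          · nlinarith [sq_nonneg (W + 1)]
          · rw [Function.update_of_ne (by decide), hv₅ 12 (by decide)]
            refine hI₄.imp_left fun ⟨h₁, h₂⟩ => ⟨h₁, fun c' hc' => ?_⟩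
            rcases Nat.lt_succ_iff_lt_or_eq.1 hc' with h' | rfl
            · exact h₂ c' h'
            · rcases hI₅ with ⟨_, h'⟩ | ⟨h', _⟩
              · omega
              · exact h'
      · intro v₄ a₄ _ _ h; exact h
      · intro v₄ a₄ hI₄ hv₄ ha₄
        have e11 : v₄ 11 = k := by rw [hv₄ 11 (by decide), hv₃ 11 (by decide), hk']
        have e10 : v₄ 10 = v₂ 10 := by rw [hv₄ 10 (by decide), hv₃ 10 (by decide)]
        have e1 : a₄ 1 = a₂ 1 := by rw [ha₄ 1 (by decide), ha₃ 1 (by decide)]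
        have e2 : a₄ 2 = a₂ 2 := by rw [ha₄ 2 (by decide), ha₃ 2 (by decide)]
        have h12 : v₄ 12 ≤ v₂ 10 := by omega
        refine Runs.mono (t₁ := 3 * (W + 1) ^ 2 + (4 * (W + 1) ^ 2 + 7 * (W + 1) ^ 2)) (by omega)
          (Runs.seq (Runs.put (W := W) h1W ?_ ?_ (Runs.cond (W := W) h1W ?_ (fun h => ?_)
          fun h => ?_)))
        · simp only [Exp.Fits]; omega
        · simp only [Exp.Fits]; omega
        · simp only [Exp.Fits]; omega
        · simp only [Exp.val, Op.eval, e10, ne_eq, ite_eq_right_iff, one_ne_zero, imp_false,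
            not_not] at h
          have hI₄' : ∀ c < v₂ 10, ¬ Twins n (a 0) (a₂ 1 c) k := by
            rcases hI₄ with h' | h'
            · exact h'.2
            · omega
          refine Runs.mono (t₁ := 3 * (W + 1) ^ 2 + 4 * (W + 1) ^ 2) (by omega)
            (Runs.seq (Runs.put (W := W) h1W ?_ ?_ (Runs.set (W := W) h1W ?_ ?_)))
          · simp only [Exp.Fits]; omega
          · simp only [Exp.Fits]; omega
          · simp only [Exp.Fits, Exp.val]; omega
          · simp only [Exp.val, Op.eval, e10, e11, e2, h]
            simp only [ne_eq, OfNat.one_ne_ofNat, OfNat.ofNat_ne_one, not_false_eq_true,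
              Function.update_of_ne, Function.update_self, Nat.reduceEqDiff, e1]
            refine ⟨by omega, fun c hc => ?_, fun c' hc' c hc => ?_, fun u hu => ?_,
              fun u hu => ?_, fun u hu => ?_⟩
            · rcases Nat.lt_succ_iff_lt_or_eq.1 hc with h' | rfl
              · rw [Function.update_of_ne h'.ne]; exact (hI.rep_lt c h').trans k.lt_succ_self
              · simp
            · rcases Nat.lt_succ_iff_lt_or_eq.1 hc' with h' | rfl
              · rw [Function.update_of_ne h'.ne, Function.update_of_ne (by omega)]
                exact hI.not_twins c' h' c hc
              · rw [Function.update_self, Function.update_of_ne hc.ne]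
                exact hI₄' c hc
            · rcases Nat.lt_succ_iff_lt_or_eq.1 hu with h' | rfl
              · rw [Function.update_of_ne h'.ne]; exact (hI.cls_lt u h').trans (by omega)
              · simp
            · rcases Nat.lt_succ_iff_lt_or_eq.1 hu with h' | rfl
              · rw [Function.update_of_ne h'.ne, Function.update_of_ne (hI.cls_lt u h').ne]
                exact hI.twins u h'
              · rw [Function.update_self, Function.update_self]
                exact fun w _ => Or.inr (Or.inr rfl)
            · rcases Nat.lt_succ_iff_lt_or_eq.1 hu with h' | rfl
              · rw [Function.update_of_ne h'.ne, Function.update_of_ne (hI.cls_lt u h').ne]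
                exact hI.rep_le u h'
              · rw [Function.update_self, Function.update_self]
        · simp only [Exp.val, Op.eval, e10, ite_eq_right_iff, one_ne_zero, imp_false] at h
          have hI₄' : v₄ 12 < v₂ 10 ∧ Twins n (a 0) (a₂ 1 (v₄ 12)) k := by
            rcases hI₄ with h' | h'
            · omega
            · exact h'
          refine Runs.mono ?_ (Runs.skip ?_)
          · nlinarith [sq_nonneg (W + 1)]
          · simp only [Exp.val, e11, e2]
            simp only [ne_eq, OfNat.one_ne_ofNat, not_false_eq_true,
              Function.update_of_ne, Function.update_self, Nat.reduceEqDiff, e10, e1]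
            refine ⟨by omega, fun c hc => ?_, hI.not_twins, fun u hu => ?_,
              fun u hu => ?_, fun u hu => ?_⟩
            · exact (hI.rep_lt c hc).trans k.lt_succ_self
            · rcases Nat.lt_succ_iff_lt_or_eq.1 hu with h' | rfl
              · rw [Function.update_of_ne h'.ne]; exact hI.cls_lt u h'
              · simpa using hI₄'.1
            · rcases Nat.lt_succ_iff_lt_or_eq.1 hu with h' | rfl
              · rw [Function.update_of_ne h'.ne]; exact hI.twins u h'
              · rw [Function.update_self]; exact hI₄'.2
            · rcases Nat.lt_succ_iff_lt_or_eq.1 hu with h' | rfl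
              · rw [Function.update_of_ne h'.ne]; exact hI.rep_le u h'
              · rw [Function.update_self]; exact (hI.rep_lt _ hI₄'.1).le
  · intro v' a' _ _ h; exact h

/-! ### The sample parameter and the threshold -/

/-- Stores `n * (n - 1) / 2` in the variable `20` and its power of two in the variable `21`. -/
def computeTwoPow : Prog :=
  .seq (.set 20 (.op .div (.op .mul (.var 0) (.op .sub (.var 0) (.const 1))) (.const 2)))
    (.seq (.set 21 (.const 1)) (.forLoop 22 20 (.set 21 (.op .add (.var 21) (.var 21)))))

theorem runs_computeTwoPow {orc : Option Oracle} {v : ℕ → ℕ} {a : ℕ → ℕ → ℕ} {W n : ℕ}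
    (hW : n * n + 2 ≤ W) (h0 : v 0 = n) :
    Runs orc computeTwoPow v a ((12 * (n * n) + 20) * (W + 1) ^ 2)
      fun v' _ => v' 21 = 2 ^ n.choose 2 := by
  have hM : n * n + 2 < 2 ^ W := (Nat.lt_two_pow_self).trans_le (Nat.pow_le_pow_right (by omega) hW)
  have h4 : 2 ^ 2 ≤ 2 ^ W := Nat.pow_le_pow_right (by norm_num) (by omega)
  have h1W : 1 ≤ W := by omega
  have hN : n.choose 2 ≤ n * n := by
    rw [Nat.choose_two_right]
    exact (Nat.div_le_self _ _).trans (Nat.mul_le_mul_left _ (Nat.sub_le _ _))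
  have hn : n * (n - 1) ≤ n * n := Nat.mul_le_mul_left _ (Nat.sub_le _ _)
  have hnn : n ≤ n * n := Nat.le_mul_self n
  refine Runs.mono (t₁ := 8 * (W + 1) ^ 2 + (2 * (W + 1) ^ 2 +
    (n.choose 2 * (4 * (W + 1) ^ 2 + 8 * (W + 1) ^ 2) + 6 * (W + 1) ^ 2))) ?_
    (Runs.seq (Runs.set h1W ?_ (Runs.seq (Runs.set h1W ?_ (Runs.forLoop h1W ?_ ?_
      (by decide) (by decide) (by decide) (fun k v' _ => v' 21 = 2 ^ k) ?_ ?_ ?_)))))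
  · nlinarith [Nat.mul_le_mul_right ((W + 1) ^ 2) hN]
  · simp only [Exp.Fits, Exp.val, Op.eval, h0]
    and_intros <;> omega
  · simp only [Exp.Fits]; omega
  · omega
  · simp [Exp.val, Op.eval, h0, Nat.choose_two_right]
  · simp [Exp.val]
  · intro k hk v' a' hk' _ _ hI
    have : 2 ^ (k + 1) < 2 ^ W := Nat.pow_lt_pow_right (by norm_num) (by omega)
    rw [pow_succ] at this
    refine Runs.set h1W ?_ ?_
    · simp only [Exp.Fits, Exp.val, hI]; omega
    · simp only [Exp.val, Op.eval, hI]
      rw [Function.update_of_ne (by decide), Function.update_self, pow_succ]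
      omega
  · intro v' a' _ _ h; exact h

/-- Stores `((r + 1) / 2)!` in the variable `24`, where `r` is the variable `10`. -/
def computeFactorial : Prog :=
  .seq (.set 24 (.const 1))
    (.seq (.set 25 (.op .div (.op .add (.var 10) (.const 1)) (.const 2)))
      (.forLoop 26 25 (.set 24 (.op .mul (.var 24) (.op .add (.var 26) (.const 1))))))

theorem factorial_lt_two_pow {n m W : ℕ} (hW : n * n + 2 ≤ W) (hm : m ≤ n) :
    m.factorial < 2 ^ W := by
  calc m.factorial ≤ n.factorial := Nat.factorial_le hm
    _ ≤ n ^ n := Nat.factorial_le_pow n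
    _ ≤ (2 ^ n) ^ n := Nat.pow_le_pow_left Nat.lt_two_pow_self.le n
    _ = 2 ^ (n * n) := (pow_mul _ _ _).symm
    _ < 2 ^ W := Nat.pow_lt_pow_right (by norm_num) (by omega)

theorem runs_computeFactorial {orc : Option Oracle} {v : ℕ → ℕ} {a : ℕ → ℕ → ℕ} {W n r : ℕ}
    (hW : n * n + 2 ≤ W) (hr : v 10 = r) (hrn : r ≤ n) :
    Runs orc computeFactorial v a ((20 * n + 20) * (W + 1) ^ 2)
      fun v' _ => v' 24 = ((r + 1) / 2).factorial := by
  have hM : n * n + 2 < 2 ^ W := (Nat.lt_two_pow_self).trans_le (Nat.pow_le_pow_right (by omega) hW)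
  have h1W : 1 ≤ W := by omega
  have hnn : n ≤ n * n := Nat.le_mul_self n
  have hr2 : (r + 1) / 2 ≤ n := by omega
  refine Runs.mono (t₁ := 2 * (W + 1) ^ 2 + (6 * (W + 1) ^ 2 +
    ((r + 1) / 2 * (8 * (W + 1) ^ 2 + 8 * (W + 1) ^ 2) + 6 * (W + 1) ^ 2))) ?_
    (Runs.seq (Runs.set h1W ?_ (Runs.seq (Runs.set h1W ?_ (Runs.forLoop h1W ?_ ?_
      (by decide) (by decide) (by decide) (fun k v' _ => v' 24 = k.factorial) ?_ ?_ ?_)))))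
  · nlinarith [Nat.mul_le_mul_right ((W + 1) ^ 2) hr2]
  · simp only [Exp.Fits]; omega
  · simp [Exp.Fits, Exp.val, hr]; omega
  · omega
  · simp [Exp.val, Op.eval, hr]
  · simp [Exp.val]
  · intro k hk v' a' hk' _ _ hI
    have h1 := factorial_lt_two_pow hW (show k + 1 ≤ n by omega)
    have h2 := factorial_lt_two_pow hW (show k ≤ n by omega)
    rw [Nat.factorial_succ, mul_comm] at h1
    refine Runs.mono (Nat.mul_le_mul_right _ (by decide)) (Runs.set (W := W) h1W ?_ ?_)
    · simp only [Exp.Fits, Exp.val, Op.eval, hI, hk']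
      exact ⟨⟨h2, ⟨by omega, by omega⟩, by omega⟩, h1⟩
    · simp only [Exp.val, Op.eval, hI, hk']
      rw [Function.update_of_ne (by decide), Function.update_self, Nat.factorial_succ, mul_comm]
  · intro v' a' _ _ h; exact h

/-- Stores `2 ^ N / (2 * m - 2 ^ N) + 1`, which is about `1 / ε`, in the variable `23`, and the
threshold for the sizes of isomorphism classes in the variable `27`. The constant `144 = 16 * 9`
makes it at least `16 * n ^ 2 / ε ^ 2`, as the variable `23` is at least `1 / (3 * ε)`. -/
def computeThreshold : Prog :=
  .seq computeTwoPow
    (.seq (.set 23 (.op .add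
        (.op .div (.var 21) (.op .sub (.op .add (.var 2) (.var 2)) (.var 21))) (.const 1)))
      (.seq computeFactorial
        (.set 27 (.op .mul (.op .mul (.const 144) (.op .mul (.var 0) (.var 0)))
          (.op .mul (.var 23) (.var 23))))))

/-- The number `2 ^ N / (2 * m - 2 ^ N) + 1`, where `N` is the number of pairs of vertices. If `m`
is `(1 / 2 + ε) * 2 ^ N`, this is between `1 / (3 * ε)` and `1 / ε`. This holds up to rounding,
which `invGap_bounds` takes into account. -/
def invGap (n m : ℕ) : ℕ := 2 ^ n.choose 2 / (m + m - 2 ^ n.choose 2) + 1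

theorem invGap_sq_le (n m : ℕ) : invGap n m * invGap n m ≤ 2 ^ (n * n + 2) := by
  have h1 : invGap n m ≤ 2 ^ (n.choose 2 + 1) := by
    have := Nat.div_le_self (2 ^ n.choose 2) (m + m - 2 ^ n.choose 2)
    have := Nat.one_le_two_pow (n := n.choose 2)
    unfold invGap
    rw [pow_succ]; omega
  refine (Nat.mul_le_mul h1 h1).trans ?_
  rw [← pow_add]
  refine Nat.pow_le_pow_right (by norm_num) ?_
  have h2 : n.choose 2 * 2 ≤ n * n := by
    rw [Nat.choose_two_right]
    exact (Nat.div_mul_le_self _ _).trans (Nat.mul_le_mul_left _ (Nat.sub_le _ _))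
  omega

theorem runs_computeThreshold {orc : Option Oracle} {v : ℕ → ℕ} {a : ℕ → ℕ → ℕ} {W n m r : ℕ}
    (hW : 2 * (n * n) + 20 ≤ W) (h0 : v 0 = n) (hm : v 2 = m) (hmN : m ≤ 2 ^ n.choose 2)
    (hr : v 10 = r) (hrn : r ≤ n) :
    Runs orc computeThreshold v a ((12 * (n * n) + 20 * n + 100) * (W + 1) ^ 2)
      fun v' _ => v' 23 = invGap n m ∧ v' 24 = ((r + 1) / 2).factorial ∧
        v' 27 = 144 * (n * n) * (invGap n m * invGap n m) := by
  have h1W : 1 ≤ W := by omega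
  have hM : n * n + 2 < 2 ^ (n * n + 2) := Nat.lt_two_pow_self
  have hM' : 2 ^ (n * n + 2) * 256 * 2 ^ (n * n + 2) ≤ 2 ^ W := by
    rw [show 256 = 2 ^ 8 from rfl, ← pow_add, ← pow_add]
    exact Nat.pow_le_pow_right (by norm_num) (by omega)
  have hsq := invGap_sq_le n m
  have hnn : n ≤ n * n := Nat.le_mul_self n
  have hN : n.choose 2 ≤ n * n := by
    rw [Nat.choose_two_right]
    exact (Nat.div_le_self _ _).trans (Nat.mul_le_mul_left _ (Nat.sub_le _ _))
  have hpw : 2 ^ n.choose 2 ≤ 2 ^ (n * n + 2) := Nat.pow_le_pow_right (by norm_num) (by omega)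
  have hbig : 256 * 2 ^ (n * n + 2) ≤ 2 ^ W := by nlinarith
  refine Runs.mono (t₁ := (12 * (n * n) + 20) * (W + 1) ^ 2 + (10 * (W + 1) ^ 2 +
    ((20 * n + 20) * (W + 1) ^ 2 + 10 * (W + 1) ^ 2))) (by nlinarith [sq_nonneg (W + 1)])
    (Runs.seq_frame (runs_computeTwoPow (n := n) (by omega) h0) fun v₁ a₁ h21 hv₁ _ =>
    Runs.seq_frame (R := fun v' _ => v' 23 = invGap n m) (Runs.set h1W ?_ ?_)
      fun v₂ a₂ h23 hv₂ _ =>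
    Runs.seq_frame (runs_computeFactorial (n := n) (by omega)
        (by rw [hv₂ 10 (by decide), hv₁ 10 (by decide), hr]) hrn)
      fun v₃ a₃ h24 hv₃ _ => Runs.set h1W ?_ ?_)
  · have : v₁ 2 = m := by rw [hv₁ 2 (by decide), hm]
    have := Nat.div_le_self (2 ^ n.choose 2) (m + m - 2 ^ n.choose 2)
    simp only [Exp.Fits, Exp.val, Op.eval, h21, hv₁ 2 (by decide), hm]
    and_intros <;> omega
  · simp [Exp.val, Op.eval, h21, hv₁ 2 (by decide), hm, invGap]
  · have e0 : v₃ 0 = n := by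
      rw [hv₃ 0 (by decide), hv₂ 0 (by decide), hv₁ 0 (by decide), h0]
    have e23 : v₃ 23 = invGap n m := by rw [hv₃ 23 (by decide), h23]
    have : 144 * (n * n) * (invGap n m * invGap n m) < 2 ^ W := by nlinarith
    have : invGap n m ≤ invGap n m * invGap n m := Nat.le_mul_self _
    simp only [Exp.Fits, Exp.val, Op.eval, e0, e23]
    and_intros <;> omega
  · have e0 : v₃ 0 = n := by
      rw [hv₃ 0 (by decide), hv₂ 0 (by decide), hv₁ 0 (by decide), h0]
    have e23 : v₃ 23 = invGap n m := by rw [hv₃ 23 (by decide), h23]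
    simp [Exp.val, Op.eval, e0, e23, h24]

/-! ### Counting cliques by the twin classes that they meet -/

/-- The vertices in `U` are pairwise adjacent, for the adjacency matrix `A`. -/
def IsCliqueOf (n : ℕ) (A : ℕ → ℕ) (U : Finset ℕ) : Prop :=
  ∀ u ∈ U, ∀ w ∈ U, u ≠ w → A (u * n + w) ≠ 0

/-- The set of the classes that meet `U`, as the number with these binary digits. -/
def classMask (cls : ℕ → ℕ) (U : Finset ℕ) : ℕ := ∑ c ∈ U.image cls, 2 ^ c

open Classical in
/-- The number of cliques with `j` vertices, all less than `v`, that meet exactly the classes in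
the mask `T`. -/
noncomputable def maskedCliques (n : ℕ) (A cls : ℕ → ℕ) (v T j : ℕ) : ℕ :=
  ((Finset.range v).powerset.filter fun U =>
    IsCliqueOf n A U ∧ U.card = j ∧ classMask cls U = T).card

/-- The vertex `v` is adjacent to the representatives of all classes in the mask `T`. -/
def Compat (n : ℕ) (A : ℕ → ℕ) (r : ℕ) (rep : ℕ → ℕ) (v T : ℕ) : Prop :=
  ∀ c < r, T / 2 ^ c % 2 = 1 → A (v * n + rep c) ≠ 0

theorem testBit_classMask (cls : ℕ → ℕ) (U : Finset ℕ) (c : ℕ) :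
    (classMask cls U).testBit c ↔ c ∈ U.image cls := by
  rw [← Nat.mem_bitIndices, ← List.mem_toFinset, classMask, Finset.toFinset_bitIndices_sum_two_pow]

theorem classMask_insert_of_mem {cls : ℕ → ℕ} {U : Finset ℕ} {v : ℕ} (h : cls v ∈ U.image cls) :
    classMask cls (insert v U) = classMask cls U := by
  rw [classMask, Finset.image_insert, Finset.insert_eq_of_mem h, classMask]

theorem classMask_insert_of_notMem {cls : ℕ → ℕ} {U : Finset ℕ} {v : ℕ}
    (h : cls v ∉ U.image cls) :
    classMask cls (insert v U) = 2 ^ cls v + classMask cls U := by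
  rw [classMask, Finset.image_insert, Finset.sum_insert h, classMask]

theorem testBit_sub_two_pow {T c : ℕ} (h : T.testBit c) :
    2 ^ c ≤ T ∧ (T - 2 ^ c).testBit c = false := by
  have h1 : 2 ^ c ≤ T := Nat.ge_two_pow_of_testBit h
  refine ⟨h1, ?_⟩
  have := Nat.testBit_two_pow_add_eq (T - 2 ^ c) c
  rw [Nat.add_sub_cancel' h1, h] at this
  simpa using this.symm

theorem classMask_insert_eq_iff {cls : ℕ → ℕ} {U : Finset ℕ} {v T : ℕ} :
    classMask cls (insert v U) = T ↔ T.testBit (cls v) ∧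
      (classMask cls U = T ∨ classMask cls U = T - 2 ^ cls v) := by
  constructor
  · rintro rfl
    refine ⟨(testBit_classMask _ _ _).2 (by simp), ?_⟩
    by_cases h : cls v ∈ U.image cls
    · left; rw [classMask_insert_of_mem h]
    · right; rw [classMask_insert_of_notMem h]; omega
  · rintro ⟨h1, rfl | h2⟩
    · exact classMask_insert_of_mem ((testBit_classMask _ _ _).1 h1)
    · have h3 := testBit_sub_two_pow h1
      rw [classMask_insert_of_notMem, h2]
      · omega
      · intro h
        rw [← testBit_classMask, h2, h3.2] at h
        exact absurd h (by simp)

/-- Whether `v` extends a clique `U` of earlier vertices depends only on the classes that `U` meets.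
-/
theorem isCliqueOf_insert {n : ℕ} {A : ℕ → ℕ} {r : ℕ} {rep cls : ℕ → ℕ}
    (hA : ∀ u < n, ∀ w < n, A (u * n + w) = A (w * n + u))
    (hT : TwinClasses n A n r rep cls) {v : ℕ} (hv : v < n) {U : Finset ℕ}
    (hU : U ⊆ Finset.range v) :
    IsCliqueOf n A (insert v U) ↔ IsCliqueOf n A U ∧ Compat n A r rep v (classMask cls U) := by
  have key : ∀ u ∈ U, A (v * n + u) = A (v * n + rep (cls u)) := by
    intro u hu
    have huv : u < v := Finset.mem_range.1 (hU hu)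
    have hun : u < n := huv.trans hv
    have h1 := hT.rep_le u hun
    have h2 := hT.twins u hun v hv
    rw [hA v hv u hun, hA v hv _ (by omega)]
    rcases h2 with h2 | h2 | h2
    · omega
    · omega
    · exact h2
  constructor
  · intro h
    refine ⟨fun u hu w hw => h u (Finset.mem_insert_of_mem hu) w (Finset.mem_insert_of_mem hw), ?_⟩
    intro c hc hb
    have : (classMask cls U).testBit c := by rw [Nat.testBit_eq_decide_div_mod_eq]; simpa using hb
    rw [testBit_classMask, Finset.mem_image] at this
    obtain ⟨u, hu, rfl⟩ := this
    rw [← key u hu]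
    have huv : u < v := Finset.mem_range.1 (hU hu)
    exact h v (Finset.mem_insert_self _ _) u (Finset.mem_insert_of_mem hu) huv.ne'
  · rintro ⟨h1, h2⟩
    have h3 : ∀ u ∈ U, A (v * n + u) ≠ 0 := by
      intro u hu
      rw [key u hu]
      have huv : u < v := Finset.mem_range.1 (hU hu)
      refine h2 _ (hT.cls_lt u (huv.trans hv)) ?_
      have := (testBit_classMask cls U (cls u)).2 (Finset.mem_image_of_mem _ hu)
      rw [Nat.testBit_eq_decide_div_mod_eq] at this
      simpa using this
    intro u hu w hw huw
    rcases Finset.mem_insert.1 hu with hu' | hu' <;> rcases Finset.mem_insert.1 hw with hw' | hw'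
    · exact absurd (hu'.trans hw'.symm) huw
    · rw [hu']; exact h3 w hw'
    · have huv := Finset.mem_range.1 (hU hu')
      rw [hw', hA u (huv.trans hv) v hv]
      exact h3 u hu'
    · exact h1 u hu' w hw' huw

open Classical in
/-- The recursion for the numbers of cliques. A clique that contains `v` arises from a clique of
earlier vertices, which either meets the class of `v` or does not. -/
theorem maskedCliques_succ {n : ℕ} {A : ℕ → ℕ} {r : ℕ} {rep cls : ℕ → ℕ}
    (hA : ∀ u < n, ∀ w < n, A (u * n + w) = A (w * n + u))
    (hT : TwinClasses n A n r rep cls) {v : ℕ} (hv : v < n) (T j : ℕ) :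
    maskedCliques n A cls (v + 1) T j = maskedCliques n A cls v T j +
      (if 0 < j ∧ T.testBit (cls v) then
        (if Compat n A r rep v T then maskedCliques n A cls v T (j - 1) else 0) +
        (if Compat n A r rep v (T - 2 ^ cls v) then
          maskedCliques n A cls v (T - 2 ^ cls v) (j - 1) else 0) else 0) := by
  have hins : Set.InjOn (insert v) (↑(Finset.range v).powerset : Set (Finset ℕ)) := by
    intro U hU U' hU' h
    simp only [Finset.coe_powerset, Set.mem_preimage, Set.mem_powerset_iff, Finset.coe_subset]
      at hU hU'
    have h1 : v ∉ U := fun h => absurd (Finset.mem_range.1 (hU h)) (lt_irrefl v)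
    have h2 : v ∉ U' := fun h => absurd (Finset.mem_range.1 (hU' h)) (lt_irrefl v)
    rw [← Finset.erase_insert h1, h, Finset.erase_insert h2]
  have hdisj : Disjoint (Finset.range v).powerset ((Finset.range v).powerset.image (insert v)) := by
    rw [Finset.disjoint_left]
    intro U hU hU'
    obtain ⟨U', -, rfl⟩ := Finset.mem_image.1 hU'
    exact absurd (Finset.mem_range.1 (Finset.mem_powerset.1 hU (Finset.mem_insert_self v U')))
      (lt_irrefl v)
  rw [maskedCliques, Finset.range_add_one, Finset.powerset_insert, Finset.filter_union,
    Finset.card_union_of_disjoint (Finset.disjoint_filter_filter hdisj), ← maskedCliques]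
  congr 1
  rw [Finset.filter_image, Finset.card_image_of_injOn (hins.mono (by
    intro U hU; exact (Finset.mem_filter.1 hU).1))]
  have hins_card : ∀ U ∈ (Finset.range v).powerset, (insert v U).card = U.card + 1 := by
    intro U hU
    rw [Finset.card_insert_of_notMem]
    exact fun h => absurd (Finset.mem_range.1 (Finset.mem_powerset.1 hU h)) (lt_irrefl v)
  by_cases hj : 0 < j ∧ T.testBit (cls v)
  · rw [if_pos hj]
    obtain ⟨hj, hb⟩ := hj
    have hlt := testBit_sub_two_pow hb
    have hne : T ≠ T - 2 ^ cls v := by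
      have := Nat.two_pow_pos (cls v)
      omega
    have e1 : ∀ T', (if Compat n A r rep v T' then maskedCliques n A cls v T' (j - 1) else 0) =
        ((Finset.range v).powerset.filter fun U => Compat n A r rep v T' ∧
          IsCliqueOf n A U ∧ U.card = j - 1 ∧ classMask cls U = T').card := by
      intro T'
      split_ifs with h <;> simp [maskedCliques, h]
    rw [e1, e1, ← Finset.card_union_of_disjoint]
    · rw [← Finset.filter_or]
      congr 1
      refine Finset.filter_congr fun U hU => ?_
      rw [isCliqueOf_insert hA hT hv (Finset.mem_powerset.1 hU), hins_card U hU,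
        classMask_insert_eq_iff]
      constructor
      · rintro ⟨⟨h1, h2⟩, h3, -, h4 | h4⟩
        · left; rw [h4] at h2; exact ⟨h2, h1, by omega, h4⟩
        · right; rw [h4] at h2; exact ⟨h2, h1, by omega, h4⟩
      · rintro (⟨h2, h1, h3, h4⟩ | ⟨h2, h1, h3, h4⟩)
        · exact ⟨⟨h1, by rwa [h4]⟩, by omega, hb, Or.inl h4⟩
        · exact ⟨⟨h1, by rwa [h4]⟩, by omega, hb, Or.inr h4⟩
    · rw [Finset.disjoint_filter]
      rintro U - ⟨-, -, -, h⟩ ⟨-, -, -, h'⟩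
      exact hne (h.symm.trans h')
  · rw [if_neg hj, Finset.card_eq_zero, Finset.filter_eq_empty_iff]
    rintro U hU ⟨-, h2, h3⟩
    rw [hins_card U hU] at h2
    exact hj ⟨by omega, (classMask_insert_eq_iff.1 h3).1⟩

theorem maskedCliques_zero (n : ℕ) (A cls : ℕ → ℕ) (T j : ℕ) :
    maskedCliques n A cls 0 T j = if T = 0 ∧ j = 0 then 1 else 0 := by
  classical
  rw [maskedCliques, Finset.range_zero, Finset.powerset_empty, Finset.filter_singleton]
  by_cases h : T = 0 ∧ j = 0
  · simp [h, IsCliqueOf, classMask]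
  · rw [if_neg h, if_neg]
    · simp
    · rintro ⟨-, h1, h2⟩
      exact h ⟨by simpa [classMask] using h2.symm, by simpa using h1.symm⟩

open Classical in
theorem maskedCliques_le (n : ℕ) (A cls : ℕ → ℕ) (v T j : ℕ) :
    maskedCliques n A cls v T j ≤ 2 ^ v := by
  refine (Finset.card_filter_le _ _).trans ?_
  rw [Finset.card_powerset, Finset.card_range]

open Classical in
/-- Each clique is counted for exactly one mask. -/
theorem sum_maskedCliques {n : ℕ} {A : ℕ → ℕ} {r : ℕ} {cls : ℕ → ℕ} (hcls : ∀ v < n, cls v < r)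
    (j : ℕ) : ∑ T ∈ Finset.range (2 ^ r), maskedCliques n A cls n T j =
      ((Finset.range n).powerset.filter fun U => IsCliqueOf n A U ∧ U.card = j).card := by
  rw [Finset.card_eq_sum_card_fiberwise (f := classMask cls) (t := Finset.range (2 ^ r))]
  · refine Finset.sum_congr rfl fun T _ => ?_
    rw [maskedCliques, Finset.filter_filter]
    simp only [and_assoc]
  · intro U hU
    have hU := Finset.mem_powerset.1 (Finset.mem_filter.1 hU).1
    rw [Finset.mem_coe, Finset.mem_range]
    refine Nat.lt_pow_two_of_testBit _ fun i hi => ?_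
    by_contra h
    rw [Bool.not_eq_false, testBit_classMask, Finset.mem_image] at h
    obtain ⟨u, hu, rfl⟩ := h
    exact absurd (hcls u (Finset.mem_range.1 (hU hu))) (by omega)

/-- Variable `y` tests whether the vertex in the variable `36` is adjacent to the representatives
of all classes in the mask in the variable `x`. -/
def compatTest (x y : ℕ) : Prog :=
  .seq (.set y (.const 1))
    (.forLoop 29 10 (.set y (.op .mul (.var y) (.op .lt (.const 0) (.op .add
      (.op .eq (.op .mod (.op .div (.var x) (.read 3 (.var 29))) (.const 2)) (.const 0))
      (.read 0 (.op .add (.op .mul (.var 36) (.var 0)) (.read 1 (.var 29)))))))))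

theorem runs_compatTest {orc : Option Oracle} {v : ℕ → ℕ} {a : ℕ → ℕ → ℕ} {W n r x y : ℕ}
    (hW : 2 * (n * n) + 20 ≤ W) (hxy : x ≠ y) (hx : x ≠ 29) (hy : y ≠ 29) (hy10 : y ≠ 10)
    (hy36 : y ≠ 36) (hy0 : y ≠ 0)
    (h0 : v 0 = n) (hv : v 36 < n) (hr : v 10 = r) (hrn : r ≤ n)
    (h3 : ∀ c < r, a 3 c = 2 ^ c) (h1 : ∀ c < r, a 1 c < n) (hA : ∀ i, a 0 i < 2)
    (hxW : v x < 2 ^ W) :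
    Runs orc (compatTest x y) v a ((30 * n + 10) * (W + 1) ^ 2)
      fun v' _ => IsFlag (v' y) (Compat n (a 0) r (a 1) (v 36) (v x)) := by
  have h1W : 1 ≤ W := by omega
  have hM : 2 * (n * n) + 20 < 2 ^ W :=
    (Nat.lt_two_pow_self).trans_le (Nat.pow_le_pow_right (by omega) hW)
  have hnn : n ≤ n * n := Nat.le_mul_self n
  refine Runs.mono ?_ (Runs.seq_frame (R := fun v' _ => v' y = 1)
    (Runs.set (W := W) (by omega) ?_ (by simp [Exp.val])) fun v₁ a₁ hy1 hv₁ ha₁ =>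
    Runs.forLoop (W := W) (t := 21 * (W + 1) ^ 2) (by omega) (N := r) ?_ ?_
    ?_ ?_ (by decide)
    (fun k v' _ => IsFlag (v' y) (∀ c < k, v x / 2 ^ c % 2 = 1 → a 0 (v 36 * n + a 1 c) ≠ 0))
    ?_ ?_ ?_)
  · simp only [Exp.len]
    nlinarith [Nat.mul_le_mul_right ((W + 1) ^ 2) hrn]
  · simp only [Exp.Fits]; omega
  · omega
  · rw [hv₁ 10 (by simp [Prog.wv, hy10.symm]), hr]
  · simp [Prog.wv, hy.symm]
  · simp [Prog.wv, hy10.symm]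
  · left; simp [Function.update_of_ne hy, hy1]
  · intro c hc v₂ a₂ hk' hv₂ ha₂ hI
    have e0 : v₂ 0 = n := by
      rw [hv₂ 0 (by simp [Prog.wv, hy0.symm]) (by decide),
        hv₁ 0 (by simp [Prog.wv, hy0.symm]), h0]
    have e36 : v₂ 36 = v 36 := by
      rw [hv₂ 36 (by simp [Prog.wv, hy36.symm]) (by decide),
        hv₁ 36 (by simp [Prog.wv, hy36.symm])]
    have ex : v₂ x = v x := by
      rw [hv₂ x (by simp [Prog.wv, hxy]) hx, hv₁ x (by simp [Prog.wv, hxy])]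
    have ea : a₂ = a := funext fun b => by
      rw [ha₂ b (by simp [Prog.wa]), ha₁ b (by simp [Prog.wa])]
    subst ea
    have hle := hI.le_one
    have hc1 := h1 c hc
    have b1 : v 36 * n + a₂ 1 c < n * n := by nlinarith
    have hA' := hA (v 36 * n + a₂ 1 c)
    have hpc : 2 ^ c < 2 ^ W := Nat.pow_lt_pow_right (by norm_num) (by omega)
    refine Runs.set (W := W) h1W ?_ ?_
    · simp only [Exp.Fits, Exp.val, Op.eval, e0, e36, ex, hk', h3 c hc]
      have := ite_le_one (v x / 2 ^ c % 2 = 0)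
      and_intros <;> first | omega | exact (Nat.mul_le_mul hle (ite_le_one _)).trans_lt (by omega)
    · simp only [Exp.val, Op.eval, e0, e36, ex, hk', h3 c hc]
      rw [Function.update_of_ne hy, Function.update_self]
      refine (hI.and (isFlag_ite _)).congr (Iff.trans (and_congr Iff.rfl ?_)
        Nat.forall_lt_succ_right.symm)
      by_cases hb : v x / 2 ^ c % 2 = 0
      · simp [hb]
      · have hb' : v x / 2 ^ c % 2 = 1 := by omega
        simp [hb', Nat.pos_iff_ne_zero]
  · intro v'' a'' _ _ hI
    exact hI

/-- Stores `2 ^ r` in the variable `30` and the smaller powers of two in the array `3`, where `r`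
is the variable `10`. -/
def computePowers : Prog :=
  .seq (.set 30 (.const 1))
    (.forLoop 31 10 (.seq (.put 3 (.var 31) (.var 30)) (.set 30 (.op .add (.var 30) (.var 30)))))

theorem runs_computePowers {orc : Option Oracle} {v : ℕ → ℕ} {a : ℕ → ℕ → ℕ} {W n r : ℕ}
    (hW : 2 * (n * n) + 20 ≤ W) (hr : v 10 = r) (hrn : r ≤ n) :
    Runs orc computePowers v a ((15 * n + 10) * (W + 1) ^ 2)
      fun v' a' => v' 30 = 2 ^ r ∧ ∀ c < r, a' 3 c = 2 ^ c := by
  have h1W : 1 ≤ W := by omega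
  have hM : 2 * (n * n) + 20 < 2 ^ W :=
    (Nat.lt_two_pow_self).trans_le (Nat.pow_le_pow_right (by omega) hW)
  have hnn : n ≤ n * n := Nat.le_mul_self n
  refine Runs.mono ?_ (Runs.seq_frame (R := fun v' _ => v' 30 = 1)
    (Runs.set (W := W) (by omega) ?_ (by simp [Exp.val])) fun v₁ a₁ h30 hv₁ ha₁ =>
    Runs.forLoop (W := W) (t := 3 * (W + 1) ^ 2 + 4 * (W + 1) ^ 2) (by omega) (N := r) ?_ ?_
    (by decide) (by decide) (by decide)
    (fun k v' a' => v' 30 = 2 ^ k ∧ ∀ c < k, a' 3 c = 2 ^ c) ?_ ?_ ?_)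
  · simp only [Exp.len]
    nlinarith [Nat.mul_le_mul_right ((W + 1) ^ 2) hrn]
  · simp only [Exp.Fits]; omega
  · omega
  · rw [hv₁ 10 (by decide), hr]
  · simp [h30]
  · rintro k hk v₂ a₂ hk' hv₂ ha₂ ⟨hI, hI'⟩
    have hlt : 2 ^ (k + 1) < 2 ^ W := Nat.pow_lt_pow_right (by norm_num) (by omega)
    rw [pow_succ] at hlt
    refine Runs.seq (Runs.put h1W ?_ ?_ (Runs.set h1W ?_ ?_))
    · simp only [Exp.Fits]; omega
    · simp only [Exp.Fits]; omega
    · simp only [Exp.Fits, Exp.val]; omega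
    · simp only [Exp.val, Op.eval, hI, hk', Function.update_self]
      refine ⟨?_, fun c hc => ?_⟩
      · rw [Function.update_of_ne (by decide), Function.update_self, pow_succ]; omega
      · rcases Nat.lt_succ_iff_lt_or_eq.1 hc with h | rfl
        · rw [Function.update_of_ne h.ne, hI' c h]
        · rw [Function.update_self]
  · intro v' a' _ _ h; exact h

/-- One entry of the table of the numbers `maskedCliques`. The table is stored in the array `5`,
row after row, the entry for `v`, `T` and `j` in the cell `(v * P + T) * (n + 2) + j`. -/
def tableStep : Prog :=
  .seq (.set 34 (.op .div (.var 33) (.var 32)))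
    (.seq (.set 35 (.op .mod (.var 33) (.var 32)))
    (.seq (.set 36 (.op .div (.var 34) (.var 30)))
    (.seq (.set 39 (.op .mod (.var 34) (.var 30)))
    (.seq (.set 31 (.read 3 (.read 2 (.var 36))))
    (.seq (.set 28 (.op .sub (.var 39) (.var 31)))
    (.seq (compatTest 39 40) (.seq (compatTest 28 41)
    (.put 5 (.op .add (.var 37) (.var 33))
      (.op .add (.read 5 (.var 33))
        (.op .mul (.op .mul (.op .lt (.const 0) (.var 35))
            (.op .mod (.op .div (.var 39) (.var 31)) (.const 2)))
          (.op .add (.op .mul (.var 40) (.read 5 (.op .sub (.var 33) (.const 1))))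
            (.op .mul (.var 41) (.read 5 (.op .sub (.op .sub (.var 33) (.const 1))
              (.op .mul (.var 31) (.var 32)))))))))))))))) 

/-- The entry of the table in the cell `y`. -/
noncomputable def tableEntry (n : ℕ) (A cls : ℕ → ℕ) (P y : ℕ) : ℕ :=
  maskedCliques n A cls (y / (n + 2) / P) (y / (n + 2) % P) (y % (n + 2))

theorem tableEntry_eq (n : ℕ) (A cls : ℕ → ℕ) {P v T j : ℕ} (hT : T < P) (hj : j < n + 2) :
    tableEntry n A cls P ((v * P + T) * (n + 2) + j) = maskedCliques n A cls v T j := by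
  have h1 : ((v * P + T) * (n + 2) + j) / (n + 2) = v * P + T := by
    rw [mul_comm, Nat.mul_add_div (by omega), Nat.div_eq_of_lt hj, add_zero]
  have h2 : ((v * P + T) * (n + 2) + j) % (n + 2) = j := by
    rw [mul_comm, Nat.mul_add_mod, Nat.mod_eq_of_lt hj]
  have h3 : (v * P + T) / P = v := by
    rw [mul_comm, Nat.mul_add_div (by omega), Nat.div_eq_of_lt hT, add_zero]
  have h4 : (v * P + T) % P = T := by
    rw [mul_comm, Nat.mul_add_mod, Nat.mod_eq_of_lt hT]
  rw [tableEntry, h1, h2, h3, h4]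

theorem table_size_lt {n W : ℕ} (hW : 2 * (n * n) + 20 ≤ W) :
    16 * (2 ^ n * (n + 2) * (n + 2)) < 2 ^ W := by
  have hW' : 3 * n + 8 < W := by nlinarith [sq_nonneg ((n : ℤ) - 1)]
  have hnlt : n < 2 ^ n := Nat.lt_two_pow_self
  have : n + 2 ≤ 2 * 2 ^ n := by omega
  calc 16 * (2 ^ n * (n + 2) * (n + 2)) ≤ 16 * (2 ^ n * (2 * 2 ^ n) * (2 * 2 ^ n)) := by gcongr
    _ = 2 ^ (3 * n + 6) := by ring
    _ < 2 ^ W := Nat.pow_lt_pow_right (by norm_num) (by omega)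

theorem runs_tableStep {orc : Option Oracle} {v : ℕ → ℕ} {a : ℕ → ℕ → ℕ} {W n r k : ℕ}
    (hW : 2 * (n * n) + 20 ≤ W) (h0 : v 0 = n) (hr : v 10 = r)
    (hT : TwinClasses n (a 0) n r (a 1) (a 2)) (hA : ∀ i, a 0 i < 2)
    (hsym : ∀ u < n, ∀ w < n, a 0 (u * n + w) = a 0 (w * n + u))
    (h3 : ∀ c < r, a 3 c = 2 ^ c) (h30 : v 30 = 2 ^ r) (h32 : v 32 = n + 2)
    (h37 : v 37 = 2 ^ r * (n + 2)) (h33 : v 33 = k) (hk : k < n * (2 ^ r * (n + 2)))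
    (h5 : ∀ y < 2 ^ r * (n + 2) + k, a 5 y = tableEntry n (a 0) (a 2) (2 ^ r) y) :
    Runs orc tableStep v a ((60 * n + 80) * (W + 1) ^ 2)
      fun _ a' => ∀ y < 2 ^ r * (n + 2) + (k + 1),
        a' 5 y = tableEntry n (a 0) (a 2) (2 ^ r) y := by
  have h1W : 1 ≤ W := by omega
  have hrn : r ≤ n := hT.card_le
  have hnn : n ≤ n * n := Nat.le_mul_self n
  have hnlt : n < 2 ^ n := Nat.lt_two_pow_self
  have hPn : 2 ^ r ≤ 2 ^ n := Nat.pow_le_pow_right (by norm_num) hrn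
  have h2n : 1 ≤ 2 ^ n := Nat.one_le_two_pow
  have hP0 : 0 < 2 ^ r := Nat.two_pow_pos r
  have hM1 := table_size_lt hW
  have hS : 2 ^ r * (n + 2) + n * (2 ^ r * (n + 2)) ≤ 2 ^ n * (n + 2) * (n + 2) := by
    calc 2 ^ r * (n + 2) + n * (2 ^ r * (n + 2)) ≤ 2 ^ r * (n + 2) * (n + 2) := by nlinarith
      _ ≤ _ := by gcongr
  have hSn : 2 ^ n * (n + 2) ≤ 2 ^ n * (n + 2) * (n + 2) := Nat.le_mul_of_pos_right _ (by omega)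
  have hnS : 2 ^ n ≤ 2 ^ n * (n + 2) := Nat.le_mul_of_pos_right _ (by omega)
  have hnS' : n + 2 ≤ 2 ^ n * (n + 2) := Nat.le_mul_of_pos_left _ (by omega)
  obtain ⟨g, j, hj, hkg⟩ : ∃ g j, j < n + 2 ∧ k = g * (n + 2) + j :=
    ⟨k / (n + 2), k % (n + 2), Nat.mod_lt _ (by omega), (Nat.div_add_mod' _ _).symm⟩
  obtain ⟨u, T, hTP, hgu⟩ : ∃ u T, T < 2 ^ r ∧ g = u * 2 ^ r + T :=
    ⟨g / 2 ^ r, g % 2 ^ r, Nat.mod_lt _ hP0, (Nat.div_add_mod' _ _).symm⟩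
  have hu : u < n := by
    by_contra h
    push Not at h
    have : n * 2 ^ r * (n + 2) ≤ g * (n + 2) :=
      Nat.mul_le_mul_right _ ((Nat.mul_le_mul_right _ h).trans (by omega))
    rw [mul_assoc] at this
    omega
  have hkdiv : k / (n + 2) = g := by
    rw [hkg, mul_comm, Nat.mul_add_div (by omega), Nat.div_eq_of_lt hj, add_zero]
  have hkmod : k % (n + 2) = j := by
    rw [hkg, mul_comm, Nat.mul_add_mod, Nat.mod_eq_of_lt hj]
  have hgdiv : g / 2 ^ r = u := by
    rw [hgu, mul_comm, Nat.mul_add_div hP0, Nat.div_eq_of_lt hTP, add_zero]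
  have hgmod : g % 2 ^ r = T := by
    rw [hgu, mul_comm, Nat.mul_add_mod, Nat.mod_eq_of_lt hTP]
  have hcls := hT.cls_lt u hu
  set c := a 2 u with hc
  have hcP : 2 ^ c < 2 ^ r := Nat.pow_lt_pow_right (by norm_num) hcls
  have hgk : g ≤ k := by rw [← hkdiv]; exact Nat.div_le_self _ _
  -- All reads from the table are in cells that have been filled.
  have hD : ∀ y ≤ k, a 5 y = tableEntry n (a 0) (a 2) (2 ^ r) y ∧ a 5 y ≤ 2 ^ n := by
    intro y hy
    have hlt : y < 2 ^ r * (n + 2) + k := by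
      have := Nat.mul_pos hP0 (show 0 < n + 2 by omega)
      omega
    refine ⟨h5 y hlt, ?_⟩
    rw [h5 y hlt, tableEntry]
    refine (maskedCliques_le _ _ _ _ _ _).trans (Nat.pow_le_pow_right (by norm_num) ?_)
    calc y / (n + 2) / 2 ^ r ≤ k / (n + 2) / 2 ^ r :=
          Nat.div_le_div_right (Nat.div_le_div_right hy)
      _ ≤ n := by rw [hkdiv, hgdiv]; exact hu.le
  refine Runs.mono (t₁ := 4 * (W + 1) ^ 2 + (4 * (W + 1) ^ 2 + (4 * (W + 1) ^ 2 + (4 * (W + 1) ^ 2 +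
    (4 * (W + 1) ^ 2 + (4 * (W + 1) ^ 2 + ((30 * n + 10) * (W + 1) ^ 2 +
    ((30 * n + 10) * (W + 1) ^ 2 + 34 * (W + 1) ^ 2)))))))) (by nlinarith [sq_nonneg (W + 1)]) ?_
  refine Runs.seq (Runs.set h1W ?_ (Runs.seq (Runs.set h1W ?_ (Runs.seq (Runs.set h1W ?_
    (Runs.seq (Runs.set h1W ?_ (Runs.seq (Runs.set h1W ?_ (Runs.seq (Runs.set h1W ?_ ?_)))))))))))
  · simp only [Exp.Fits]; omega
  · simp only [Exp.Fits]
    simp only [ne_eq, Nat.reduceEqDiff, not_false_eq_true, Function.update_of_ne]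
    omega
  · simp [Exp.Fits, Exp.val, Op.eval, h33, h32, h30, hkdiv]
    omega
  · simp [Exp.Fits, Exp.val, Op.eval, h33, h32, h30, hkdiv]
    omega
  · simp [Exp.Fits, Exp.val, Op.eval, h33, h32, h30, hkdiv, hgdiv]
    rw [← hc, h3 c hcls]
    omega
  · simp [Exp.Fits, Exp.val, Op.eval, h33, h32, h30, hkdiv, hgdiv, hgmod]
    rw [← hc, h3 c hcls]
    omega
  simp only [Exp.val, Op.eval]
  simp only [ne_eq, Nat.reduceEqDiff, not_false_eq_true, Function.update_of_ne,
    Function.update_self, h33, h32, h30, hkdiv, hkmod, hgdiv, hgmod, ← hc, h3 c hcls]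
  refine Runs.seq_frame (runs_compatTest (n := n) (r := r) hW (by decide) (by decide) (by decide)
    (by decide) (by decide) (by decide) ?_ ?_ ?_ hrn h3 (fun c hc => hT.rep_lt c hc) hA ?_)
    fun v₁ a₁ hf₁ hv₁ ha₁ => ?_
  · simp [h0]
  · simpa using hu
  · simp [hr]
  · simp; omega
  obtain rfl : a₁ = a := funext fun b => ha₁ b (by simp [compatTest, Prog.forLoop, Prog.wa])
  refine Runs.seq_frame (runs_compatTest (n := n) (r := r) hW (by decide) (by decide) (by decide)
    (by decide) (by decide) (by decide) ?_ ?_ ?_ hrn h3 (fun c hc => hT.rep_lt c hc) hA ?_)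
    fun v₂ a₂ hf₂ hv₂ ha₂ => ?_
  · rw [hv₁ 0 (by decide)]; simp [h0]
  · rw [hv₁ 36 (by decide)]; simpa using hu
  · rw [hv₁ 10 (by decide)]; simp [hr]
  · rw [hv₁ 28 (by decide)]
    rw [Function.update_self]
    exact (Nat.sub_le _ _).trans_lt (by omega)
  obtain rfl : a₂ = a₁ := funext fun b => ha₂ b (by simp [compatTest, Prog.forLoop, Prog.wa])
  rw [hv₁ 28 (by decide), hv₁ 36 (by decide)] at hf₂
  rw [← hv₂ 40 (by decide)] at hf₁
  simp at hf₁ hf₂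
  have e33 : v₂ 33 = k := by rw [hv₂ 33 (by decide), hv₁ 33 (by decide)]; simp [h33]
  have e32 : v₂ 32 = n + 2 := by rw [hv₂ 32 (by decide), hv₁ 32 (by decide)]; simp [h32]
  have e37 : v₂ 37 = 2 ^ r * (n + 2) := by
    rw [hv₂ 37 (by decide), hv₁ 37 (by decide)]; simp [h37]
  have e35 : v₂ 35 = j := by rw [hv₂ 35 (by decide), hv₁ 35 (by decide)]; simp
  have e39 : v₂ 39 = T := by rw [hv₂ 39 (by decide), hv₁ 39 (by decide)]; simp
  have e31 : v₂ 31 = 2 ^ c := by rw [hv₂ 31 (by decide), hv₁ 31 (by decide)]; simp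
  clear hv₂ hv₁ ha₁ ha₂
  have hl₁ := hf₁.le_one
  have hl₂ := hf₂.le_one
  have d0 := hD k le_rfl
  have d1 := hD (k - 1) (by omega)
  have d2 := hD (k - 1 - 2 ^ c * (n + 2)) (by omega)
  have m1 := Nat.mul_le_mul hl₁ d1.2
  have m2 := Nat.mul_le_mul hl₂ d2.2
  have m3 : (if 0 < j then 1 else 0) * (T / 2 ^ c % 2) ≤ 1 * 1 :=
    Nat.mul_le_mul (ite_le_one _) (by omega)
  have m4 := Nat.mul_le_mul m3 (Nat.add_le_add m1 m2)
  have m5 : 2 ^ c * (n + 2) ≤ 2 ^ n * (n + 2) := Nat.mul_le_mul_right _ (by omega)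
  refine Runs.put h1W ?_ ?_ ?_
  · simp only [Exp.Fits, Exp.val, e33, e37]
    omega
  · simp only [Exp.Fits, Exp.val, Op.eval, e33, e32, e31, e35, e39]
    have := ite_le_one (0 < j)
    and_intros <;> omega
  · simp only [Exp.val, Op.eval, e33, e32, e31, e35, e37, e39, Function.update_self]
    intro y hy
    rcases Nat.lt_succ_iff_lt_or_eq.1 (show y < 2 ^ r * (n + 2) + k + 1 by omega) with hy' | rfl
    · rw [Function.update_of_ne hy'.ne]; exact h5 y hy'
    rw [Function.update_self]
    have hidx : 2 ^ r * (n + 2) + k = ((u + 1) * 2 ^ r + T) * (n + 2) + j := by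
      rw [hkg, hgu]; ring
    rw [hidx, tableEntry_eq _ _ _ hTP hj, maskedCliques_succ hsym hT hu]
    have hk2 : k = (u * 2 ^ r + T) * (n + 2) + j := by rw [hkg, hgu]
    congr 1
    · rw [d0.1, hk2, tableEntry_eq _ _ _ hTP hj]
    rw [← hc, Nat.testBit_eq_decide_div_mod_eq]
    by_cases hj0 : 0 < j
    swap
    · simp [hj0]
    by_cases hb : T / 2 ^ c % 2 = 1
    swap
    · have : T / 2 ^ c % 2 = 0 := by omega
      simp [this]
    have hcT : 2 ^ c ≤ T := by
      by_contra h
      rw [Nat.div_eq_of_lt (by omega)] at hb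
      omega
    have hk3 : k - 1 = (u * 2 ^ r + T) * (n + 2) + (j - 1) := by omega
    have hk4 : k - 1 - 2 ^ c * (n + 2) = (u * 2 ^ r + (T - 2 ^ c)) * (n + 2) + (j - 1) := by
      obtain ⟨T', rfl⟩ := Nat.exists_eq_add_of_le hcT
      rw [hk3, Nat.add_sub_cancel_left]
      have : (u * 2 ^ r + (2 ^ c + T')) * (n + 2) =
          (u * 2 ^ r + T') * (n + 2) + 2 ^ c * (n + 2) := by
        ring
      omega
    rw [d1.1, d2.1, hk3, ← hk3, hk4, hk3, tableEntry_eq _ _ _ hTP (by omega),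
      tableEntry_eq _ _ _ (by omega) (by omega)]
    simp only [hj0, hb, decide_true, and_self, if_true, one_mul]
    congr 1
    · rcases hf₁ with ⟨h, h'⟩ | ⟨h, h'⟩ <;> simp [h, h']
    · rcases hf₂ with ⟨h, h'⟩ | ⟨h, h'⟩ <;> simp [h, h']

/-- Fills the table of the numbers `maskedCliques`. -/
def fillTable : Prog :=
  .seq computePowers
    (.seq (.set 32 (.op .add (.var 0) (.const 2)))
    (.seq (.set 37 (.op .mul (.var 30) (.var 32)))
    (.seq (.set 38 (.op .mul (.var 0) (.var 37)))
    (.seq (.put 5 (.const 0) (.const 1))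
      (.forLoop 33 38 tableStep)))))

theorem runs_fillTable {orc : Option Oracle} {v : ℕ → ℕ} {a : ℕ → ℕ → ℕ} {W n r : ℕ}
    (hW : 2 * (n * n) + 20 ≤ W) (h0 : v 0 = n) (hr : v 10 = r)
    (hT : TwinClasses n (a 0) n r (a 1) (a 2)) (hA : ∀ i, a 0 i < 2)
    (hsym : ∀ u < n, ∀ w < n, a 0 (u * n + w) = a 0 (w * n + u)) (h5 : ∀ y, a 5 y = 0) :
    Runs orc fillTable v a
      ((n * (2 ^ r * (n + 2)) * (60 * n + 88) + 15 * n + 35) * (W + 1) ^ 2)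
      fun v' a' => (v' 30 = 2 ^ r ∧ v' 32 = n + 2) ∧
        ∀ y < 2 ^ r * (n + 2) + n * (2 ^ r * (n + 2)),
          a' 5 y = tableEntry n (a 0) (a 2) (2 ^ r) y := by
  have h1W : 1 ≤ W := by omega
  have hrn : r ≤ n := hT.card_le
  have hnn : n ≤ n * n := Nat.le_mul_self n
  have hPn : 2 ^ r ≤ 2 ^ n := Nat.pow_le_pow_right (by norm_num) hrn
  have h2n : 1 ≤ 2 ^ n := Nat.one_le_two_pow
  have hP0 : 0 < 2 ^ r := Nat.two_pow_pos r
  have hM1 := table_size_lt hW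
  have hS : 2 ^ r * (n + 2) + n * (2 ^ r * (n + 2)) ≤ 2 ^ n * (n + 2) * (n + 2) := by
    calc 2 ^ r * (n + 2) + n * (2 ^ r * (n + 2)) ≤ 2 ^ r * (n + 2) * (n + 2) := by nlinarith
      _ ≤ _ := by gcongr
  have hSn : 2 ^ n * (n + 2) ≤ 2 ^ n * (n + 2) * (n + 2) := Nat.le_mul_of_pos_right _ (by omega)
  have hnS : 2 ^ n ≤ 2 ^ n * (n + 2) := Nat.le_mul_of_pos_right _ (by omega)
  have hnS' : n + 2 ≤ 2 ^ n * (n + 2) := Nat.le_mul_of_pos_left _ (by omega)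
  refine Runs.mono (t₁ := (15 * n + 10) * (W + 1) ^ 2 + (4 * (W + 1) ^ 2 + (4 * (W + 1) ^ 2 +
    (4 * (W + 1) ^ 2 + (3 * (W + 1) ^ 2 + (n * (2 ^ r * (n + 2)) *
      ((60 * n + 80) * (W + 1) ^ 2 + 8 * (W + 1) ^ 2) + 6 * (W + 1) ^ 2)))))) ?_
    (Runs.seq_frame (runs_computePowers hW hr hrn) fun v₁ a₁ hpw hv₁ ha₁ => ?_)
  · generalize (W + 1) ^ 2 = U
    refine le_of_le_of_eq (Nat.le_add_right _ (4 * U)) (by ring)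
  obtain ⟨h30, h3⟩ := hpw
  have e0 : v₁ 0 = n := by rw [hv₁ 0 (by decide), h0]
  refine Runs.seq (Runs.set h1W ?_ (Runs.seq (Runs.set h1W ?_ (Runs.seq (Runs.set h1W ?_
    (Runs.seq (Runs.put h1W ?_ ?_ ?_)))))))
  · simp only [Exp.Fits, Exp.val]; omega
  · simp [Exp.Fits, Exp.val, Op.eval, e0, h30]; omega
  · simp [Exp.Fits, Exp.val, Op.eval, e0, h30]; omega
  · simp only [Exp.Fits]; omega
  · simp only [Exp.Fits]; omega
  refine Runs.forLoop (t := (60 * n + 80) * (W + 1) ^ 2) h1W (N := n * (2 ^ r * (n + 2)))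
    (by omega) ?_ (by decide) (by decide) (by decide)
    (fun k' _ a' => ∀ y < 2 ^ r * (n + 2) + k',
      a' 5 y = tableEntry n (a 0) (a 2) (2 ^ r) y) ?_ ?_ ?_
  · simp [Exp.val, Op.eval, e0, h30]
  · intro y hy
    have hy0 : y / (n + 2) / 2 ^ r = 0 := by
      rw [Nat.div_div_eq_div_mul]
      exact Nat.div_eq_of_lt (by rw [mul_comm]; exact hy)
    rw [tableEntry, hy0, maskedCliques_zero]
    simp only [Exp.val, Function.update_self, ha₁ 5 (by decide)]
    by_cases hy1 : y = 0
    · subst hy1; simp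
    · rw [Function.update_of_ne hy1, h5, if_neg]
      rintro ⟨h1, h2⟩
      have h3 : y / (n + 2) = 0 := by
        have := Nat.div_add_mod (y / (n + 2)) (2 ^ r)
        rw [hy0, h1] at this; simpa using this.symm
      have := Nat.div_add_mod y (n + 2)
      rw [h3, h2] at this
      simp at this
      omega
  · intro k' hk' v₂ a₂ h33 hv₂ ha₂ hI
    have a0 : a₂ 0 = a 0 := by
      rw [ha₂ 0 (by decide), Function.update_of_ne (by decide), ha₁ 0 (by decide)]
    have a1 : a₂ 1 = a 1 := by
      rw [ha₂ 1 (by decide), Function.update_of_ne (by decide), ha₁ 1 (by decide)]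
    have a2 : a₂ 2 = a 2 := by
      rw [ha₂ 2 (by decide), Function.update_of_ne (by decide), ha₁ 2 (by decide)]
    have a3 : a₂ 3 = a₁ 3 := by
      rw [ha₂ 3 (by decide), Function.update_of_ne (by decide)]
    rw [← a0, ← a2] at hI ⊢
    refine runs_tableStep (k := k') hW ?_ ?_ (r := r) ?_ ?_ ?_ ?_ ?_ ?_ ?_ h33 hk' hI
    · rw [hv₂ 0 (by decide) (by decide)]; simp [e0]
    · rw [hv₂ 10 (by decide) (by decide)]; simp [hv₁ 10 (by decide), hr]
    · rw [a0, a1, a2]; exact hT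
    · rw [a0]; exact hA
    · rw [a0]; exact hsym
    · rw [a3]; exact h3
    · rw [hv₂ 30 (by decide) (by decide)]; simp [h30]
    · rw [hv₂ 32 (by decide) (by decide)]; simp [Exp.val, Op.eval, e0]
    · rw [hv₂ 37 (by decide) (by decide)]; simp [Exp.val, Op.eval, e0, h30]
  · intro v' a' hv' _ h
    refine ⟨⟨?_, ?_⟩, h⟩
    · rw [hv' 30 (by decide) (by decide)]; simp [h30]
    · rw [hv' 32 (by decide) (by decide)]; simp [Exp.val, Op.eval, e0]

theorem sum_maskedCliques_le (n : ℕ) (A cls : ℕ → ℕ) (v j m : ℕ) :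
    ∑ T ∈ Finset.range m, maskedCliques n A cls v T j ≤ m * 2 ^ v := by
  refine (Finset.sum_le_card_nsmul _ _ (2 ^ v) fun T _ => maskedCliques_le n A cls v T j).trans ?_
  rw [Finset.card_range, smul_eq_mul]

/-- Stores in the variable `3` the number of cliques whose size is the variable `1`. -/
def countCliques : Prog :=
  .seq fillTable
    (.seq (.set 3 (.const 0))
      (.forLoop 34 30 (.set 3 (.op .add (.var 3) (.read 5 (.op .add
        (.op .mul (.op .add (.op .mul (.var 0) (.var 30)) (.var 34)) (.var 32)) (.var 1)))))))

open Classical in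
theorem runs_countCliques {orc : Option Oracle} {v : ℕ → ℕ} {a : ℕ → ℕ → ℕ} {W n r k : ℕ}
    (hW : 2 * (n * n) + 20 ≤ W) (h0 : v 0 = n) (hr : v 10 = r)
    (hT : TwinClasses n (a 0) n r (a 1) (a 2)) (hA : ∀ i, a 0 i < 2)
    (hsym : ∀ u < n, ∀ w < n, a 0 (u * n + w) = a 0 (w * n + u))
    (hk : v 1 = k) (hkn : k < n + 2) (h5 : ∀ y, a 5 y = 0) :
    Runs orc countCliques v a (200 * (2 ^ r * (n + 2) ^ 3) * (W + 1) ^ 2)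
      fun v' _ => v' 3 = ((Finset.range n).powerset.filter fun U =>
        IsCliqueOf n (a 0) U ∧ U.card = k).card := by
  have h1W : 1 ≤ W := by omega
  have hrn : r ≤ n := hT.card_le
  have hnn : n ≤ n * n := Nat.le_mul_self n
  have hPn : 2 ^ r ≤ 2 ^ n := Nat.pow_le_pow_right (by norm_num) hrn
  have h2n : 1 ≤ 2 ^ n := Nat.one_le_two_pow
  have hP0 : 0 < 2 ^ r := Nat.two_pow_pos r
  have hM1 := table_size_lt hW
  have hS : 2 ^ r * (n + 2) + n * (2 ^ r * (n + 2)) ≤ 2 ^ n * (n + 2) * (n + 2) := by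
    calc 2 ^ r * (n + 2) + n * (2 ^ r * (n + 2)) ≤ 2 ^ r * (n + 2) * (n + 2) := by nlinarith
      _ ≤ _ := by gcongr
  have hSn : 2 ^ n * (n + 2) ≤ 2 ^ n * (n + 2) * (n + 2) := Nat.le_mul_of_pos_right _ (by omega)
  have hnS : 2 ^ n ≤ 2 ^ n * (n + 2) := Nat.le_mul_of_pos_right _ (by omega)
  have hnS' : n + 2 ≤ 2 ^ n * (n + 2) := Nat.le_mul_of_pos_left _ (by omega)
  refine Runs.mono (t₁ := (n * (2 ^ r * (n + 2)) * (60 * n + 88) + 15 * n + 35) * (W + 1) ^ 2 +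
    (2 * (W + 1) ^ 2 + (2 ^ r * (13 * (W + 1) ^ 2 + 8 * (W + 1) ^ 2) + 6 * (W + 1) ^ 2))) ?_
    (Runs.seq_frame (runs_fillTable hW h0 hr hT hA hsym h5) fun v₃ a₃ hD hv₃ ha₃ => ?_)
  · have h1 : 1 ≤ 2 ^ r := hP0
    have e : n * (2 ^ r * (n + 2)) * (60 * n + 88) + 2 ^ r * 21 + 15 * n + 50
        ≤ 200 * (2 ^ r * (n + 2) ^ 3) := by
      have : n * (n + 2) * (60 * n + 88) + 21 + 15 * n + 50 ≤ 200 * (n + 2) ^ 3 := by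
        ring_nf; omega
      calc n * (2 ^ r * (n + 2)) * (60 * n + 88) + 2 ^ r * 21 + 15 * n + 50
          ≤ n * (2 ^ r * (n + 2)) * (60 * n + 88) + 2 ^ r * 21 + 2 ^ r * (15 * n + 50) := by
            nlinarith
        _ = 2 ^ r * (n * (n + 2) * (60 * n + 88) + 21 + 15 * n + 50) := by ring
        _ ≤ 2 ^ r * (200 * (n + 2) ^ 3) := Nat.mul_le_mul_left _ this
        _ = _ := by ring
    generalize (W + 1) ^ 2 = U
    refine le_trans ?_ (Nat.mul_le_mul_right U e)
    refine le_of_le_of_eq (Nat.le_add_right _ (7 * U)) (by ring)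
  obtain ⟨⟨f30, f32⟩, hD⟩ := hD
  have f0 : v₃ 0 = n := by rw [hv₃ 0 (by decide)]; exact h0
  have f1 : v₃ 1 = k := by rw [hv₃ 1 (by decide)]; exact hk
  have hD' : ∀ T < 2 ^ r, a₃ 5 ((n * 2 ^ r + T) * (n + 2) + k) = maskedCliques n (a 0) (a 2) n T k ∧
      (n * 2 ^ r + T) * (n + 2) + k < 2 ^ n * (n + 2) * (n + 2) := by
    intro T hTP
    have : (n * 2 ^ r + T) * (n + 2) + k < 2 ^ r * (n + 2) + n * (2 ^ r * (n + 2)) := by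
      nlinarith
    rw [hD _ this, tableEntry_eq _ _ _ hTP hkn]
    exact ⟨rfl, by omega⟩
  refine Runs.seq_frame (R := fun v' _ => v' 3 = 0) (Runs.set h1W ?_ (by simp [Exp.val]))
    fun v₄ a₄ h3' hv₄ ha₄ => Runs.forLoop h1W (N := 2 ^ r) (by omega) ?_
    (by decide) (by decide) (by decide)
    (fun k' v' _ => v' 3 = ∑ T ∈ Finset.range k', maskedCliques n (a 0) (a 2) n T k) ?_ ?_ ?_
  · simp only [Exp.Fits]; omega
  · rw [hv₄ 30 (by decide), f30]
  · simp [h3']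
  · intro T hTP v₅ a₅ h34 hv₅ ha₅ hI
    have g0 : v₅ 0 = n := by rw [hv₅ 0 (by decide) (by decide), hv₄ 0 (by decide), f0]
    have g1 : v₅ 1 = k := by rw [hv₅ 1 (by decide) (by decide), hv₄ 1 (by decide), f1]
    have g30 : v₅ 30 = 2 ^ r := by rw [hv₅ 30 (by decide) (by decide), hv₄ 30 (by decide), f30]
    have g32 : v₅ 32 = n + 2 := by rw [hv₅ 32 (by decide) (by decide), hv₄ 32 (by decide), f32]
    have ga : a₅ 5 = a₃ 5 := by rw [ha₅ 5 (by decide), ha₄ 5 (by decide)]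
    obtain ⟨hd1, hd2⟩ := hD' T hTP
    have hsum : v₅ 3 + maskedCliques n (a 0) (a 2) n T k ≤ 2 ^ r * 2 ^ n := by
      rw [hI, ← Finset.sum_range_succ]
      exact (sum_maskedCliques_le n (a 0) (a 2) n k (T + 1)).trans (Nat.mul_le_mul_right _ hTP)
    have hlt : 2 ^ r * 2 ^ n < 2 ^ W := by
      rw [← pow_add]; exact Nat.pow_lt_pow_right (by norm_num) (by omega)
    have m2 : n * 2 ^ r + T ≤ (n * 2 ^ r + T) * (n + 2) := Nat.le_mul_of_pos_right _ (by omega)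
    have m1 : n * 2 ^ r ≤ (n * 2 ^ r + T) * (n + 2) := (Nat.le_add_right _ _).trans m2
    refine Runs.set h1W ?_ ?_
    · simp only [Exp.Fits, Exp.val, Op.eval, g0, g1, g30, g32, ga, h34, hd1]
      and_intros <;> omega
    · simp only [Exp.val, Op.eval, g0, g1, g30, g32, ga, h34, hd1]
      rw [Function.update_of_ne (by decide), Function.update_self, hI, Finset.sum_range_succ]
  · intro v' a' _ _ h
    rw [h, sum_maskedCliques hT.cls_lt]

/-! ### Running a program in a separate part of the memory -/

/-- The expression with all variables and arrays moved up by `100`. -/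
def Exp.shift : Exp → Exp
  | .const c => .const c
  | .var x => .var (x + 100)
  | .read b e => .read (b + 100) e.shift
  | .op o e f => .op o e.shift f.shift

/-- The program with all variables and arrays moved up by `100`. -/
def Prog.shift : Prog → Prog
  | .skip => .skip
  | .set x e => .set (x + 100) e.shift
  | .put b e f => .put (b + 100) e.shift f.shift
  | .rand x e => .rand (x + 100) e.shift
  | .query x b => .query (x + 100) (b + 100)
  | .seq p q => .seq p.shift q.shift
  | .cond e p q => .cond e.shift p.shift q.shift
  | .loop e p => .loop e.shift p.shift

/-- The memory `s` moved up by `100`, above the variables `f` and the arrays `g`, when time `d` has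
already been spent. -/
def State.shift (f : ℕ → ℕ) (g : ℕ → ℕ → ℕ) (d : ℕ) (s : State) : State where
  var x := if x < 100 then f x else s.var (x - 100)
  arr b := if b < 100 then g b else s.arr (b - 100)
  cost := d + s.cost

/-- A left inverse of `State.shift`. -/
def State.unshift (d : ℕ) (s : State) : State where
  var x := s.var (x + 100)
  arr b := s.arr (b + 100)
  cost := s.cost - d

section Shift

variable (f : ℕ → ℕ) (g : ℕ → ℕ → ℕ) (d : ℕ)

theorem State.unshift_shift (s : State) : (s.shift f g d).unshift d = s := by
  simp [State.shift, State.unshift]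

theorem Exp.eval_shift (s : State) (e : Exp) : e.shift.eval (s.shift f g d) = e.eval s := by
  induction e <;> simp_all [Exp.eval, Exp.shift, State.shift]

theorem Exp.cost_shift (s : State) (e : Exp) : e.shift.cost (s.shift f g d) = e.cost s := by
  induction e with
  | const c => rfl
  | var x => simp [Exp.cost, Exp.shift, State.shift]
  | read b e ih =>
    simp only [Exp.cost, Exp.shift, ih, Exp.eval_shift]
    simp [State.shift]
  | op o e e' ih ih' => simp only [Exp.cost, Exp.shift, ih, ih', Exp.eval_shift]

theorem State.shift_tick (s : State) (c : ℕ) :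
    (s.tick c).shift f g d = (s.shift f g d).tick c := by
  simp [State.shift, State.tick, add_assoc]

theorem State.shift_setVar (s : State) (x v : ℕ) :
    (s.setVar x v).shift f g d = (s.shift f g d).setVar (x + 100) v := by
  simp only [State.shift, State.setVar, State.mk.injEq, and_true]
  funext y
  by_cases hy : y < 100
  · simp [hy, show y ≠ x + 100 by omega]
  · obtain ⟨z, rfl⟩ := Nat.exists_eq_add_of_le' (Nat.not_lt.1 hy)
    by_cases hz : z = x
    · subst hz; simp
    · simp [hz]

theorem State.shift_setArr (s : State) (x i v : ℕ) :
    (s.setArr x i v).shift f g d = (s.shift f g d).setArr (x + 100) i v := by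
  simp only [State.shift, State.setArr, State.mk.injEq, true_and, and_true]
  funext y
  by_cases hy : y < 100
  · simp [hy, show y ≠ x + 100 by omega]
  · obtain ⟨z, rfl⟩ := Nat.exists_eq_add_of_le' (Nat.not_lt.1 hy)
    by_cases hz : z = x
    · subst hz; simp
    · simp [hz]

theorem Exec.shift {orc : Option Oracle} {p : Prog} {s : State} {μ : PMF State}
    (h : Exec none p s μ) : Exec orc p.shift (s.shift f g d) (μ.map (State.shift f g d)) := by
  induction h with
  | skip s =>
    rw [PMF.pure_map, State.shift_tick]
    exact Exec.skip _
  | set x e s =>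
    rw [PMF.pure_map, State.shift_tick, State.shift_setVar]
    have := Exec.set (orc := orc) (x + 100) e.shift (s.shift f g d)
    rwa [Exp.eval_shift, Exp.cost_shift] at this
  | put b e e' s =>
    rw [PMF.pure_map, State.shift_tick, State.shift_setArr]
    have := Exec.put (orc := orc) (b + 100) e.shift e'.shift (s.shift f g d)
    rwa [Exp.eval_shift, Exp.cost_shift, Exp.eval_shift, Exp.cost_shift] at this
  | rand x e s =>
    have := Exec.rand (orc := orc) (x + 100) e.shift (s.shift f g d)
    rw [Exp.eval_shift, Exp.cost_shift] at this
    rw [PMF.map_comp]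
    simpa only [Prog.shift, Function.comp_def, State.shift_tick, State.shift_setVar] using this
  | query o x b s h => cases h
  | seq p q s μ κ hp hq ihp ihq =>
    have := Exec.seq p.shift q.shift _ _
      (fun t => (κ (t.unshift d)).map (State.shift f g d)) ihp (by
        intro s' hs'
        rw [PMF.support_map] at hs'
        obtain ⟨s, hs, rfl⟩ := hs'
        rw [State.unshift_shift]
        exact ihq s hs)
    rw [PMF.bind_map] at this
    rw [PMF.map_bind]
    simpa only [Prog.shift, Function.comp_def, State.unshift_shift] using this
  | cond_true e p q s μ he hp ih =>
    refine Exec.cond_true _ _ _ _ _ (by rwa [Exp.eval_shift]) ?_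
    rwa [Exp.cost_shift, ← State.shift_tick]
  | cond_false e p q s μ he hp ih =>
    refine Exec.cond_false _ _ _ _ _ (by rwa [Exp.eval_shift]) ?_
    rwa [Exp.cost_shift, ← State.shift_tick]
  | loop_true e p s μ he hp ih =>
    refine Exec.loop_true _ _ _ _ (by rwa [Exp.eval_shift]) ?_
    rwa [Exp.cost_shift, ← State.shift_tick]
  | loop_false e p s he =>
    rw [PMF.pure_map, State.shift_tick]
    have := Exec.loop_false (orc := orc) e.shift p.shift (s.shift f g d) (by rwa [Exp.eval_shift])
    rwa [Exp.cost_shift] at this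

end Shift

/-- The program `p` can be run, with the same cost, in the part of the memory from `100` on. Since
`p` asks no oracle, it runs in the presence of any oracle. -/
theorem runs_shift {orc : Option Oracle} {p : Prog} {s s' : State} {v : ℕ → ℕ} {a : ℕ → ℕ → ℕ}
    (h : Exec none p s (PMF.pure s')) (hs : s.cost = 0) (hv : ∀ x, v (x + 100) = s.var x)
    (ha : ∀ b, a (b + 100) = s.arr b) :
    Runs orc p.shift v a s'.cost fun v' _ => ∀ x, v' (x + 100) = s'.var x := by
  intro c
  have := h.shift (orc := orc) v a c
  rw [PMF.pure_map] at this
  refine ⟨(s'.shift v a c).var, (s'.shift v a c).arr, (s'.shift v a c).cost, ?_, le_rfl, ?_⟩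
  · convert this using 1
    simp only [State.shift, hs, State.mk.injEq, add_zero, and_true]
    constructor
    · funext y
      by_cases hy : y < 100
      · simp [hy]
      · obtain ⟨z, rfl⟩ := Nat.exists_eq_add_of_le' (Nat.not_lt.1 hy)
        simp [hv]
    · funext y
      by_cases hy : y < 100
      · simp [hy]
      · obtain ⟨z, rfl⟩ := Nat.exists_eq_add_of_le' (Nat.not_lt.1 hy)
        simp [ha]
  · intro x
    simp [State.shift]

/-- Copies the variables `0`, …, `3` and the first `n * n` cells of the array `0` to the memory for
a program that is moved up by `100`. -/
def copyInput : Prog :=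
  .seq (.set 100 (.var 0)) (.seq (.set 101 (.var 1)) (.seq (.set 102 (.var 2))
    (.seq (.set 103 (.var 3)) (.seq (.set 60 (.op .mul (.var 0) (.var 0)))
      (.forLoop 61 60 (.put 100 (.var 61) (.read 0 (.var 61))))))))

theorem runs_copyInput {orc : Option Oracle} {v : ℕ → ℕ} {a : ℕ → ℕ → ℕ} {W n k m c : ℕ}
    (hW : 1 ≤ W) (hn : n * n < 2 ^ W) (h0 : v 0 = n) (h1 : v 1 = k) (h2 : v 2 = m) (h3 : v 3 = c)
    (hk : k < 2 ^ W) (hm : m < 2 ^ W) (hc : c < 2 ^ W) (hA : ∀ i, a 0 i < 2)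
    (hA' : ∀ i, n * n ≤ i → a 0 i = 0) (hv : ∀ x, 100 ≤ x → v x = 0)
    (ha : ∀ b, 100 ≤ b → ∀ i, a b i = 0) :
    Runs orc copyInput v a ((20 * (n * n) + 30) * (W + 1) ^ 2) fun v' a' =>
      (∀ x, v' (x + 100) = if x = 0 then n else if x = 1 then k else if x = 2 then m else
        if x = 3 then c else 0) ∧ ∀ b, a' (b + 100) = if b = 0 then a 0 else fun _ => 0 := by
  have hM : 1 < 2 ^ W := Nat.one_lt_two_pow (by omega)
  have hnn : n ≤ n * n := Nat.le_mul_self n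
  refine Runs.mono (t₁ := 2 * (W + 1) ^ 2 + (2 * (W + 1) ^ 2 + (2 * (W + 1) ^ 2 +
    (2 * (W + 1) ^ 2 + (4 * (W + 1) ^ 2 + (n * n * (4 * (W + 1) ^ 2 + 8 * (W + 1) ^ 2) +
      6 * (W + 1) ^ 2)))))) ?_
    (Runs.seq (Runs.set hW ?_ (Runs.seq (Runs.set hW ?_ (Runs.seq (Runs.set hW ?_
    (Runs.seq (Runs.set hW ?_ (Runs.seq (Runs.set hW ?_ ?_))))))))))
  · nlinarith [sq_nonneg (W + 1), Nat.zero_le (n * n * (W + 1) ^ 2)]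
  · simp only [Exp.Fits]; omega
  · simp [Exp.Fits, h1, hk]
  · simp [Exp.Fits, h2, hm]
  · simp [Exp.Fits, h3, hc]
  · simp [Exp.Fits, Exp.val, h0]; omega
  refine Runs.forLoop (N := n * n) hW hn ?_ (by decide) (by decide) (by decide)
    (fun k _ a' => ∀ i, a' 100 i = if i < k then a 0 i else 0) ?_ ?_ ?_
  · simp [Exp.val, Op.eval, h0]
  · simp [ha]
  · intro i hi v' a' h61 hv' ha' hI
    have e0 : a' 0 = a 0 := ha' 0 (by decide)
    have := hA i
    refine Runs.put hW ?_ ?_ ?_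
    · simp only [Exp.Fits]; omega
    · simp only [Exp.Fits, Exp.val, h61, e0]; omega
    · simp only [Exp.val, h61, e0, Function.update_self]
      intro j
      by_cases hj : j = i
      · subst hj; simp
      · rw [Function.update_of_ne hj, hI j]
        have : j < i ↔ j < i + 1 := by omega
        simp only [this]
  · intro v' a' hv' ha' hI
    refine ⟨fun x => ?_, fun b => ?_⟩
    · rw [hv' (x + 100) (by simp [Prog.wv]) (by omega)]
      by_cases hx : x < 4
      · interval_cases x <;> simp [Exp.val, h0, h1, h2, h3]
      · rw [if_neg (by omega), if_neg (by omega), if_neg (by omega), if_neg (by omega)]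
        repeat rw [Function.update_of_ne (by omega)]
        exact hv _ (by omega)
    · by_cases hb : b = 0
      · subst hb
        rw [if_pos rfl]
        funext i
        rw [hI i]
        split_ifs with h
        · rfl
        · exact (hA' i (by omega)).symm
      · rw [if_neg hb, ha' _ (by simp [Prog.wa, hb])]
        funext i
        exact ha _ (by omega) i

/-! ### Random permutations from random numbers -/

/-- The permutation of `{0, …, i - 1}` that the Fisher–Yates shuffle makes from the digits of `d`
in the factorial number system. -/
def shuffle (d : ℕ) : ℕ → Equiv.Perm ℕ
  | 0 => 1
  | i + 1 => shuffle d i * Equiv.swap i (d / i.factorial % (i + 1))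

theorem shuffle_of_le (d : ℕ) {i u : ℕ} (h : i ≤ u) : shuffle d i u = u := by
  induction i with
  | zero => rfl
  | succ i ih =>
    have := Nat.mod_lt (d / i.factorial) (Nat.succ_pos i)
    have h1 : u ≠ d / i.factorial % (i + 1) := by rw [Nat.succ_eq_add_one] at this; omega
    rw [shuffle, Equiv.Perm.mul_apply, Equiv.swap_apply_of_ne_of_ne (by omega) h1]
    exact ih (by omega)

theorem shuffle_lt (d : ℕ) {i u : ℕ} (h : u < i) : shuffle d i u < i := by
  by_contra h'
  have h1 : shuffle d i (shuffle d i u) = shuffle d i u := shuffle_of_le d (Nat.not_lt.1 h')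
  have h2 := (shuffle d i).injective h1
  omega

theorem shuffle_symm_succ (d i : ℕ) :
    (shuffle d (i + 1)).symm i = d / i.factorial % (i + 1) := by
  rw [Equiv.symm_apply_eq, shuffle, Equiv.Perm.mul_apply, Equiv.swap_apply_right,
    shuffle_of_le d le_rfl]

/-- The shuffle determines its digits. -/
theorem shuffle_injective {d d' : ℕ} (i : ℕ) (h : shuffle d i = shuffle d' i) :
    d % i.factorial = d' % i.factorial := by
  induction i with
  | zero => simp [Nat.mod_one]
  | succ i ih =>
    have h1 : d / i.factorial % (i + 1) = d' / i.factorial % (i + 1) := by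
      rw [← shuffle_symm_succ, ← shuffle_symm_succ, h]
    have h2 : shuffle d i = shuffle d' i := by
      rw [shuffle, shuffle, h1] at h
      exact mul_right_cancel h
    rw [Nat.factorial_succ, mul_comm, Nat.mod_mul, Nat.mod_mul, ih h2, h1]

/-- Stores in the array `6` the shuffle of `{0, …, n - 1}` made from the variable `44`. -/
def makeShuffle : Prog :=
  .forLoop 45 0 (.seq (.set 46 (.op .mod (.var 44) (.op .add (.var 45) (.const 1))))
    (.seq (.set 44 (.op .div (.var 44) (.op .add (.var 45) (.const 1))))
    (.seq (.put 6 (.var 45) (.var 45)) (.seq (.put 6 (.var 45) (.read 6 (.var 46)))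
      (.put 6 (.var 46) (.var 45))))))

theorem runs_makeShuffle {orc : Option Oracle} {v : ℕ → ℕ} {a : ℕ → ℕ → ℕ} {W n d : ℕ}
    (hW : 1 ≤ W) (hn : n * n + 2 < 2 ^ W) (h0 : v 0 = n) (h44 : v 44 = d) (hd : d < 2 ^ W) :
    Runs orc makeShuffle v a ((30 * n + 6) * (W + 1) ^ 2)
      fun _ a' => ∀ u < n, a' 6 u = shuffle d n u := by
  have hM : 1 < 2 ^ W := Nat.one_lt_two_pow (by omega)
  have hnn : n ≤ n * n := Nat.le_mul_self n
  refine Runs.mono (t₁ := n * ((6 * (W + 1) ^ 2 + (6 * (W + 1) ^ 2 + (3 * (W + 1) ^ 2 +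
    (4 * (W + 1) ^ 2 + 3 * (W + 1) ^ 2)))) + 8 * (W + 1) ^ 2) + 6 * (W + 1) ^ 2)
    (le_of_eq (by ring)) (Runs.forLoop (N := n) hW (by omega) h0 (by decide) (by decide)
    (by decide) (fun i v' a' => v' 44 = d / i.factorial ∧ ∀ u < i, a' 6 u = shuffle d i u)
    ?_ ?_ ?_)
  · simp [h44]
  · rintro i hi v₁ a₁ h45 hv₁ ha₁ ⟨hI, hI'⟩
    have hdi : d / i.factorial ≤ d := Nat.div_le_self _ _
    set j := d / i.factorial % (i + 1) with hj
    have hji : j < i + 1 := Nat.mod_lt _ (Nat.succ_pos i)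
    have hsh : shuffle d (i + 1) = shuffle d i * Equiv.swap i j := rfl
    have hread : Function.update (a₁ 6) i i j = shuffle d i j := by
      by_cases h : j = i
      · rw [h, Function.update_self, shuffle_of_le d le_rfl]
      · rw [Function.update_of_ne h, hI' j (by omega)]
    have hread' : shuffle d i j < n := by
      by_cases h : j = i
      · rw [h, shuffle_of_le d le_rfl]; exact hi
      · exact (shuffle_lt d (by omega)).trans hi
    refine Runs.seq (Runs.set hW ?_ (Runs.seq (Runs.set hW ?_ (Runs.seq (Runs.put hW ?_ ?_
      (Runs.seq (Runs.put hW ?_ ?_ (Runs.put hW ?_ ?_ ?_))))))))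
    · simp only [Exp.Fits, Exp.val, h45, hI]; omega
    · simp [Exp.Fits, Exp.val, h45, hI]; omega
    · simp [Exp.Fits, h45]; omega
    · simp [Exp.Fits, h45]; omega
    · simp [Exp.Fits, h45]; omega
    · simp [Exp.Fits, Exp.val, Op.eval, h45, hI, ← hj, hread]; omega
    · simp [Exp.Fits, Exp.val, Op.eval, h45, hI, ← hj]; omega
    · simp [Exp.Fits, h45]; omega
    · simp only [Exp.val, Op.eval]
      simp only [ne_eq, Nat.reduceEqDiff, not_false_eq_true, Function.update_of_ne,
        Function.update_self, h45, hI, ← hj, hread]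
      refine ⟨?_, fun u hu => ?_⟩
      · rw [Nat.div_div_eq_div_mul, mul_comm, ← Nat.factorial_succ]
      · rw [hsh, Equiv.Perm.mul_apply]
        by_cases h1 : u = j
        · rw [h1, Function.update_self, Equiv.swap_apply_right, shuffle_of_le d le_rfl]
        · rw [Function.update_of_ne h1]
          by_cases h2 : u = i
          · rw [h2, Function.update_self, Equiv.swap_apply_left]
          · rw [Function.update_of_ne h2, Function.update_of_ne h2,
              Equiv.swap_apply_of_ne_of_ne h2 h1, hI' u (by omega)]
  · intro v' a' _ _ h; exact h.2

/-- Stores in the array `7` the adjacency matrix with the vertices permuted by the array `6`. -/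
def permuteMatrix : Prog :=
  .forLoop 45 48 (.put 7 (.var 45) (.read 0 (.op .add
    (.op .mul (.read 6 (.op .div (.var 45) (.var 0))) (.var 0))
    (.read 6 (.op .mod (.var 45) (.var 0))))))

theorem runs_permuteMatrix {orc : Option Oracle} {v : ℕ → ℕ} {a : ℕ → ℕ → ℕ} {W n d : ℕ}
    (hW : 1 ≤ W) (hn : n * n + 2 < 2 ^ W) (h0 : v 0 = n) (h48 : v 48 = n * n)
    (hA : ∀ i, a 0 i < 2) (h6 : ∀ u < n, a 6 u = shuffle d n u) :
    Runs orc permuteMatrix v a ((22 * (n * n) + 6) * (W + 1) ^ 2)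
      fun _ a' => ∀ z < n * n, a' 7 z = a 0 (shuffle d n (z / n) * n + shuffle d n (z % n)) := by
  have hM : 1 < 2 ^ W := Nat.one_lt_two_pow (by omega)
  have hnn : n ≤ n * n := Nat.le_mul_self n
  refine Runs.mono (t₁ := n * n * (14 * (W + 1) ^ 2 + 8 * (W + 1) ^ 2) + 6 * (W + 1) ^ 2)
    (le_of_eq (by ring)) (Runs.forLoop (N := n * n) hW (by omega) h48 (by decide) (by decide)
    (by decide) (fun k _ a' => ∀ z < k, a' 7 z =
      a 0 (shuffle d n (z / n) * n + shuffle d n (z % n))) ?_ ?_ ?_)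
  · simp
  · intro z hz v₁ a₁ h45 hv₁ ha₁ hI
    have e0 : v₁ 0 = n := by rw [hv₁ 0 (by decide) (by decide), h0]
    have a0 : a₁ 0 = a 0 := ha₁ 0 (by decide)
    have a6 : a₁ 6 = a 6 := ha₁ 6 (by decide)
    have hn0 : 0 < n := by
      rcases Nat.eq_zero_or_pos n with h | h
      · subst h; omega
      · exact h
    have h1 : z / n < n := Nat.div_lt_of_lt_mul hz
    have h2 : z % n < n := Nat.mod_lt _ hn0
    have h3 := shuffle_lt d h1
    have h4 := shuffle_lt d h2
    have h5 : shuffle d n (z / n) * n + shuffle d n (z % n) < n * n := by nlinarith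
    have h6' := hA (shuffle d n (z / n) * n + shuffle d n (z % n))
    refine Runs.put hW ?_ ?_ ?_
    · simp only [Exp.Fits, h45]; omega
    · simp only [Exp.Fits, Exp.val, Op.eval, h45, e0, a0, a6, h6 _ h1, h6 _ h2]
      and_intros <;> omega
    · simp only [Exp.val, Op.eval, h45, e0, a0, a6, h6 _ h1, h6 _ h2, Function.update_self]
      intro y hy
      by_cases h : y = z
      · rw [h, Function.update_self]
      · rw [Function.update_of_ne h, hI y (by omega)]
  · intro v' a' _ _ h; exact h

/-! ### The majority vote -/

/-- The invariant of the Boyer–Moore vote for the value `w`: `b` is the number of votes for `w`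
minus the number of other votes. If the candidate `cand` is not `w`, the counter `cnt` is at most
the lead of the other votes, so `w` is the candidate as soon as `b` is positive. -/
def VoteInv (w : ℕ) (b : ℤ) (cand cnt : ℕ) : Prop :=
  (cand = w → b ≤ cnt) ∧ (cand ≠ w → b ≤ -cnt)

/-- One step of the Boyer–Moore vote with candidate `53` and counter `42`, for the vote `52`. -/
def castVote : Prog :=
  .cond (.var 42)
    (.cond (.op .eq (.var 52) (.var 53)) (.set 42 (.op .add (.var 42) (.const 1)))
      (.set 42 (.op .sub (.var 42) (.const 1))))
    (.seq (.set 53 (.var 52)) (.set 42 (.const 1)))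

theorem runs_castVote {orc : Option Oracle} {v : ℕ → ℕ} {a : ℕ → ℕ → ℕ} {W T i w x : ℕ} {b : ℤ}
    (hW : 1 ≤ W) (h52 : v 52 = x) (hs : x.size ≤ T)
    (h42 : v 42 ≤ i) (hi : i + 1 < 2 ^ W) (h53 : (v 53).size ≤ T)
    (hI : VoteInv w b (v 53) (v 42)) :
    Runs orc castVote v a (6 * T + 6 + 6 * (W + 1) ^ 2)
      fun v' _ => v' 42 ≤ i + 1 ∧ (v' 53).size ≤ T ∧
        VoteInv w (b + if x = w then 1 else -1) (v' 53) (v' 42) := by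
  have hM : 1 < 2 ^ W := Nat.one_lt_two_pow (by omega)
  unfold VoteInv at hI ⊢
  refine Runs.mono (t₁ := 2 * (W + 1) ^ 2 + (6 * T + 6 + 4 * (W + 1) ^ 2)) (by omega)
    (Runs.cond hW ?_ (fun h => ?_) (fun h => ?_))
  · simp only [Exp.Fits]; omega
  · simp only [Exp.val] at h
    refine Runs.mono (t₁ := (4 * T + 4) + 4 * (W + 1) ^ 2) (by omega)
      (Runs.cond_of_time ?_ (fun h' => ?_) (fun h' => ?_))
    · simp only [Exp.time, Exp.cost, Op.cost, Exp.eval, h52]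
      omega
    · simp only [Exp.val, Op.eval, h52, ne_eq, ite_eq_right_iff, one_ne_zero, imp_false,
        not_not] at h'
      refine Runs.set hW ?_ ?_
      · simp only [Exp.Fits, Exp.val]; omega
      · simp only [Exp.val, Op.eval]
        rw [Function.update_self, Function.update_of_ne (by decide)]
        refine ⟨by omega, h53, ?_⟩
        push_cast
        split_ifs <;> omega
    · simp only [Exp.val, Op.eval, h52, ite_eq_right_iff, one_ne_zero, imp_false] at h'
      refine Runs.set hW ?_ ?_
      · simp only [Exp.Fits]; omega
      · simp only [Exp.val, Op.eval]
        rw [Function.update_self, Function.update_of_ne (by decide)]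
        refine ⟨by omega, h53, ?_⟩
        split_ifs <;> omega
  · simp only [Exp.val] at h
    refine Runs.mono (t₁ := (2 * T + 2) + 2 * (W + 1) ^ 2) (by omega)
      (Runs.seq (Runs.set_of_time ?_ (Runs.set hW ?_ ?_)))
    · simp only [Exp.time, Exp.cost, Exp.val, h52]
      omega
    · simp only [Exp.Fits]; omega
    · simp only [Exp.val]
      rw [Function.update_self, Function.update_of_ne (by decide), Function.update_self, h52]
      refine ⟨by omega, hs, ?_⟩
      split_ifs <;> omega

/-- Takes the next sample: the vertices are permuted by the last digit (to the base `n!`) of the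
variable `50`, the oracle is asked for the permuted graph, and its answer is put to the vote. -/
def sampleStep : Prog :=
  .seq (.set 44 (.op .mod (.var 50) (.var 40)))
    (.seq (.set 50 (.op .div (.var 50) (.var 40)))
    (.seq makeShuffle (.seq permuteMatrix (.seq (.query 52 7) castVote))))

theorem runs_sampleStep {o : Oracle} {v : ℕ → ℕ} {a : ℕ → ℕ → ℕ} {W n L T i w : ℕ} {b : ℤ}
    {ans : ℕ → ℕ} (hW : 1 ≤ W) (hn : n * n + 2 < 2 ^ W) (hnf : n.factorial < 2 ^ W)
    (h0 : v 0 = n) (h40 : v 40 = n.factorial) (h48 : v 48 = n * n) (h50 : v 50 < 2 ^ L)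
    (hA : ∀ i, a 0 i < 2) (hT : o.time = T) (hs : ∀ d < n.factorial, (ans d).size ≤ T)
    (hans : ∀ d < n.factorial, ∀ B : ℕ → ℕ,
      (∀ z < n * n, B z = a 0 (shuffle d n (z / n) * n + shuffle d n (z % n))) →
        o.answer B = ans d)
    (h42 : v 42 ≤ i) (hi : i + 1 < 2 ^ W) (h53 : (v 53).size ≤ T)
    (hI : VoteInv w b (v 53) (v 42)) :
    Runs (some o) sampleStep v a
      (8 * (L + 1) * (W + 1) + (22 * (n * n) + 30 * n + 30) * (W + 1) ^ 2 + 10 * T + 10)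
      fun v' _ => v' 50 = v 50 / n.factorial ∧ v' 42 ≤ i + 1 ∧ (v' 53).size ≤ T ∧
        VoteInv w (b + if ans (v 50 % n.factorial) = w then 1 else -1) (v' 53) (v' 42) := by
  set V := v 50 with hV
  have hM : 1 < 2 ^ W := Nat.one_lt_two_pow (by omega)
  have hnf0 : 0 < n.factorial := Nat.factorial_pos n
  set d := V % n.factorial with hd
  have hdn : d < n.factorial := Nat.mod_lt _ hnf0
  have s1 : V.size ≤ L := Nat.size_le.2 h50
  have s2 : n.factorial.size ≤ W := Nat.size_le.2 hnf
  have s3 : d.size ≤ W := Nat.size_le.2 (hdn.trans hnf)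
  have s4 : (V / n.factorial).size ≤ L := Nat.size_le.2 ((Nat.div_le_self _ _).trans_lt h50)
  have s5 := Nat.mul_le_mul s1 s2
  refine Runs.mono (t₁ := 4 * (L + 1) * (W + 1) + (4 * (L + 1) * (W + 1) +
    ((30 * n + 6) * (W + 1) ^ 2 + ((22 * (n * n) + 6) * (W + 1) ^ 2 + ((2 * T + 1) +
      (6 * T + 6 + 6 * (W + 1) ^ 2)))))) (by nlinarith [sq_nonneg (W + 1)])
    (Runs.seq_frame (R := fun v' _ => v' 44 = d) (Runs.set_of_time ?_ ?_) fun v₁ a₁ e44 hv₁ ha₁ =>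
    Runs.seq_frame (R := fun v' _ => v' 50 = V / n.factorial) (Runs.set_of_time ?_ ?_)
      fun v₂ a₂ e50 hv₂ ha₂ =>
    Runs.seq_frame (runs_makeShuffle hW hn ?_ (d := d) ?_ (hdn.trans hnf)) fun v₃ a₃ e6 hv₃ ha₃ =>
    Runs.seq_frame (runs_permuteMatrix hW hn ?_ ?_ ?_ e6) fun v₄ a₄ e7 hv₄ ha₄ =>
    Runs.seq_frame (R := fun v' _ => v' 52 = ans d) ?_ fun v₅ a₅ e52 hv₅ ha₅ => ?_)
  · simp only [Exp.time, Exp.cost, Op.cost, Exp.eval, Exp.val, Op.eval, h40, ← hV, ← hd]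
    nlinarith
  · simp [Exp.val, Op.eval, h40, hd, hV]
  · have f50 : v₁ 50 = V := by rw [hv₁ 50 (by decide)]
    have f40 : v₁ 40 = n.factorial := by rw [hv₁ 40 (by decide), h40]
    simp only [Exp.time, Exp.cost, Op.cost, Exp.eval, Exp.val, Op.eval, f50, f40]
    nlinarith
  · have f50 : v₁ 50 = V := by rw [hv₁ 50 (by decide)]
    have f40 : v₁ 40 = n.factorial := by rw [hv₁ 40 (by decide), h40]
    simp [Exp.val, Op.eval, f50, f40]
  · rw [hv₂ 0 (by decide), hv₁ 0 (by decide), h0]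
  · rw [hv₂ 44 (by decide), e44]
  · rw [hv₃ 0 (by decide), hv₂ 0 (by decide), hv₁ 0 (by decide), h0]
  · rw [hv₃ 48 (by decide), hv₂ 48 (by decide), hv₁ 48 (by decide), h48]
  · rw [ha₃ 0 (by decide), ha₂ 0 (by decide), ha₁ 0 (by decide)]; exact hA
  · have : o.answer (a₄ 7) = ans d := by
      refine hans d hdn _ fun z hz => ?_
      rw [e7 z hz, ha₃ 0 (by decide), ha₂ 0 (by decide), ha₁ 0 (by decide)]
    refine Runs.mono ?_ (Runs.query ?_)
    · rw [this, hT]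
      have := hs d hdn
      omega
    · rw [Function.update_self, this]
  · have f50 : v₅ 50 = V / n.factorial := by
      rw [hv₅ 50 (by decide), hv₄ 50 (by decide), hv₃ 50 (by decide), e50]
    have f42 : v₅ 42 = v 42 := by
      rw [hv₅ 42 (by decide), hv₄ 42 (by decide), hv₃ 42 (by decide), hv₂ 42 (by decide),
        hv₁ 42 (by decide)]
    have f53 : v₅ 53 = v 53 := by
      rw [hv₅ 53 (by decide), hv₄ 53 (by decide), hv₃ 53 (by decide), hv₂ 53 (by decide),
        hv₁ 53 (by decide)]
    have s6 := hs d hdn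
    clear hv₁ hv₂ hv₃ hv₄ hv₅ ha₁ ha₂ ha₃ ha₄ ha₅
    rw [← f53, ← f42] at hI
    refine (runs_castVote hW e52 s6 (by rwa [f42]) hi (by rwa [f53]) hI).frame.imp ?_
    rintro v' a' ⟨h, h', -⟩
    exact ⟨by rw [h' 50 (by decide), f50], h⟩

/-- Stores `n!` in the variable `40`, the number `K / ε ^ 2` of samples in the variable `41`, and
the number of outcomes of all samples in the variable `51`. -/
def prepareVote (K : ℕ) : Prog :=
  .seq (.set 40 (.const 1))
    (.seq (.forLoop 43 0 (.set 40 (.op .mul (.var 40) (.op .add (.var 43) (.const 1)))))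
    (.seq (.set 48 (.op .mul (.var 0) (.var 0)))
    (.seq (.set 41 (.op .mul (.const K) (.op .mul (.var 23) (.var 23))))
    (.seq (.set 51 (.const 1)) (.forLoop 43 41 (.set 51 (.op .mul (.var 51) (.var 40))))))))

theorem runs_prepareVote {orc : Option Oracle} {v : ℕ → ℕ} {a : ℕ → ℕ → ℕ} {W n L K q t : ℕ}
    (hW : n * n + 2 ≤ W) (h0 : v 0 = n) (h23 : v 23 = q) (hK : K < 2 ^ W) (hq : q * q < 2 ^ W)
    (ht : K * (q * q) = t) (htW : t < 2 ^ W) (hL : n.factorial ^ t < 2 ^ L) :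
    Runs orc (prepareVote K) v a
      ((16 * n + 40) * (W + 1) ^ 2 + t * (4 * (L + 1) * (W + 1) + 8 * (W + 1) ^ 2))
      fun v' _ => v' 40 = n.factorial ∧ v' 48 = n * n ∧ v' 41 = t ∧ v' 51 = n.factorial ^ t := by
  have h1W : 1 ≤ W := by omega
  have hM : n * n + 2 < 2 ^ W :=
    (Nat.lt_two_pow_self).trans_le (Nat.pow_le_pow_right (by omega) hW)
  have hnn : n ≤ n * n := Nat.le_mul_self n
  have hqq : q ≤ q * q := Nat.le_mul_self q
  refine Runs.mono (t₁ := 2 * (W + 1) ^ 2 + ((n * (6 * (W + 1) ^ 2 + 8 * (W + 1) ^ 2) +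
    6 * (W + 1) ^ 2) + (4 * (W + 1) ^ 2 + (6 * (W + 1) ^ 2 + (2 * (W + 1) ^ 2 +
    (t * (4 * (L + 1) * (W + 1) + 8 * (W + 1) ^ 2) + 6 * (W + 1) ^ 2)))))) ?_
    (Runs.seq_frame (R := fun v' _ => v' 40 = 1) (Runs.set h1W ?_ (by simp [Exp.val]))
      fun v₁ a₁ e40 hv₁ ha₁ =>
    Runs.seq_frame (R := fun v' _ => v' 40 = n.factorial)
      (Runs.forLoop h1W (N := n) (by omega) ?_ (by decide) (by decide) (by decide)
        (fun k v' _ => v' 40 = k.factorial) ?_ ?_ (fun v' a' _ _ h => h))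
      fun v₂ a₂ f40 hv₂ ha₂ =>
    Runs.seq (Runs.set h1W ?_ (Runs.seq (Runs.set h1W ?_ (Runs.seq (Runs.set h1W ?_
      (Runs.forLoop h1W (N := t) htW ?_ (by decide) (by decide) (by decide)
        (fun k v' _ => v' 51 = n.factorial ^ k) ?_ ?_ ?_)))))))
  · nlinarith [Nat.zero_le (n * (W + 1) ^ 2), sq_nonneg (W + 1)]
  · simp only [Exp.Fits]; omega
  · rw [hv₁ 0 (by decide), h0]
  · simp [e40]
  · intro k hk v' a' hk' _ _ hI
    have h1 := factorial_lt_two_pow hW (show k + 1 ≤ n by omega)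
    have h2 := factorial_lt_two_pow hW (show k ≤ n by omega)
    rw [Nat.factorial_succ, mul_comm] at h1
    refine Runs.set h1W ?_ ?_
    · simp only [Exp.Fits, Exp.val, Op.eval, hI, hk']
      exact ⟨⟨h2, ⟨by omega, by omega⟩, by omega⟩, h1⟩
    · simp only [Exp.val, Op.eval, hI, hk']
      rw [Function.update_of_ne (by decide), Function.update_self, Nat.factorial_succ, mul_comm]
  · simp only [Exp.Fits, Exp.val, hv₂ 0 (by decide), hv₁ 0 (by decide), h0]; omega
  · simp [Exp.Fits, Exp.val, Op.eval, hv₂ 23 (by decide), hv₁ 23 (by decide), h23, ht]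
    omega
  · simp only [Exp.Fits]; omega
  · simp [Exp.val, Op.eval, hv₂ 23 (by decide), hv₁ 23 (by decide), h23, ht]
  · simp [Exp.val]
  · intro i hi v₃ a₃ hi' hv₃ ha₃ hI
    have g40 : v₃ 40 = n.factorial := by rw [hv₃ 40 (by decide) (by decide)]; simp [f40]
    have hlt : n.factorial ^ (i + 1) < 2 ^ L :=
      (Nat.pow_le_pow_right (Nat.factorial_pos n) hi).trans_lt hL
    have s1 : (n.factorial ^ i).size ≤ L := Nat.size_le.2
      ((Nat.pow_le_pow_right (Nat.factorial_pos n) (Nat.le_succ i)).trans_lt hlt)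
    have s2 : n.factorial.size ≤ W := Nat.size_le.2 (factorial_lt_two_pow hW le_rfl)
    have s3 : (n.factorial ^ (i + 1)).size ≤ L := Nat.size_le.2 hlt
    have s4 := Nat.mul_le_mul s1 s2
    rw [pow_succ] at s3
    refine Runs.set_of_time ?_ ?_
    · simp only [Exp.time, Exp.cost, Op.cost, Exp.eval, Exp.val, Op.eval, hI, g40]
      nlinarith
    · simp only [Exp.val, Op.eval, hI, g40]
      rw [Function.update_of_ne (by decide), Function.update_self, pow_succ]
  · intro v' a' hv' _ h
    refine ⟨?_, ?_, ?_, h⟩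
    · rw [hv' 40 (by decide) (by decide)]; simp [f40]
    · rw [hv' 48 (by decide) (by decide)]
      simp [Exp.val, Op.eval, hv₂ 0 (by decide), hv₁ 0 (by decide), h0]
    · rw [hv' 41 (by decide) (by decide)]
      simp [Exp.val, Op.eval, hv₂ 23 (by decide), hv₁ 23 (by decide), h23, ht]

/-- Takes as many samples as the variable `41` says and outputs the winner of the vote. -/
def holdVote : Prog :=
  .seq (.set 42 (.const 0)) (.seq (.set 53 (.const 0))
    (.seq (.forLoop 43 41 sampleStep) (.set 4 (.var 53))))

/-- The number of votes for `w` minus the number of other votes, when the samples are given by the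
digits of `V` to the base `b`. -/
def voteBalance (ans : ℕ → ℕ) (b t w V : ℕ) : ℤ :=
  ∑ i ∈ Finset.range t, if ans (V / b ^ i % b) = w then 1 else -1

theorem runs_holdVote {o : Oracle} {v : ℕ → ℕ} {a : ℕ → ℕ → ℕ} {W n L T t w : ℕ}
    {ans : ℕ → ℕ} (hW : 1 ≤ W) (hn : n * n + 2 < 2 ^ W) (hnf : n.factorial < 2 ^ W)
    (h0 : v 0 = n) (h40 : v 40 = n.factorial) (h48 : v 48 = n * n) (h41 : v 41 = t)
    (ht : t + 1 < 2 ^ W) (h50 : v 50 < 2 ^ L)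
    (hA : ∀ i, a 0 i < 2) (hT : o.time = T) (hs : ∀ d < n.factorial, (ans d).size ≤ T)
    (hans : ∀ d < n.factorial, ∀ B : ℕ → ℕ,
      (∀ z < n * n, B z = a 0 (shuffle d n (z / n) * n + shuffle d n (z % n))) →
        o.answer B = ans d) :
    Runs (some o) holdVote v a
      (t * (8 * (L + 1) * (W + 1) + (22 * (n * n) + 30 * n + 38) * (W + 1) ^ 2 + 10 * T + 10)
        + 10 * (W + 1) ^ 2 + 2 * T + 2)
      fun v' _ => 0 < voteBalance ans n.factorial t w (v 50) → v' 4 = w := by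
  have hM : 1 < 2 ^ W := Nat.one_lt_two_pow (by omega)
  refine Runs.mono (t₁ := 2 * (W + 1) ^ 2 + (2 * (W + 1) ^ 2 +
    ((t * ((8 * (L + 1) * (W + 1) + (22 * (n * n) + 30 * n + 30) * (W + 1) ^ 2 + 10 * T + 10) +
      8 * (W + 1) ^ 2) + 6 * (W + 1) ^ 2) + (2 * T + 2)))) (le_of_eq (by ring))
    (Runs.seq (Runs.set hW ?_ (Runs.seq (Runs.set hW ?_ (Runs.seq_frame
      (R := fun v' _ => (v' 53).size ≤ T ∧
        (0 < voteBalance ans n.factorial t w (v 50) → v' 53 = w))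
      (Runs.forLoop hW (N := t) (by omega) ?_ (by decide) (by decide) (by decide)
        (fun k v' _ => v' 50 = v 50 / n.factorial ^ k ∧ v' 42 ≤ k ∧ (v' 53).size ≤ T ∧
          VoteInv w (voteBalance ans n.factorial k w (v 50)) (v' 53) (v' 42)) ?_ ?_ ?_)
      fun v₃ a₃ h53 hv₃ ha₃ => Runs.set_of_time ?_ ?_)))))
  · simp only [Exp.Fits]; omega
  · simp only [Exp.Fits]; omega
  · simp [h41]
  · simp [Exp.val, VoteInv, voteBalance]
  · rintro i hi v₁ a₁ h43 hv₁ ha₁ ⟨i1, i2, i3, i4⟩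
    have e0 : v₁ 0 = n := by rw [hv₁ 0 (by decide) (by decide)]; simp [h0]
    have e40 : v₁ 40 = n.factorial := by rw [hv₁ 40 (by decide) (by decide)]; simp [h40]
    have e48 : v₁ 48 = n * n := by rw [hv₁ 48 (by decide) (by decide)]; simp [h48]
    have a0 : a₁ 0 = a 0 := ha₁ 0 (by decide)
    have h50' : v₁ 50 < 2 ^ L := by rw [i1]; exact (Nat.div_le_self _ _).trans_lt h50
    refine (runs_sampleStep hW hn hnf e0 e40 e48 h50' (by rwa [a0]) hT hs (by rwa [a0]) i2
      (by omega) i3 i4).imp ?_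
    rintro v₂ a₂ ⟨j1, j2, j3, j4⟩
    rw [Function.update_of_ne (by decide), Function.update_of_ne (by decide),
      Function.update_of_ne (by decide)]
    refine ⟨?_, j2, j3, ?_⟩
    · rw [j1, i1, Nat.div_div_eq_div_mul, pow_succ]
    · rw [voteBalance, Finset.sum_range_succ, ← i1]
      exact j4
  · rintro v' a' _ _ ⟨-, -, h1, h2⟩
    refine ⟨h1, fun h => ?_⟩
    by_contra hne
    have := h2.2 hne
    omega
  · simp only [Exp.time, Exp.cost, Exp.val]
    have := h53.1
    omega
  · simp only [Exp.val, Function.update_self]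
    exact h53.2

theorem exec_rand_seq {orc : Option Oracle} {x : ℕ} {e : Exp} {p : Prog} {s : State}
    (F : ℕ → State) (hF : ∀ r ≤ e.eval s, Exec orc p
      ((s.setVar x r).tick (e.cost s + (e.eval s).size + 1)) (PMF.pure (F r))) :
    Exec orc (.seq (.rand x e) p) s
      ((PMF.uniformOfFintype (Fin (e.eval s + 1))).map fun r : Fin (e.eval s + 1) => F r) := by
  have := Exec.seq (.rand x e) p s _ (fun s' => PMF.pure (F (s'.var x)))
    (Exec.rand (orc := orc) x e s) (by
      intro s' hs'
      rw [PMF.support_map] at hs'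
      obtain ⟨r, -, rfl⟩ := hs'
      simp only [State.tick, State.setVar, Function.update_self]
      exact hF r (Nat.lt_succ_iff.1 r.2))
  rw [PMF.bind_map] at this
  rw [PMF.map]
  refine Eq.subst (motive := fun f => Exec orc _ s (PMF.bind _ f)) ?_ this
  funext r
  simp [State.tick, State.setVar]

theorem le_uniform_map_apply {α : Type*} {N : ℕ} (F : Fin (N + 1) → α) (w : α)
    (good : Finset ℕ) (hg : good ⊆ Finset.range (N + 1))
    (hF : ∀ r : Fin (N + 1), (r : ℕ) ∈ good → F r = w) :
    ((good.card : ENNReal) / (N + 1 : ℕ)) ≤ ((PMF.uniformOfFintype (Fin (N + 1))).map F) w := by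
  classical
  rw [PMF.map_apply, tsum_fintype]
  have hcard : good.card = (Finset.univ.filter fun r : Fin (N + 1) => (r : ℕ) ∈ good).card := by
    rw [← Finset.card_map Fin.valEmbedding]
    congr 1
    ext r
    simp only [Finset.mem_map, Finset.mem_filter, Finset.mem_univ, true_and, Fin.valEmbedding_apply]
    constructor
    · intro hr
      exact ⟨⟨r, Finset.mem_range.1 (hg hr)⟩, hr, rfl⟩
    · rintro ⟨r, hr, rfl⟩; exact hr
  calc ((good.card : ENNReal) / (N + 1 : ℕ))
      = ∑ r ∈ Finset.univ.filter fun r : Fin (N + 1) => (r : ℕ) ∈ good,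
          ((N + 1 : ℕ) : ENNReal)⁻¹ := by
        rw [Finset.sum_const, nsmul_eq_mul, ← hcard, div_eq_mul_inv]
    _ = ∑ r ∈ Finset.univ.filter fun r : Fin (N + 1) => (r : ℕ) ∈ good,
          (if w = F r then PMF.uniformOfFintype (Fin (N + 1)) r else 0) := by
        refine Finset.sum_congr rfl fun r hr => ?_
        rw [if_pos (hF r (Finset.mem_filter.1 hr).2).symm, PMF.uniformOfFintype_apply,
          Fintype.card_fin]
    _ ≤ _ := by
        refine (Finset.sum_le_sum_of_subset (Finset.filter_subset _ _)).trans (le_of_eq ?_)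
        refine Finset.sum_congr rfl fun r _ => ?_
        congr

/-- Takes samples and outputs the winner of the vote. All samples come from a single random draw. -/
def vote (K : ℕ) : Prog :=
  .seq (prepareVote K) (.seq (.rand 50 (.op .sub (.var 51) (.const 1))) holdVote)

/-- The vote with the answers `ans d` to the samples `d < n!`. The set `good` holds outcomes of the
random draw for which `w` wins; `L` bounds the length of the number that is drawn. -/
theorem exec_vote {o : Oracle} {v : ℕ → ℕ} {a : ℕ → ℕ → ℕ} {W n L K T q t w : ℕ}
    {ans : ℕ → ℕ} (hW : n * n + 2 ≤ W) (h0 : v 0 = n) (h23 : v 23 = q) (hK : K < 2 ^ W)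
    (hq : q * q < 2 ^ W) (ht : K * (q * q) = t) (htW : t + 1 < 2 ^ W)
    (hL : n.factorial ^ t < 2 ^ L) (hA : ∀ i, a 0 i < 2) (hT : o.time = T)
    (hs : ∀ d < n.factorial, (ans d).size ≤ T)
    (hans : ∀ d < n.factorial, ∀ B : ℕ → ℕ,
      (∀ z < n * n, B z = a 0 (shuffle d n (z / n) * n + shuffle d n (z % n))) →
        o.answer B = ans d)
    (good : Finset ℕ) (hg : good ⊆ Finset.range (n.factorial ^ t))
    (hgood : ∀ V ∈ good, 0 < voteBalance ans n.factorial t w V) (c : ℕ) :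
    ∃ μ : PMF State, Exec (some o) (vote K) ⟨v, a, c⟩ μ ∧
      (∀ s ∈ μ.support, s.cost ≤ c + ((16 * n + 50) * (W + 1) ^ 2 + 6 * (L + 1) + t *
        (12 * (L + 1) * (W + 1) + (22 * (n * n) + 30 * n + 46) * (W + 1) ^ 2 + 10 * T + 10)
        + 2 * T + 2)) ∧
      ((good.card : ENNReal) / (n.factorial ^ t : ℕ)) ≤ (μ.map State.output) w := by
  have h1W : 1 ≤ W := by omega
  have hM : n * n + 2 < 2 ^ W :=
    (Nat.lt_two_pow_self).trans_le (Nat.pow_le_pow_right (by omega) hW)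
  have hnf := factorial_lt_two_pow hW (le_refl n)
  obtain ⟨v₁, a₁, c₁, e₁, hc₁, ⟨h40, h48, h41, h51⟩, hv₁, ha₁⟩ :=
    (runs_prepareVote (orc := some o) (a := a) hW h0 h23 hK hq ht (by omega) hL).frame c
  have hpos : 0 < n.factorial ^ t := pow_pos (Nat.factorial_pos n) t
  set e : Exp := .op .sub (.var 51) (.const 1) with he
  set s₁ : State := ⟨v₁, a₁, c₁⟩ with hs₁
  have heval : e.eval s₁ + 1 = n.factorial ^ t := by
    simp only [he, Exp.eval, Op.eval, hs₁, h51]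
    omega
  have hsz : (n.factorial ^ t).size ≤ L := Nat.size_le.2 hL
  have hcost : e.cost s₁ + (e.eval s₁).size + 1 ≤ 6 * (L + 1) := by
    have h1 : (e.eval s₁).size ≤ L := (Nat.size_le_size (by omega)).trans hsz
    have h2 : Nat.size 1 = 1 := Nat.size_one
    have h3 : e.cost s₁ = ((n.factorial ^ t).size + 1) + (Nat.size 1 + 1) +
        ((n.factorial ^ t).size + Nat.size 1 + 1) := by
      simp only [he, Exp.cost, Op.cost, Exp.eval, hs₁, h51]
    omega
  have key : ∀ r ≤ e.eval s₁, ∃ s' : State, Exec (some o) holdVote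
      ((s₁.setVar 50 r).tick (e.cost s₁ + (e.eval s₁).size + 1)) (PMF.pure s') ∧
      s'.cost ≤ c₁ + 6 * (L + 1) + (t * (8 * (L + 1) * (W + 1) + (22 * (n * n) + 30 * n + 38) *
        (W + 1) ^ 2 + 10 * T + 10) + 10 * (W + 1) ^ 2 + 2 * T + 2) ∧
      (0 < voteBalance ans n.factorial t w r → s'.output = w) := by
    intro r hr
    have hr' : r < 2 ^ L := by omega
    obtain ⟨v₂, a₂, c₂, e₂, hc₂, hw⟩ := runs_holdVote (o := o) (v := Function.update v₁ 50 r)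
      (a := a₁) (W := W) (n := n) (L := L) (T := T) (t := t) (w := w) (ans := ans) h1W hM hnf
      (by simp [hv₁ 0 (by simp [prepareVote, Prog.forLoop, Prog.wv]), h0])
      (by simp [h40]) (by simp [h48]) (by simp [h41])
      htW (by simpa using hr')
      (by rw [ha₁ 0 (by simp [prepareVote, Prog.forLoop, Prog.wa])]; exact hA) hT hs
      (by rw [ha₁ 0 (by simp [prepareVote, Prog.forLoop, Prog.wa])]; exact hans)
      (c₁ + (e.cost s₁ + (e.eval s₁).size + 1))
    refine ⟨_, e₂, ?_, ?_⟩
    · simp only; omega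
    · simpa [State.output] using hw
  have : Nonempty State := ⟨s₁⟩
  choose! F hF using key
  refine ⟨_, Exec.seq _ _ _ _ (fun _ => (PMF.uniformOfFintype (Fin (e.eval s₁ + 1))).map
    fun r : Fin (e.eval s₁ + 1) => F r) e₁ ?_, ?_, ?_⟩
  · intro s' hs'
    rw [PMF.support_pure, Set.mem_singleton_iff] at hs'
    subst hs'
    exact exec_rand_seq F fun r hr => (hF r hr).1
  · rw [PMF.pure_bind]
    intro s' hs'
    rw [PMF.support_map] at hs'
    obtain ⟨r, -, rfl⟩ := hs'
    have := (hF r (Nat.lt_succ_iff.1 r.2)).2.1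
    refine this.trans ?_
    nlinarith
  · rw [PMF.pure_bind, PMF.map_comp, ← heval]
    refine le_uniform_map_apply _ w good (by rwa [heval]) fun r hr => ?_
    exact (hF r (Nat.lt_succ_iff.1 r.2)).2.2 (hgood _ hr)

end RAM

/-! ### Graphs without twins have many relabellings -/

/-- Two permutations whose supports meet only in `α` have a 3-cycle as a commutator. -/
theorem commutator_apply_of_supports {V : Type*} {x y : Equiv.Perm V} {α : V}
    (hx : x α ≠ α) (hy : y α ≠ α)
    (h : ∀ v, v ≠ α → x v = v ∨ y v = v) :
    (x * y * x⁻¹ * y⁻¹) α = x α ∧ (x * y * x⁻¹ * y⁻¹) (x α) = y α ∧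
      (x * y * x⁻¹ * y⁻¹) (y α) = α ∧
      ∀ w, w ≠ α → w ≠ x α → w ≠ y α → (x * y * x⁻¹ * y⁻¹) w = w := by
  have hxy : ∀ v, v ≠ α → y v ≠ v → x v = v := fun v hv hyv => (h v hv).resolve_right hyv
  have hyx : ∀ v, v ≠ α → x v ≠ v → y v = v := fun v hv hxv => (h v hv).resolve_left hxv
  have ix : ∀ {a b : V}, x a = b → x⁻¹ b = a := fun hab => by simp [← hab]
  have iy : ∀ {a b : V}, y a = b → y⁻¹ b = a := fun hab => by simp [← hab]
  -- `y α` is fixed by `x`, and `x α` by `y`.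
  have xβ : x (y α) = y α := hxy _ hy fun e => hy (y.injective e)
  have yγ : y (x α) = x α := hyx _ hx fun e => hx (x.injective e)
  simp only [Equiv.Perm.mul_apply]
  refine ⟨?_, ?_, ?_, ?_⟩
  · have h1 : y⁻¹ α ≠ α := fun e => hy (by simpa using (congrArg y e).symm)
    have h2 : x (y⁻¹ α) = y⁻¹ α := hxy _ h1 (by simpa using h1.symm)
    rw [ix h2]; simp
  · rw [iy yγ, ix rfl, xβ]
  · rw [iy rfl]
    have h1 : x⁻¹ α ≠ α := fun e => hx (by simpa using (congrArg x e).symm)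
    have h2 : y (x⁻¹ α) = x⁻¹ α := hyx _ h1 (by simpa using h1.symm)
    rw [h2]; simp
  · intro w h1 h2 h3
    by_cases hw : y w = w
    · rw [iy hw]
      have h4 : x⁻¹ w ≠ α := fun e => h2 (by rw [← e]; simp)
      by_cases hw' : x w = w
      · rw [ix hw', hw, hw']
      · have h5 : y (x⁻¹ w) = x⁻¹ w :=
          hyx _ h4 (fun e => hw' (by
            have : w = x⁻¹ w := by simpa using e
            simpa using congrArg x this))
        rw [h5]; simp
    · have h4 : y⁻¹ w ≠ α := fun e => h3 (by rw [← e]; simp)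
      have h5 : y (y⁻¹ w) ≠ y⁻¹ w := fun e => hw (by
        have : w = y⁻¹ w := by simpa using e
        simpa using congrArg y this)
      have h6 : x (y⁻¹ w) = y⁻¹ w := hxy _ h4 h5
      rw [ix h6]; simp [hxy w h1 hw]

section Orbit

variable {V : Type*} [Fintype V] [DecidableEq V]

open Classical in
/-- The graphs that arise from `G` by permuting the vertices. -/
noncomputable def relabellings (G : SimpleGraph V) : Finset (SimpleGraph V) :=
  Finset.univ.image fun σ : Equiv.Perm V => G.comap σ

/-- No automorphism of `G` other than the identity moves only vertices in `W`. -/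
def AutFree (G : SimpleGraph V) (W : Finset V) : Prop :=
  ∀ σ : Equiv.Perm V, (∀ v, v ∉ W → σ v = v) → (∀ a b, G.Adj (σ a) (σ b) ↔ G.Adj a b) → σ = 1

/-- Bochert's argument. If a largest set `W ⊆ R` of this kind had less than half of the elements of
`R`, there would be nontrivial automorphisms `x` and `y` on `R \ W` and on `W` with one more vertex;
their commutator would be a 3-cycle, which makes two vertices of `R` twins. -/
theorem exists_autFree (G : SimpleGraph V) (R : Finset V)
    (hR : ∀ u ∈ R, ∀ v ∈ R, u ≠ v → ∃ w, w ≠ u ∧ w ≠ v ∧ ¬ (G.Adj u w ↔ G.Adj v w)) :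
    ∃ W ⊆ R, R.card ≤ 2 * W.card ∧ AutFree G W := by
  classical
  obtain ⟨W, hW, hmax⟩ := Finset.exists_max_image (R.powerset.filter (AutFree G)) Finset.card
    ⟨∅, by
      simp only [Finset.mem_filter, Finset.mem_powerset, Finset.empty_subset, true_and]
      intro σ hσ _
      ext v
      simp [hσ v]⟩
  rw [Finset.mem_filter, Finset.mem_powerset] at hW
  refine ⟨W, hW.1, ?_, hW.2⟩
  by_contra hcard
  push Not at hcard
  have hD : ¬ AutFree G (R \ W) := by
    intro h
    have h1 := hmax (R \ W) (by
      rw [Finset.mem_filter, Finset.mem_powerset]; exact ⟨Finset.sdiff_subset, h⟩)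
    rw [Finset.card_sdiff_of_subset hW.1] at h1
    omega
  unfold AutFree at hD
  push Not at hD
  obtain ⟨x, hx, hxG, hx1⟩ := hD
  obtain ⟨α, hα⟩ : ∃ α, x α ≠ α := by
    by_contra h
    push Not at h
    exact hx1 (Equiv.ext h)
  have hαD : α ∈ R \ W := by
    by_contra h
    exact hα (hx α h)
  rw [Finset.mem_sdiff] at hαD
  have hE : ¬ AutFree G (insert α W) := by
    intro h
    have h1 := hmax (insert α W) (by
      rw [Finset.mem_filter, Finset.mem_powerset]
      exact ⟨Finset.insert_subset hαD.1 hW.1, h⟩)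
    rw [Finset.card_insert_of_notMem hαD.2] at h1
    omega
  unfold AutFree at hE
  push Not at hE
  obtain ⟨y, hy, hyG, hy1⟩ := hE
  have hyα : y α ≠ α := by
    intro h
    refine hy1 (hW.2 y (fun v hv => ?_) hyG)
    by_cases e : v = α
    · rw [e, h]
    · exact hy v (by simp [e, hv])
  have hsupp : ∀ v, v ≠ α → x v = v ∨ y v = v := by
    intro v hv
    by_cases hvW : v ∈ W
    · left; exact hx v (by simp [hvW])
    · right; exact hy v (by simp [hv, hvW])
  obtain ⟨z1, z2, z3, z4⟩ := commutator_apply_of_supports hα hyα hsupp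
  set z := x * y * x⁻¹ * y⁻¹ with hz
  have hinv : ∀ {τ : Equiv.Perm V}, (∀ a b, G.Adj (τ a) (τ b) ↔ G.Adj a b) →
      ∀ a b, G.Adj (τ⁻¹ a) (τ⁻¹ b) ↔ G.Adj a b := by
    intro τ hτ a b
    rw [← hτ]; simp
  have hzG : ∀ a b, G.Adj (z a) (z b) ↔ G.Adj a b := by
    intro a b
    simp only [hz, Equiv.Perm.mul_apply]
    rw [hxG, hyG, hinv hxG, hinv hyG]
  have hxα : x α ∈ R := by
    by_contra h
    have := hx (x α) (fun h' => h (Finset.mem_sdiff.1 h').1)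
    exact hα (x.injective this)
  obtain ⟨w, hw1, hw2, hw3⟩ := hR α hαD.1 (x α) hxα (Ne.symm hα)
  refine hw3 ?_
  by_cases hw4 : w = y α
  · rw [hw4, ← hzG α (y α), z1, z3, ← hzG (x α) α, z2, z1, G.adj_comm]
  · rw [← hzG α w, z1, z4 w hw1 hw2 hw4]

/-- If no two vertices in `R` are twins, the permutations of a set as in `exists_autFree` give
different relabellings. -/
theorem factorial_le_card_relabellings (G : SimpleGraph V) (R : Finset V)
    (hR : ∀ u ∈ R, ∀ v ∈ R, u ≠ v → ∃ w, w ≠ u ∧ w ≠ v ∧ ¬ (G.Adj u w ↔ G.Adj v w)) :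
    ((R.card + 1) / 2).factorial ≤ (relabellings G).card := by
  classical
  obtain ⟨W, -, hcard, hfree⟩ := exists_autFree G R hR
  calc ((R.card + 1) / 2).factorial ≤ W.card.factorial := Nat.factorial_le (by omega)
    _ = (Finset.univ : Finset (Equiv.Perm W)).card := by
        rw [Finset.card_univ, Fintype.card_perm, Fintype.card_coe]
    _ = (Finset.univ.image fun τ : Equiv.Perm W =>
          G.comap (Equiv.Perm.ofSubtype τ : Equiv.Perm V)).card := by
        refine (Finset.card_image_of_injective _ fun τ τ' h => ?_).symm
        refine Equiv.Perm.ofSubtype_injective (p := (· ∈ W)) ?_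
        rw [← mul_inv_eq_one]
        refine hfree _ (fun v hv => ?_) fun a b => ?_
        · rw [← map_inv, ← map_mul]
          exact Equiv.Perm.ofSubtype_apply_of_not_mem _ hv
        · have := congrArg (fun G' : SimpleGraph V => G'.Adj
            ((Equiv.Perm.ofSubtype τ' : Equiv.Perm V)⁻¹ a)
            ((Equiv.Perm.ofSubtype τ' : Equiv.Perm V)⁻¹ b)) h
          simpa using this
    _ ≤ (relabellings G).card := by
        refine Finset.card_le_card fun G' hG' => ?_
        obtain ⟨τ, -, rfl⟩ := Finset.mem_image.1 hG'
        exact Finset.mem_image_of_mem _ (Finset.mem_univ _)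

open Classical in
/-- Each relabelling of `G` comes from the same number of permutations. -/
theorem card_perm_comap_mem (G : SimpleGraph V) (S : Finset (SimpleGraph V)) :
    (Finset.univ.filter fun σ : Equiv.Perm V => G.comap σ ∈ S).card * (relabellings G).card =
      (Fintype.card V).factorial * (S ∩ relabellings G).card := by
  set f : Equiv.Perm V → SimpleGraph V := fun σ => G.comap σ with hf
  set m := (Finset.univ.filter fun σ : Equiv.Perm V => f σ = G).card with hm
  have hfib : ∀ G' ∈ relabellings G, (Finset.univ.filter fun σ => f σ = G').card = m := by
    intro G' hG'
    obtain ⟨τ, -, rfl⟩ := Finset.mem_image.1 hG'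
    refine (Finset.card_bij (fun σ _ => σ * τ) ?_ ?_ ?_).symm
    · intro σ hσ
      have hσ := (Finset.mem_filter.1 hσ).2
      rw [Finset.mem_filter]
      refine ⟨Finset.mem_univ _, ?_⟩
      conv_rhs => rw [← hσ]
      ext a b
      simp [hf]
    · intro σ _ σ' _ h
      exact mul_right_cancel h
    · intro σ hσ
      have hσ := (Finset.mem_filter.1 hσ).2
      refine ⟨σ * τ⁻¹, ?_, by simp⟩
      rw [Finset.mem_filter]
      refine ⟨Finset.mem_univ _, ?_⟩
      ext a b
      have := congrArg (fun G' : SimpleGraph V => G'.Adj (τ⁻¹ a) (τ⁻¹ b)) hσ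
      simpa [hf] using this
  have h1 : (Finset.univ.filter fun σ => f σ ∈ S).card = (S ∩ relabellings G).card * m := by
    rw [Finset.card_eq_sum_card_fiberwise (f := f) (t := S ∩ relabellings G)]
    · rw [Finset.sum_const_nat]
      intro G' hG'
      rw [← hfib G' (Finset.mem_inter.1 hG').2, Finset.filter_filter]
      congr 1
      refine Finset.filter_congr fun σ _ => ?_
      constructor
      · exact fun h => h.2
      · exact fun h => ⟨h ▸ (Finset.mem_inter.1 hG').1, h⟩
    · intro σ hσ
      exact Finset.mem_inter.2 ⟨(Finset.mem_filter.1 hσ).2,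
        Finset.mem_image_of_mem _ (Finset.mem_univ _)⟩
  have h2 : (Fintype.card V).factorial = (relabellings G).card * m := by
    rw [← Fintype.card_perm, ← Finset.card_univ,
      Finset.card_eq_sum_card_fiberwise (f := f) (t := relabellings G)]
    · rw [Finset.sum_const_nat hfib]
    · intro σ _
      exact Finset.mem_image_of_mem _ (Finset.mem_univ _)
  rw [h1, h2]
  ring

end Orbit

namespace RAM

/-- The shuffle as a permutation of `Fin n`. -/
noncomputable def finShuffle (n d : ℕ) : Equiv.Perm (Fin n) :=
  Equiv.ofBijective (fun u => ⟨shuffle d n u, shuffle_lt d u.2⟩)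
    (Finite.injective_iff_bijective.1 fun _ _ h =>
      Fin.ext ((shuffle d n).injective (Fin.mk.inj_iff.1 h)))

theorem coe_finShuffle (n d : ℕ) (u : Fin n) : (finShuffle n d u : ℕ) = shuffle d n u := rfl

open Classical in
/-- A random number less than `n!` gives a uniformly random permutation. -/
theorem card_finShuffle_mem (n : ℕ) (p : Equiv.Perm (Fin n) → Prop) :
    ((Finset.range n.factorial).filter fun d => p (finShuffle n d)).card =
      (Finset.univ.filter p).card := by
  have hinj : Function.Injective fun d : Fin n.factorial => finShuffle n d := by
    intro d d' h
    have h1 : shuffle d n = shuffle d' n := by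
      ext u
      by_cases hu : u < n
      · have := congrArg (fun σ : Equiv.Perm (Fin n) => (σ ⟨u, hu⟩ : ℕ)) h
        simpa only [coe_finShuffle] using this
      · rw [shuffle_of_le _ (Nat.not_lt.1 hu), shuffle_of_le _ (Nat.not_lt.1 hu)]
    have := shuffle_injective n h1
    rwa [Nat.mod_eq_of_lt d.2, Nat.mod_eq_of_lt d'.2, Fin.val_inj] at this
  have hbij := (Fintype.bijective_iff_injective_and_card _).2
    ⟨hinj, by rw [Fintype.card_fin, Fintype.card_perm, Fintype.card_fin]⟩
  refine Finset.card_bij (fun d _ => finShuffle n d) ?_ ?_ ?_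
  · intro d hd
    rw [Finset.mem_filter] at hd ⊢
    exact ⟨Finset.mem_univ _, hd.2⟩
  · intro d hd d' hd' h
    have := @hinj ⟨d, Finset.mem_range.1 (Finset.mem_filter.1 hd).1⟩
      ⟨d', Finset.mem_range.1 (Finset.mem_filter.1 hd').1⟩ h
    exact Fin.mk.inj_iff.1 this
  · intro σ hσ
    obtain ⟨d, rfl⟩ := hbij.2 σ
    refine ⟨d, ?_, rfl⟩
    rw [Finset.mem_filter] at hσ ⊢
    exact ⟨Finset.mem_range.2 d.2, hσ.2⟩

end RAM

/-! ### Random sets of prescribed size -/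

/-- A random set of `m` elements out of `M` misses `i` given elements with probability at most
`((M - m) / M) ^ i`. -/
theorem choose_sub_mul_pow_le {M m i : ℕ} (hi : i ≤ M) (hm : m ≤ M) :
    (M - i).choose m * M ^ i ≤ (M - m) ^ i * M.choose m := by
  induction i with
  | zero => simp
  | succ i ih =>
    have ih := ih (by omega)
    obtain ⟨N, hN⟩ : ∃ N, M - i = N + 1 := ⟨M - i - 1, by omega⟩
    have h1 : M - (i + 1) = N := by omega
    rw [hN] at ih
    rw [h1]
    have h2 : N.choose m * M ≤ (N + 1).choose m * (M - m) := by
      by_cases hmN : N + 1 ≤ m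
      · rw [Nat.choose_eq_zero_of_lt (by omega)]; simp
      have hmN' : m ≤ N + 1 := by omega
      have h3 := Nat.choose_mul_succ_eq N m
      have h4 : (N + 1 - m) * M ≤ (M - m) * (N + 1) := by
        have h5 : N + 1 ≤ M := by omega
        zify [hmN', hm]
        have h6 : (N : ℤ) + 1 ≤ M := by exact_mod_cast h5
        have h7 : (0 : ℤ) ≤ m := by positivity
        nlinarith
      refine Nat.le_of_mul_le_mul_right ?_ (show 0 < N + 1 by simp)
      calc N.choose m * M * (N + 1) = (N + 1).choose m * ((N + 1 - m) * M) := by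
            rw [← mul_assoc, ← h3]; ring
        _ ≤ (N + 1).choose m * ((M - m) * (N + 1)) := Nat.mul_le_mul_left _ h4
        _ = _ := by ring
    calc N.choose m * M ^ (i + 1) = N.choose m * M * M ^ i := by ring
      _ ≤ (N + 1).choose m * (M - m) * M ^ i := Nat.mul_le_mul_right _ h2
      _ = (N + 1).choose m * M ^ i * (M - m) := by ring
      _ ≤ (M - m) ^ i * M.choose m * (M - m) := Nat.mul_le_mul_right _ ih
      _ = _ := by ring

section Tail

variable {Ω : Type*} [Fintype Ω] [DecidableEq Ω]

/-- The moment generating function of the number of elements of `B` that a random set of `m`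
elements misses is at most that of a binomial random variable. -/
theorem sum_pow_card_sdiff_le (B : Finset Ω) {m : ℕ} (hm : m ≤ Fintype.card Ω) {q y : ℝ}
    (hy : 0 ≤ y) (hq : (Fintype.card Ω - m : ℝ) ≤ q * Fintype.card Ω) :
    ∑ S ∈ Finset.powersetCard m (Finset.univ : Finset Ω), (1 + y) ^ (B \ S).card ≤
      (1 + q * y) ^ B.card * (Fintype.card Ω).choose m := by
  have h1 : ∀ S : Finset Ω, (1 + y) ^ (B \ S).card =
      ∑ I ∈ B.powerset, if Disjoint I S then y ^ I.card else 0 := by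
    intro S
    rw [← Finset.sum_filter, add_comm, ← Finset.sum_pow_mul_eq_add_pow]
    simp only [one_pow, mul_one]
    refine Finset.sum_congr ?_ fun _ _ => rfl
    ext I
    simp only [Finset.mem_powerset, Finset.mem_filter, Finset.subset_sdiff]
  have h2 : ∀ I ∈ B.powerset, ∑ S ∈ Finset.powersetCard m (Finset.univ : Finset Ω),
      (if Disjoint I S then y ^ I.card else 0) ≤
        (q * y) ^ I.card * 1 ^ (B.card - I.card) * (Fintype.card Ω).choose m := by
    intro I _
    have h3 : (Finset.powersetCard m (Finset.univ : Finset Ω)).filter (fun S => Disjoint I S) =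
        Finset.powersetCard m (Finset.univ \ I) := by
      ext S
      simp only [Finset.mem_filter, Finset.mem_powersetCard, Finset.subset_sdiff]
      constructor
      · rintro ⟨⟨h, h'⟩, h''⟩; exact ⟨⟨h, h''.symm⟩, h'⟩
      · rintro ⟨⟨h, h''⟩, h'⟩; exact ⟨⟨h, h'⟩, h''.symm⟩
    have hIM : I.card ≤ Fintype.card Ω := Finset.card_le_univ I
    rw [← Finset.sum_filter, h3, Finset.sum_const, Finset.card_powersetCard,
      Finset.card_sdiff_of_subset (Finset.subset_univ I), Finset.card_univ, nsmul_eq_mul, mul_pow,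
      one_pow, mul_one]
    have h4 := choose_sub_mul_pow_le hIM hm
    have h5 : ((Fintype.card Ω - I.card).choose m : ℝ) ≤
        q ^ I.card * (Fintype.card Ω).choose m := by
      rcases Nat.eq_zero_or_pos (Fintype.card Ω) with h0 | h0
      · have : I.card = 0 := by omega
        simp [this]
      have h6 : (0 : ℝ) < (Fintype.card Ω : ℝ) ^ I.card := by positivity
      refine le_of_mul_le_mul_right ?_ h6
      have h7 : (((Fintype.card Ω - I.card).choose m * Fintype.card Ω ^ I.card : ℕ) : ℝ) ≤
          (((Fintype.card Ω - m) ^ I.card * (Fintype.card Ω).choose m : ℕ) : ℝ) :=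
        Nat.cast_le.2 h4
      push_cast [Nat.cast_sub hm] at h7
      refine h7.trans ?_
      have h8 : ((Fintype.card Ω : ℝ) - m) ^ I.card ≤ (q * Fintype.card Ω) ^ I.card := by
        refine pow_le_pow_left₀ ?_ hq _
        rw [sub_nonneg]; exact_mod_cast hm
      rw [mul_pow] at h8
      calc _ ≤ q ^ I.card * (Fintype.card Ω : ℝ) ^ I.card * (Fintype.card Ω).choose m := by gcongr
        _ = _ := by ring
    calc ((Fintype.card Ω - I.card).choose m : ℝ) * y ^ I.card ≤
          q ^ I.card * (Fintype.card Ω).choose m * y ^ I.card := by gcongr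
      _ = _ := by ring
  simp only [h1]
  rw [Finset.sum_comm]
  refine (Finset.sum_le_sum h2).trans (le_of_eq ?_)
  rw [← Finset.sum_mul, Finset.sum_pow_mul_eq_add_pow, add_comm]

open Classical in
/-- A random set with a fraction `1 / 2 + ε` of all elements contains a fraction of at least
`(1 + ε) / 2` of the elements of a given set `B`, up to an exponentially small probability. -/
theorem card_filter_card_inter_lt_le (B : Finset Ω) {m : ℕ} {ε : ℝ} (hε : 0 < ε) (hε' : ε ≤ 1 / 2)
    (hm : m ≤ Fintype.card Ω) (hm' : (1 / 2 + ε) * Fintype.card Ω ≤ m) :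
    (((Finset.powersetCard m (Finset.univ : Finset Ω)).filter fun S =>
        ((S ∩ B).card : ℝ) < (1 + ε) / 2 * B.card).card : ℝ) ≤
      Real.exp (-(ε ^ 2 / 8 * B.card)) * (Fintype.card Ω).choose m := by
  have h1 := Real.abs_exp_sub_one_sub_id_le (x := ε / 2) (by rw [abs_of_pos] <;> linarith)
  have h2 := (abs_le.1 h1).2
  have h3 := Real.add_one_le_exp (ε / 2)
  -- The tail bound is obtained from the moment generating function at `ε / 2`.
  set y := Real.exp (ε / 2) - 1 with hy
  have hy0 : 0 ≤ y := by linarith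
  have hsum := sum_pow_card_sdiff_le B hm (q := 1 / 2 - ε) hy0 (by linarith)
  have h4 : ∀ S ∈ (Finset.powersetCard m (Finset.univ : Finset Ω)).filter fun S =>
      ((S ∩ B).card : ℝ) < (1 + ε) / 2 * B.card,
      Real.exp (ε / 2 * ((1 - ε) / 2 * B.card)) ≤ (1 + y) ^ (B \ S).card := by
    intro S hS
    have h5 := (Finset.mem_filter.1 hS).2
    have h6 : (S ∩ B).card + (B \ S).card = B.card := by
      rw [Finset.inter_comm]; exact Finset.card_inter_add_card_sdiff B S
    have h7 : ((S ∩ B).card : ℝ) + (B \ S).card = B.card := by exact_mod_cast h6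
    rw [hy, add_sub_cancel, ← Real.exp_nat_mul]
    refine Real.exp_le_exp.2 ?_
    nlinarith
  have h8 : (((Finset.powersetCard m (Finset.univ : Finset Ω)).filter fun S =>
        ((S ∩ B).card : ℝ) < (1 + ε) / 2 * B.card).card : ℝ) *
      Real.exp (ε / 2 * ((1 - ε) / 2 * B.card)) ≤
      (1 + (1 / 2 - ε) * y) ^ B.card * (Fintype.card Ω).choose m := by
    refine le_trans ?_ hsum
    rw [← nsmul_eq_mul]
    refine (Finset.card_nsmul_le_sum _ _ _ h4).trans ?_
    refine Finset.sum_le_sum_of_subset_of_nonneg (Finset.filter_subset _ _) fun S _ _ => ?_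
    positivity
  have h9 : (1 + (1 / 2 - ε) * y) ^ B.card ≤ Real.exp ((1 / 2 - ε) * y * B.card) := by
    have := Real.add_one_le_exp ((1 / 2 - ε) * y)
    rw [mul_comm _ (B.card : ℝ), Real.exp_nat_mul]
    refine pow_le_pow_left₀ ?_ (by linarith) _
    have : 0 ≤ (1 / 2 - ε) * y := mul_nonneg (by linarith) hy0
    linarith
  refine le_of_mul_le_mul_right (h8.trans ?_) (Real.exp_pos (ε / 2 * ((1 - ε) / 2 * B.card)))
  rw [mul_right_comm, ← Real.exp_add]
  gcongr
  refine h9.trans (Real.exp_le_exp.2 ?_)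
  have h10 : (1 / 2 - ε) * y ≤ (1 / 2 - ε) * (ε / 2 + (ε / 2) ^ 2) :=
    mul_le_mul_of_nonneg_left (by linarith) (by linarith)
  have h11 : (1 / 2 - ε) * (ε / 2 + (ε / 2) ^ 2) ≤ -(ε ^ 2 / 8) + ε / 2 * ((1 - ε) / 2) := by
    nlinarith [pow_pos hε 3]
  have h12 : (0 : ℝ) ≤ B.card := by positivity
  nlinarith

end Tail

/-! ### The probability that the vote fails -/

namespace RAM

/-- The digits of a random number below `b ^ t` to the base `b` are independent. -/
theorem sum_prod_digits (g : ℕ → ℝ) {b : ℕ} (hb : 0 < b) (t : ℕ) :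
    ∑ V ∈ Finset.range (b ^ t), ∏ i ∈ Finset.range t, g (V / b ^ i % b) =
      (∑ d ∈ Finset.range b, g d) ^ t := by
  induction t with
  | zero => simp
  | succ t ih =>
    rw [pow_succ (∑ d ∈ Finset.range b, g d) t, ← ih, Finset.sum_mul_sum, ← Finset.sum_product']
    refine Finset.sum_nbij' (fun V => (V / b, V % b)) (fun p => b * p.1 + p.2) ?_ ?_ ?_ ?_ ?_
    · intro V hV
      rw [Finset.mem_range, pow_succ] at hV
      simp only [Finset.mem_product, Finset.mem_range]
      exact ⟨Nat.div_lt_of_lt_mul (by rwa [mul_comm]), Nat.mod_lt _ hb⟩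
    · rintro ⟨V, d⟩ h
      simp only [Finset.mem_product, Finset.mem_range] at h ⊢
      rw [pow_succ]
      nlinarith
    · intro V _
      exact Nat.div_add_mod V b
    · rintro ⟨V, d⟩ h
      simp only [Finset.mem_product, Finset.mem_range] at h
      simp only [Prod.mk.injEq]
      rw [Nat.mul_add_div hb, Nat.div_eq_of_lt h.2, Nat.mul_add_mod, Nat.mod_eq_of_lt h.2]
      exact ⟨rfl, rfl⟩
    · intro V _
      rw [Finset.prod_range_succ', pow_zero, Nat.div_one]
      congr 1
      refine Finset.prod_congr rfl fun i _ => ?_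
      rw [Nat.div_div_eq_div_mul, pow_succ']

/-- If the answers are right with probability `1 / 2 + η`, the right answer loses the vote with
probability at most `exp (-η ^ 2 * t)`. -/
theorem card_voteBalance_pos_ge (ans : ℕ → ℕ) {b : ℕ} (hb : 0 < b) (t w : ℕ) {η : ℝ}
    (hη : 0 < η) (hη' : η ≤ 1 / 2)
    (hans : (1 / 2 + η) * b ≤ (((Finset.range b).filter fun d => ans d = w).card : ℝ)) :
    (1 - Real.exp (-(η ^ 2 * t))) * (b : ℝ) ^ t ≤
      (((Finset.range (b ^ t)).filter fun V => 0 < voteBalance ans b t w V).card : ℝ) := by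
  set x : ℕ → ℤ := fun d => if ans d = w then 1 else -1 with hx
  set g : ℕ → ℝ := fun d => Real.exp (-(η * (x d : ℝ))) with hg
  have hb' : (0 : ℝ) < b := by exact_mod_cast hb
  have hsplit := Finset.card_filter_add_card_filter_not (s := Finset.range b) (fun d => ans d = w)
  rw [Finset.card_range] at hsplit
  set A := ((Finset.range b).filter fun d => ans d = w).card with hA
  set A' := ((Finset.range b).filter fun d => ¬ ans d = w).card with hA'
  have hAA : (A : ℝ) + A' = b := by exact_mod_cast hsplit
  have hsum : ∑ d ∈ Finset.range b, g d = A * Real.exp (-η) + A' * Real.exp η := by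
    rw [← Finset.sum_filter_add_sum_filter_not _ (fun d => ans d = w)]
    congr 1
    · rw [hA, ← nsmul_eq_mul, ← Finset.sum_const]
      refine Finset.sum_congr rfl fun d hd => ?_
      simp [hg, hx, (Finset.mem_filter.1 hd).2]
    · rw [hA', ← nsmul_eq_mul, ← Finset.sum_const]
      refine Finset.sum_congr rfl fun d hd => ?_
      simp [hg, hx, (Finset.mem_filter.1 hd).2]
  have hsum_le : ∑ d ∈ Finset.range b, g d ≤ Real.exp (-(η ^ 2)) * b := by
    have e1 := (abs_le.1 (Real.abs_exp_sub_one_sub_id_le (x := η)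
      (by rw [abs_of_pos] <;> linarith))).2
    have e2 := (abs_le.1 (Real.abs_exp_sub_one_sub_id_le (x := -η)
      (by rw [abs_neg, abs_of_pos] <;> linarith))).2
    have e3 := Real.add_one_le_exp (-(η ^ 2))
    have e4 : Real.exp (-η) ≤ Real.exp η := Real.exp_le_exp.2 (by linarith)
    rw [hsum]
    have e5 : (A : ℝ) * Real.exp (-η) + A' * Real.exp η ≤
        (1 / 2 + η) * b * Real.exp (-η) + (1 / 2 - η) * b * Real.exp η := by
      have : (A' : ℝ) = b - A := by linarith
      rw [this]
      nlinarith
    have e6 : (1 / 2 + η) * Real.exp (-η) + (1 / 2 - η) * Real.exp η ≤ 1 - η ^ 2 := by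
      have := mul_le_mul_of_nonneg_left e1 (show 0 ≤ 1 / 2 - η by linarith)
      have := mul_le_mul_of_nonneg_left e2 (show 0 ≤ 1 / 2 + η by linarith)
      nlinarith
    calc _ ≤ _ := e5
      _ = ((1 / 2 + η) * Real.exp (-η) + (1 / 2 - η) * Real.exp η) * b := by ring
      _ ≤ _ := mul_le_mul_of_nonneg_right (by linarith) hb'.le
  have hprod : ∀ V, ∏ i ∈ Finset.range t, g (V / b ^ i % b) =
      Real.exp (-(η * (voteBalance ans b t w V : ℝ))) := by
    intro V
    rw [voteBalance, hg, ← Real.exp_sum, Finset.sum_neg_distrib, ← Finset.mul_sum, Int.cast_sum]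
  have hbad : (((Finset.range (b ^ t)).filter fun V => ¬ 0 < voteBalance ans b t w V).card : ℝ) ≤
      Real.exp (-(η ^ 2 * t)) * (b : ℝ) ^ t := by
    calc (((Finset.range (b ^ t)).filter fun V => ¬ 0 < voteBalance ans b t w V).card : ℝ)
        ≤ ∑ V ∈ (Finset.range (b ^ t)).filter fun V => ¬ 0 < voteBalance ans b t w V,
          ∏ i ∈ Finset.range t, g (V / b ^ i % b) := by
          rw [← nsmul_one]
          refine Finset.card_nsmul_le_sum _ _ _ fun V hV => ?_
          rw [hprod]
          have h1 : voteBalance ans b t w V ≤ 0 := not_lt.1 (Finset.mem_filter.1 hV).2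
          have h2 : (voteBalance ans b t w V : ℝ) ≤ 0 := by exact_mod_cast h1
          exact Real.one_le_exp (by nlinarith)
      _ ≤ ∑ V ∈ Finset.range (b ^ t), ∏ i ∈ Finset.range t, g (V / b ^ i % b) := by
          refine Finset.sum_le_sum_of_subset_of_nonneg (Finset.filter_subset _ _) fun V _ _ => ?_
          rw [hprod]; positivity
      _ = (∑ d ∈ Finset.range b, g d) ^ t := sum_prod_digits g hb t
      _ ≤ (Real.exp (-(η ^ 2)) * b) ^ t := by
          refine pow_le_pow_left₀ (Finset.sum_nonneg fun d _ => ?_) hsum_le _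
          exact (Real.exp_pos _).le
      _ = _ := by
          rw [mul_pow, ← Real.exp_nat_mul]
          congr 2
          ring
  have htot := Finset.card_filter_add_card_filter_not (s := Finset.range (b ^ t))
    (fun V => 0 < voteBalance ans b t w V)
  rw [Finset.card_range] at htot
  have htot' : (((Finset.range (b ^ t)).filter fun V => 0 < voteBalance ans b t w V).card : ℝ) +
      ((Finset.range (b ^ t)).filter fun V => ¬ 0 < voteBalance ans b t w V).card =
      (b : ℝ) ^ t := by exact_mod_cast htot
  linarith

end RAM

/-! ### Graphs and their adjacency matrices -/

theorem mul_add_eq_mul_add_iff {n i j i' j' : ℕ} (hj : j < n) (hj' : j' < n) :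
    i * n + j = i' * n + j' ↔ i = i' ∧ j = j' := by
  constructor
  · intro h
    have h1 : i = i' := by
      have := congrArg (· / n) h
      have hn : 0 < n := by omega
      simpa [Nat.mul_comm _ n, Nat.mul_add_div hn, Nat.div_eq_of_lt hj,
        Nat.div_eq_of_lt hj'] using this
    subst h1
    exact ⟨rfl, by omega⟩
  · rintro ⟨rfl, rfl⟩; rfl

section AdjArray

variable {n : ℕ} (G : SimpleGraph (Fin n))

theorem adjArray_lt_two (m : ℕ) : adjArray G m < 2 := by
  unfold adjArray; split <;> omega

theorem adjArray_of_le {m : ℕ} (hm : n * n ≤ m) : adjArray G m = 0 := by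
  rw [adjArray, if_neg]
  rintro ⟨i, j, h, -⟩
  have := Nat.mul_le_mul_right n (show (i : ℕ) + 1 ≤ n from i.2)
  have := j.2
  nlinarith

theorem adjArray_apply (i j : Fin n) : adjArray G (i * n + j) = 1 ↔ G.Adj i j := by
  classical
  rw [adjArray]
  constructor
  · intro h
    split at h
    · rename_i h'
      obtain ⟨i', j', e, h''⟩ := h'
      rw [mul_add_eq_mul_add_iff j.2 j'.2, Fin.val_inj, Fin.val_inj] at e
      rwa [e.1, e.2]
    · simp at h
  · intro h
    rw [if_pos ⟨i, j, rfl, h⟩]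

theorem adjArray_ne_zero (i j : Fin n) : adjArray G (i * n + j) ≠ 0 ↔ G.Adj i j := by
  rw [← adjArray_apply]
  have := adjArray_lt_two G (i * n + j)
  omega

theorem adjArray_eq_iff (i j i' j' : Fin n) :
    adjArray G (i * n + j) = adjArray G (i' * n + j') ↔ (G.Adj i j ↔ G.Adj i' j') := by
  rw [← adjArray_apply, ← adjArray_apply]
  have := adjArray_lt_two G (i * n + j)
  have := adjArray_lt_two G (i' * n + j')
  omega

theorem adjArray_symm (u : ℕ) (hu : u < n) (w : ℕ) (hw : w < n) :
    adjArray G (u * n + w) = adjArray G (w * n + u) :=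
  (adjArray_eq_iff G ⟨u, hu⟩ ⟨w, hw⟩ ⟨w, hw⟩ ⟨u, hu⟩).2 (G.adj_comm _ _)

theorem cliqueParam_lt (k : ℕ) : cliqueParam n k < n + 2 := by
  unfold cliqueParam; omega

/-- The number of cliques of a graph, counted as sets of natural numbers. If `k` is larger than `n`,
both sides are `0`. -/
theorem card_isCliqueOf_adjArray (k : ℕ) [DecidablePred fun U : Finset ℕ =>
      RAM.IsCliqueOf n (adjArray G) U ∧ U.card = cliqueParam n k] :
    ((Finset.range n).powerset.filter fun U =>
      RAM.IsCliqueOf n (adjArray G) U ∧ U.card = cliqueParam n k).card = cliqueCount G k := by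
  classical
  rw [cliqueCount, ← Set.ncard_coe_finset]
  symm
  refine Set.ncard_congr (fun t _ => t.map Fin.valEmbedding) ?_ ?_ ?_
  · intro t ht
    rw [Set.mem_ofPred_eq, SimpleGraph.isNClique_iff] at ht
    have hk : k ≤ n := by
      have := Finset.card_le_univ t
      rw [Fintype.card_fin] at this
      omega
    rw [Finset.mem_coe, Finset.mem_filter, Finset.mem_powerset, Finset.card_map, ht.2, cliqueParam,
      min_eq_left (by omega)]
    refine ⟨?_, ?_, rfl⟩
    · intro x hx
      obtain ⟨i, -, rfl⟩ := Finset.mem_map.1 hx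
      exact Finset.mem_range.2 i.2
    · intro u hu w hw huw
      obtain ⟨i, hi, rfl⟩ := Finset.mem_map.1 hu
      obtain ⟨j, hj, rfl⟩ := Finset.mem_map.1 hw
      exact (adjArray_ne_zero G i j).2 (ht.1 hi hj fun e => huw (by rw [e]))
  · intro t t' _ _ h
    exact Finset.map_injective _ h
  · intro U hU
    rw [Finset.mem_coe, Finset.mem_filter, Finset.mem_powerset] at hU
    obtain ⟨hU, hcl, hcard⟩ := hU
    have hk : k ≤ n := by
      have h1 := Finset.card_le_card hU
      rw [Finset.card_range, hcard, cliqueParam] at h1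
      omega
    have hmem : (Finset.univ.filter fun i : Fin n => (i : ℕ) ∈ U).map Fin.valEmbedding = U := by
      ext x
      simp only [Finset.mem_map, Finset.mem_filter, Finset.mem_univ, true_and,
        Fin.valEmbedding_apply]
      exact ⟨by rintro ⟨i, hi, rfl⟩; exact hi,
        fun hx => ⟨⟨x, Finset.mem_range.1 (hU hx)⟩, hx, rfl⟩⟩
    refine ⟨Finset.univ.filter fun i : Fin n => (i : ℕ) ∈ U, ?_, hmem⟩
    rw [Set.mem_ofPred_eq, SimpleGraph.isNClique_iff]
    refine ⟨?_, ?_⟩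
    · intro i hi j hj hij
      simp only [Finset.coe_filter, Finset.mem_univ, true_and, Set.mem_ofPred_eq] at hi hj
      exact (adjArray_ne_zero G i j).1 (hcl i hi j hj fun e => hij (Fin.ext e))
    · rw [← Finset.card_map Fin.valEmbedding, hmem, hcard, cliqueParam, min_eq_left (by omega)]

theorem factorial_le_card_relabellings_of_twinClasses {r : ℕ} {rep cls : ℕ → ℕ}
    (hT : RAM.TwinClasses n (adjArray G) n r rep cls) :
    ((r + 1) / 2).factorial ≤ (relabellings G).card := by
  classical
  set f : Fin r → Fin n := fun c => ⟨rep c, hT.rep_lt c c.2⟩ with hf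
  have key : ∀ c c' : Fin r, c < c' → ∃ w, w ≠ f c ∧ w ≠ f c' ∧
      ¬ (G.Adj (f c) w ↔ G.Adj (f c') w) := by
    intro c c' h
    have h1 := hT.not_twins c' c'.2 c h
    simp only [RAM.Twins, not_forall, not_or] at h1
    obtain ⟨w, hw, h2, h3, h4⟩ := h1
    refine ⟨⟨w, hw⟩, fun e => h3 (congrArg Fin.val e), fun e => h2 (congrArg Fin.val e),
      fun e => ?_⟩
    exact h4 ((adjArray_eq_iff G (f c') ⟨w, hw⟩ (f c) ⟨w, hw⟩).2 e.symm)
  have hinj : Function.Injective f := by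
    intro c c' h
    rcases lt_trichotomy c c' with hc | hc | hc
    · obtain ⟨w, -, -, h'⟩ := key c c' hc
      rw [h] at h'; simp at h'
    · exact hc
    · obtain ⟨w, -, -, h'⟩ := key c' c hc
      rw [h] at h'; simp at h'
  have hcard : (Finset.univ.image f).card = r := by
    rw [Finset.card_image_of_injective _ hinj, Finset.card_univ, Fintype.card_fin]
  rw [← hcard]
  refine factorial_le_card_relabellings G _ fun u hu v hv huv => ?_
  obtain ⟨c, -, rfl⟩ := Finset.mem_image.1 hu
  obtain ⟨c', -, rfl⟩ := Finset.mem_image.1 hv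
  rcases lt_trichotomy c c' with hc | hc | hc
  · exact key c c' hc
  · exact absurd (by rw [hc]) huv
  · obtain ⟨w, h1, h2, h3⟩ := key c' c hc
    exact ⟨w, h2, h1, fun e => h3 e.symm⟩

/-- An array with a permuted adjacency matrix of `G` describes a relabelling of `G`. -/
theorem graphOfArray_eq_comap (σ : Equiv.Perm (Fin n)) {B : ℕ → ℕ}
    (hB : ∀ i j : Fin n, B (i * n + j) = adjArray G (σ i * n + σ j)) :
    graphOfArray n B = G.comap σ := by
  ext i j
  rw [graphOfArray, SimpleGraph.fromRel_adj, SimpleGraph.comap_adj, hB, hB, adjArray_ne_zero,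
    adjArray_ne_zero, G.adj_comm (σ j), or_self]
  exact and_iff_right_of_imp fun h e => h.ne (by rw [e])

end AdjArray

theorem card_simpleGraph (n : ℕ) : Fintype.card (SimpleGraph (Fin n)) = 2 ^ n.choose 2 := by
  classical
  have h : (⊤ : SimpleGraph (Fin n)).edgeFinset.card = n.choose 2 := by
    rw [SimpleGraph.card_edgeFinset_top_eq_card_choose_two, Fintype.card_fin]
  rw [← h, ← Finset.card_powerset, ← Finset.card_univ]
  refine Finset.card_bij (fun G _ => G.edgeFinset) ?_ ?_ ?_
  · intro G _
    exact Finset.mem_powerset.2 (SimpleGraph.edgeFinset_mono le_top)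
  · intro G _ G' _ h
    exact SimpleGraph.edgeFinset_inj.1 h
  · intro s hs
    refine ⟨SimpleGraph.fromEdgeSet s, Finset.mem_univ _, ?_⟩
    rw [← Finset.coe_inj, SimpleGraph.coe_edgeFinset, SimpleGraph.edgeSet_fromEdgeSet,
      sdiff_eq_left, Set.disjoint_left]
    intro e he
    have := Finset.mem_powerset.1 hs he
    rw [SimpleGraph.mem_edgeFinset] at this
    exact SimpleGraph.not_isDiag_of_mem_edgeSet _ this

open Classical in
/-- If `S` contains at least a fraction `x` of the relabellings of `G`, a random permutation takes
`G` into `S` with probability at least `x`. -/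
theorem card_comap_finShuffle_mem_ge {n : ℕ} (G : SimpleGraph (Fin n))
    (S : Finset (SimpleGraph (Fin n))) {x : ℝ}
    (h : x * (relabellings G).card ≤ ((S ∩ relabellings G).card : ℝ)) :
    x * n.factorial ≤
      (((Finset.range n.factorial).filter fun d => G.comap (RAM.finShuffle n d) ∈ S).card : ℝ) := by
  have hpos : (0 : ℝ) < (relabellings G).card := by
    have : (relabellings G).Nonempty := ⟨_, Finset.mem_image_of_mem _ (Finset.mem_univ 1)⟩
    exact_mod_cast this.card_pos
  have h1 := card_perm_comap_mem G S
  rw [Fintype.card_fin] at h1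
  have h2 := RAM.card_finShuffle_mem n fun σ => G.comap σ ∈ S
  refine le_of_mul_le_mul_right ?_ hpos
  calc x * n.factorial * (relabellings G).card
      = n.factorial * (x * (relabellings G).card) := by ring
    _ ≤ n.factorial * ((S ∩ relabellings G).card : ℝ) := by gcongr
    _ = _ := by
      rw [← Nat.cast_mul, ← Nat.cast_mul]
      congr 1
      rw [← h1]
      congr 1
      refine Eq.trans ?_ (h2.symm.trans ?_) <;> congr!

open Classical in
/-- With probability at least `1 - 2 ^ (-n ^ 2)`, a random set of graphs contains a fraction of at
least `(1 + ε) / 2` of the relabellings of every graph that has many of them. -/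
theorem one_sub_le_probOfSet {n m : ℕ} {ε : ℝ} (hε : 0 < ε) (hε' : ε ≤ 1 / 2)
    (hm : m ≤ 2 ^ n.choose 2) (hm' : (1 / 2 + ε) * 2 ^ n.choose 2 ≤ (m : ℝ))
    {E : Set (SimpleGraph (Fin n)) → Prop}
    (hE : ∀ S : Finset (SimpleGraph (Fin n)),
      (∀ G : SimpleGraph (Fin n), 16 * (n : ℝ) ^ 2 / ε ^ 2 ≤ (relabellings G).card →
        (1 + ε) / 2 * (relabellings G).card ≤ ((S ∩ relabellings G).card : ℝ)) → E S) :
    1 - (2 : ℝ) ^ (-(1 * (n : ℝ) ^ 2)) ≤ probOfSet n m E := by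
  set big := Finset.univ.filter fun G : SimpleGraph (Fin n) =>
    16 * (n : ℝ) ^ 2 / ε ^ 2 ≤ (relabellings G).card with hbig
  set all := Finset.powersetCard m (Finset.univ : Finset (SimpleGraph (Fin n))) with hall
  set bad : SimpleGraph (Fin n) → Finset (Finset (SimpleGraph (Fin n))) := fun G =>
    all.filter fun S => ((S ∩ relabellings G).card : ℝ) < (1 + ε) / 2 * (relabellings G).card
    with hbad
  have hcard := card_simpleGraph n
  have hallcard : all.card = (2 ^ n.choose 2).choose m := by
    rw [hall, Finset.card_powersetCard, Finset.card_univ, hcard]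
  have hchoose : (0 : ℝ) < ((2 ^ n.choose 2).choose m : ℕ) := by
    exact_mod_cast Nat.choose_pos hm
  have h1 : ∀ G ∈ big, ((bad G).card : ℝ) ≤
      Real.exp (-(2 * (n : ℝ) ^ 2)) * ((2 ^ n.choose 2).choose m : ℕ) := by
    intro G hG
    have h2 := card_filter_card_inter_lt_le (relabellings G) (m := m) hε hε' (by rwa [hcard])
      (by rw [hcard]; exact_mod_cast hm')
    rw [hcard] at h2
    refine le_trans (le_of_eq ?_) (h2.trans ?_)
    · rw [hbad]
    · refine mul_le_mul_of_nonneg_right (Real.exp_le_exp.2 ?_) (by positivity)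
      have h3 := (div_le_iff₀ (by positivity)).1 (Finset.mem_filter.1 hG).2
      nlinarith
  -- There are at most `2 ^ n ^ 2` graphs, and `e ^ 2 > 4`.
  have h2 : (((big.biUnion bad).card : ℕ) : ℝ) ≤
      (2 : ℝ) ^ (-(1 * (n : ℝ) ^ 2)) * ((2 ^ n.choose 2).choose m : ℕ) := by
    have h3 : ((big.biUnion bad).card : ℝ) ≤ ∑ G ∈ big, ((bad G).card : ℝ) := by
      exact_mod_cast Finset.card_biUnion_le
    have h4 : (big.card : ℝ) ≤ 2 ^ (n : ℝ) ^ 2 := by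
      have h5 : big.card ≤ 2 ^ n.choose 2 := by rw [← hcard]; exact Finset.card_le_univ _
      have h6 : n.choose 2 ≤ n ^ 2 := Nat.choose_le_pow n 2
      have h7 : big.card ≤ 2 ^ (n ^ 2) := h5.trans (Nat.pow_le_pow_right (by norm_num) h6)
      have h8 : (2 : ℝ) ^ (n : ℝ) ^ 2 = ((2 ^ (n ^ 2) : ℕ) : ℝ) := by
        rw [← Nat.cast_pow, Real.rpow_natCast]; push_cast; rfl
      rw [h8]; exact_mod_cast h7
    have h5 : Real.exp (-(2 * (n : ℝ) ^ 2)) ≤ 2 ^ (-(2 * (n : ℝ) ^ 2)) := by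
      rw [Real.rpow_def_of_pos (by norm_num)]
      refine Real.exp_le_exp.2 ?_
      have := Real.log_two_lt_d9
      nlinarith [sq_nonneg (n : ℝ)]
    have h6 : (2 : ℝ) ^ (n : ℝ) ^ 2 * 2 ^ (-(2 * (n : ℝ) ^ 2)) = 2 ^ (-(1 * (n : ℝ) ^ 2)) := by
      rw [← Real.rpow_add (by norm_num)]; ring_nf
    refine h3.trans ((Finset.sum_le_sum h1).trans ?_)
    rw [Finset.sum_const, nsmul_eq_mul, ← h6, ← mul_assoc]
    gcongr
  have hgood : ∀ S ∈ all \ big.biUnion bad, E S := by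
    intro S hS
    rw [Finset.mem_sdiff] at hS
    refine hE S fun G hG => ?_
    by_contra h
    refine hS.2 (Finset.mem_biUnion.2 ⟨G, Finset.mem_filter.2 ⟨Finset.mem_univ _, hG⟩, ?_⟩)
    exact Finset.mem_filter.2 ⟨hS.1, not_le.1 h⟩
  have hsub : big.biUnion bad ⊆ all := by
    refine Finset.biUnion_subset.2 fun G _ => Finset.filter_subset _ _
  have hden : {S : Set (SimpleGraph (Fin n)) | S.ncard = m}.ncard = (2 ^ n.choose 2).choose m := by
    rw [← hallcard, ← Set.ncard_coe_finset]
    symm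
    refine Set.ncard_congr (fun S _ => (S : Set (SimpleGraph (Fin n)))) ?_ ?_ ?_
    · intro S hS
      rw [Set.mem_ofPred_eq, Set.ncard_coe_finset]
      exact (Finset.mem_powersetCard.1 hS).2
    · intro S S' _ _ h
      exact Finset.coe_injective h
    · intro S hS
      rw [Set.mem_ofPred_eq, Set.ncard_eq_toFinset_card'] at hS
      exact ⟨S.toFinset, Finset.mem_powersetCard.2 ⟨Finset.subset_univ _, hS⟩, Set.coe_toFinset S⟩
  have hnum : (all \ big.biUnion bad).card ≤
      {S : Set (SimpleGraph (Fin n)) | S.ncard = m ∧ E S}.ncard := by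
    rw [← Set.ncard_coe_finset]
    refine Set.ncard_le_ncard_of_injOn (fun S : Finset _ => (S : Set (SimpleGraph (Fin n)))) ?_ ?_
      (Set.toFinite _)
    · intro S hS
      rw [Set.mem_ofPred_eq, Set.ncard_coe_finset]
      exact ⟨(Finset.mem_powersetCard.1 (Finset.mem_sdiff.1 hS).1).2, hgood S hS⟩
    · intro S _ S' _ h
      exact Finset.coe_injective h
  rw [probOfSet, hden, le_div_iff₀ hchoose]
  have h7 := Finset.card_sdiff_add_card_eq_card hsub
  rw [hallcard] at h7
  have h8 : ((all \ big.biUnion bad).card : ℝ) + (big.biUnion bad).card =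
      ((2 ^ n.choose 2).choose m : ℕ) := by exact_mod_cast h7
  have h9 : ((all \ big.biUnion bad).card : ℝ) ≤
      {S : Set (SimpleGraph (Fin n)) | S.ncard = m ∧ E S}.ncard := by exact_mod_cast hnum
  linarith

namespace RAM

/-! ### The program -/

/-- Counts the cliques, runs the program `Q` on the graph and this count, and copies its output. -/
def solveByCounting (Q : Prog) : Prog :=
  .seq countCliques (.seq copyInput (.seq Q.shift (.set 4 (.var 104))))

/-- Finds the twin classes; if they are so few that the isomorphism class of the graph may be too
small for a vote, there is time to count the cliques. -/
def countOrVote (Q : Prog) (K : ℕ) : Prog :=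
  .seq findTwinClasses (.seq computeThreshold
    (.cond (.op .lt (.var 24) (.var 27)) (solveByCounting Q) (vote K)))

theorem lt_hundred_of_mem_wv : (∀ x ∈ findTwinClasses.wv, x < 100) ∧
    (∀ x ∈ computeThreshold.wv, x < 100) ∧ ∀ x ∈ countCliques.wv, x < 100 := by
  decide

theorem lt_hundred_of_mem_wa : (∀ x ∈ findTwinClasses.wa, x < 100) ∧
    (∀ x ∈ computeThreshold.wa, x < 100) ∧ ∀ x ∈ countCliques.wa, x < 100 := by
  decide

theorem runs_solveByCounting {orc : Option Oracle} {v : ℕ → ℕ} {a : ℕ → ℕ → ℕ} {W n m r k : ℕ}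
    {G : SimpleGraph (Fin n)} {Q : Prog} {s : State}
    (hW : 2 * (n * n) + 20 ≤ W) (h0 : v 0 = n) (h1 : v 1 = cliqueParam n k) (h2 : v 2 = m)
    (hm : m < 2 ^ W) (hr : v 10 = r) (hA : a 0 = adjArray G)
    (hT : TwinClasses n (adjArray G) n r (a 1) (a 2)) (h5 : ∀ y, a 5 y = 0)
    (hv : ∀ x, 100 ≤ x → v x = 0) (ha : ∀ b, 100 ≤ b → ∀ i, a b i = 0)
    (hQ : Exec none Q (initState G (cliqueParam n k) m (cliqueCount G k)) (PMF.pure s)) :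
    Runs orc (solveByCounting Q) v a
      ((200 * (2 ^ r * (n + 2) ^ 3) + 20 * (n * n) + 30) * (W + 1) ^ 2 + 3 * s.cost + 2)
      fun v' _ => v' 4 = s.var 4 := by
  have h3W : W < 2 ^ W := Nat.lt_two_pow_self
  have hnn : n ≤ n * n := Nat.le_mul_self n
  have hcnt : cliqueCount G k < 2 ^ W := by
    classical
    rw [← card_isCliqueOf_adjArray]
    refine (Finset.card_filter_le _ _).trans_lt ?_
    rw [Finset.card_powerset, Finset.card_range]
    exact Nat.pow_lt_pow_right (by norm_num) (by omega)
  -- The output of `Q` is copied within the time that `Q` took to write it down.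
  have hsize : (s.var 4).size ≤ s.cost := by
    have := (hQ.size_var_le s (by simp)).2 4
    simpa [initState] using this
  refine Runs.mono (t₁ := 200 * (2 ^ r * (n + 2) ^ 3) * (W + 1) ^ 2 +
    ((20 * (n * n) + 30) * (W + 1) ^ 2 + (s.cost + (2 * s.cost + 2)))) ?_
    (Runs.seq_frame (R := fun v' _ => v' 3 = cliqueCount G k) ?_ fun v₁ a₁ e3 hv₁ ha₁ =>
    Runs.seq (Runs.imp (runs_copyInput (W := W) (n := n) (k := cliqueParam n k) (m := m)
      (c := cliqueCount G k) (by omega) (by omega) ?_ ?_ ?_ e3 ?_ hm hcnt ?_ ?_ ?_ ?_)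
      fun v₂ a₂ h₂ => Runs.seq (Runs.imp (runs_shift hQ rfl ?_ ?_)
        fun v₃ a₃ h₃ => Runs.set_of_time ?_ ?_)))
  · apply le_of_eq; ring
  · refine Runs.imp (runs_countCliques (k := cliqueParam n k) hW h0 hr (by rwa [hA]) ?_ ?_ h1
      (cliqueParam_lt k) h5) fun v' _ h => ?_
    · rw [hA]; exact adjArray_lt_two G
    · rw [hA]; exact adjArray_symm G
    · classical
      rw [h, hA, ← card_isCliqueOf_adjArray]
  · rw [hv₁ 0 (by decide), h0]
  · rw [hv₁ 1 (by decide), h1]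
  · rw [hv₁ 2 (by decide), h2]
  · have := cliqueParam_lt (n := n) k
    omega
  · rw [ha₁ 0 (by decide), hA]; exact adjArray_lt_two G
  · rw [ha₁ 0 (by decide), hA]; exact fun i hi => adjArray_of_le G hi
  · intro x hx
    rw [hv₁ x fun h => absurd (lt_hundred_of_mem_wv.2.2 x h) (by omega), hv x hx]
  · intro x hx i
    rw [ha₁ x fun h => absurd (lt_hundred_of_mem_wa.2.2 x h) (by omega), ha x hx]
  · exact h₂.1
  · intro b
    rw [h₂.2, ha₁ 0 (by decide), hA]
    rfl
  · have h4 : v₃ 104 = s.var 4 := h₃ 4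
    simp only [Exp.time, Exp.cost, Exp.val, h4]
    omega
  · simpa [Exp.val] using h₃ 4

/-- The two cases of the program, where `r` is the number of twin classes and `⟨v, a, c⟩` is the
memory when the case distinction has been made. -/
theorem exec_countOrVote {orc : Option Oracle} {n m W : ℕ} (k : ℕ) (G : SimpleGraph (Fin n))
    (Q : Prog) (K : ℕ) (hW : 2 * (n * n) + 20 ≤ W) (hm : m ≤ 2 ^ n.choose 2) :
    ∃ r v a c, ((r + 1) / 2).factorial ≤ (relabellings G).card ∧ r ≤ n ∧
      c ≤ (n * (n * (38 * n + 40) + 40) + 12 * (n * n) + 20 * n + 114) * (W + 1) ^ 2 ∧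
      v 0 = n ∧ v 23 = invGap n m ∧ a 0 = adjArray G ∧
      (((r + 1) / 2).factorial < 144 * (n * n) * (invGap n m * invGap n m) →
        ∀ s, Exec none Q (initState G (cliqueParam n k) m (cliqueCount G k)) (PMF.pure s) →
          ∃ s', Exec orc (countOrVote Q K) (initState G (cliqueParam n k) m 0) (PMF.pure s') ∧
            s'.output = s.output ∧ s'.cost ≤ c +
              ((200 * (2 ^ r * (n + 2) ^ 3) + 20 * (n * n) + 30) * (W + 1) ^ 2 + 3 * s.cost + 2)) ∧
      (144 * (n * n) * (invGap n m * invGap n m) ≤ ((r + 1) / 2).factorial →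
        ∀ μ, Exec orc (vote K) ⟨v, a, c⟩ μ →
          Exec orc (countOrVote Q K) (initState G (cliqueParam n k) m 0) μ) := by
  have h1W : 1 ≤ W := by omega
  have hnW : n * n + n < 2 ^ W := by
    have h3 : W < 2 ^ W := Nat.lt_two_pow_self
    have := Nat.le_mul_self n
    omega
  set s₀ := initState G (cliqueParam n k) m 0 with hs₀
  have hA0 : s₀.arr 0 = adjArray G := by simp [hs₀, initState]
  obtain ⟨v₁, a₁, c₁, e₁, hc₁, hT, hv₁, ha₁⟩ :=
    (runs_findTwinClasses (orc := orc) (v := s₀.var) (a := s₀.arr) (W := W) (n := n) (by omega) hnW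
      (by simp [hs₀, initState]) (by rw [hA0]; exact adjArray_lt_two G)).frame 0
  rw [hA0] at hT
  obtain ⟨v₂, a₂, c₂, e₂, hc₂, ⟨h23, h24, h27⟩, hv₂, ha₂⟩ :=
    (runs_computeThreshold (orc := orc) (v := v₁) (a := a₁) (W := W) (n := n) (m := m) (r := v₁ 10)
      hW (by rw [hv₁ 0 (by decide)]; simp [hs₀, initState])
      (by rw [hv₁ 2 (by decide)]; simp [hs₀, initState]) hm rfl hT.card_le).frame c₁
  set e : Exp := .op .lt (.var 24) (.var 27) with he
  set t := e.cost ⟨v₂, a₂, c₂⟩ + 1 with ht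
  have hf : e.Fits v₂ a₂ (2 ^ W) := by
    have h2 := invGap_sq_le n m
    have h3 : 144 * (n * n) * (invGap n m * invGap n m) < 2 ^ W := by
      calc 144 * (n * n) * (invGap n m * invGap n m) ≤ 144 * (n * n) * 2 ^ (n * n + 2) := by gcongr
        _ < 2 ^ (n * n + 8) * 2 ^ (n * n + 2) := by
          have h4 : n * n < 2 ^ (n * n) := Nat.lt_two_pow_self
          have h5 : 144 * (n * n) < 2 ^ (n * n + 8) := by rw [pow_add]; omega
          exact Nat.mul_lt_mul_of_pos_right h5 (by positivity)
        _ = 2 ^ (2 * (n * n) + 10) := by rw [← pow_add]; congr 1; ring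
        _ ≤ 2 ^ W := Nat.pow_le_pow_right (by norm_num) (by omega)
    have h4 : (v₁ 10 + 1) / 2 ≤ n := by have := hT.card_le; omega
    have h5 := factorial_lt_two_pow (n := n) (W := W) (by omega) h4
    simp only [he, Exp.Fits]
    rw [h24, h27]
    exact ⟨h5, h3⟩
  have htU : t ≤ 4 * (W + 1) ^ 2 := by
    have h1 := hf.time_le h1W
    have h2 : e.len = 3 := rfl
    rw [Exp.time, ← Exp.cost_congr ⟨v₂, a₂, c₂⟩ ⟨v₂, a₂, 0⟩ rfl rfl, h2] at h1
    nlinarith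
  have hcond : e.eval ⟨v₂, a₂, c₂⟩ ≠ 0 ↔
      ((v₁ 10 + 1) / 2).factorial < 144 * (n * n) * (invGap n m * invGap n m) := by
    simp [he, Exp.eval, Op.eval, h24, h27]
  have hseq : ∀ μ, Exec orc (.cond e (solveByCounting Q) (vote K)) ⟨v₂, a₂, c₂⟩ μ →
      Exec orc (countOrVote Q K) s₀ μ := by
    intro μ h
    have h1 := Exec.seq computeThreshold (.cond e (solveByCounting Q) (vote K)) _ _ (fun _ => μ) e₂
      (by simpa using h)
    have h2 := Exec.seq findTwinClasses (.seq computeThreshold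
      (.cond e (solveByCounting Q) (vote K))) _ _
      (fun _ => (PMF.pure (State.mk v₂ a₂ c₂)).bind fun _ => μ) e₁ (by simpa using h1)
    rw [PMF.pure_bind, PMF.pure_bind] at h2
    exact h2
  have w₁ : ∀ x, x ∉ findTwinClasses.wv → x ∉ computeThreshold.wv → v₂ x = s₀.var x :=
    fun x h h' => (hv₂ x h').trans (hv₁ x h)
  have b₁ : ∀ x, x ∉ findTwinClasses.wa → x ∉ computeThreshold.wa → a₂ x = s₀.arr x :=
    fun x h h' => (ha₂ x h').trans (ha₁ x h)
  refine ⟨v₁ 10, v₂, a₂, c₂ + t, factorial_le_card_relabellings_of_twinClasses G hT, hT.card_le, ?_,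
    ?_, h23, ?_, ?_, ?_⟩
  · calc c₂ + t ≤ (n * (n * (38 * n + 40) + 40) + 10) * (W + 1) ^ 2 +
          (12 * (n * n) + 20 * n + 100) * (W + 1) ^ 2 + 4 * (W + 1) ^ 2 := by omega
      _ = _ := by ring
  · rw [w₁ 0 (by decide) (by decide)]; simp [hs₀, initState]
  · rw [b₁ 0 (by decide) (by decide), hA0]
  · intro hlt s hs
    obtain ⟨v₃, a₃, c₃, e₃, hc₃, h4⟩ := runs_solveByCounting (orc := orc) (v := v₂) (a := a₂)
      (W := W) (n := n) (m := m) (r := v₁ 10) (k := k) (G := G) hW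
      (by rw [w₁ 0 (by decide) (by decide)]; simp [hs₀, initState])
      (by rw [w₁ 1 (by decide) (by decide)]; simp [hs₀, initState])
      (by rw [w₁ 2 (by decide) (by decide)]; simp [hs₀, initState])
      (by
        have : n.choose 2 ≤ n * n := by rw [← sq]; exact Nat.choose_le_pow n 2
        exact hm.trans_lt (Nat.pow_lt_pow_right (by norm_num) (by omega)))
      (by rw [hv₂ 10 (by decide)])
      (by rw [b₁ 0 (by decide) (by decide), hA0])
      (by rw [ha₂ 1 (by decide), ha₂ 2 (by decide)]; exact hT)
      (by rw [b₁ 5 (by decide) (by decide)]; simp [hs₀, initState])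
      (fun x hx => by
        rw [w₁ x (fun h => absurd (lt_hundred_of_mem_wv.1 x h) (by omega))
          (fun h => absurd (lt_hundred_of_mem_wv.2.1 x h) (by omega))]
        simp only [hs₀, initState]
        rw [if_neg (by omega), if_neg (by omega), if_neg (by omega), if_neg (by omega)])
      (fun x hx i => by
        rw [b₁ x (fun h => absurd (lt_hundred_of_mem_wa.1 x h) (by omega))
          (fun h => absurd (lt_hundred_of_mem_wa.2.1 x h) (by omega))]
        simp only [hs₀, initState]
        rw [if_neg (by omega)])
      hs (c₂ + t)
    refine ⟨⟨v₃, a₃, c₃⟩, hseq _ (Exec.cond_true _ _ _ _ _ (hcond.2 hlt) e₃), h4,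
      hc₃⟩
  · intro hle μ hμ
    exact hseq _ (Exec.cond_false _ _ _ _ _ (by rw [← not_ne_iff, hcond]; exact not_lt.2 hle) hμ)

/-! ### The vote among the relabellings -/

/-- A program that simulates the oracle takes the time to write down its answers. -/
theorem size_enc_le_of_simulatedInTime {𝔻 : Type*} {enc : 𝔻 ↪ ℕ} {n T : ℕ}
    {O : SimpleGraph (Fin n) → 𝔻} (h : SimulatedInTime enc O T) (G : SimpleGraph (Fin n)) :
    (enc (O G)).size ≤ T := by
  obtain ⟨Q, hQ⟩ := h
  obtain ⟨s, hs, hout, hcost⟩ := hQ G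
  have h1 := (hs.size_var_le s (by simp)).2 4
  rw [← hout]
  simp [initState] at h1
  exact h1.trans hcost

open Classical in
/-- If the oracle is right on more than half of the relabellings of `G`, the vote finds the common
value of the invariant `F` on all of them, up to a probability that decreases exponentially with the
number of samples. -/
theorem exec_vote_of_oracle {𝔻 : Type*} {enc : 𝔻 ↪ ℕ} {n W K q t T : ℕ}
    {v : ℕ → ℕ} {a : ℕ → ℕ → ℕ} {F O : SimpleGraph (Fin n) → 𝔻} {G : SimpleGraph (Fin n)}
    (hF : ∀ σ : Equiv.Perm (Fin n), F (G.comap σ) = F G)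
    {S : Finset (SimpleGraph (Fin n))}
    (hO : ∀ G ∈ S, O G = F G) (hT : SimulatedInTime enc O T) {η δ : ℝ} (hη : 0 < η)
    (hη' : η ≤ 1 / 2)
    (hS : (1 / 2 + η) * (relabellings G).card ≤ ((S ∩ relabellings G).card : ℝ))
    (hδ : Real.exp (-(η ^ 2 * t)) ≤ δ) (hW : n * n + 2 ≤ W) (h0 : v 0 = n) (h23 : v 23 = q)
    (hK : K < 2 ^ W) (hq : q * q < 2 ^ W) (ht : K * (q * q) = t) (htW : t + 1 < 2 ^ W)
    (hA : a 0 = adjArray G) (c : ℕ) :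
    ∃ μ : PMF State, Exec (some (graphOracle enc O T)) (vote K) ⟨v, a, c⟩ μ ∧
      (∀ s ∈ μ.support, s.cost ≤ c + ((16 * n + 50) * (W + 1) ^ 2 + 6 * (t * W + 2) + t *
        (12 * (t * W + 2) * (W + 1) + (22 * (n * n) + 30 * n + 46) * (W + 1) ^ 2 + 10 * T + 10)
        + 2 * T + 2)) ∧
      ENNReal.ofReal (1 - δ) ≤ (μ.map State.output) (enc (F G)) := by
  set ans : ℕ → ℕ := fun d => enc (O (G.comap (finShuffle n d))) with hans
  set b := n.factorial with hb
  have hb0 : 0 < b := Nat.factorial_pos n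
  set good := (Finset.range (b ^ t)).filter fun V => 0 < voteBalance ans b t (enc (F G)) V
    with hgood
  have hL : b ^ t < 2 ^ (t * W + 1) := by
    have h1 : b < 2 ^ W := factorial_lt_two_pow hW le_rfl
    calc b ^ t ≤ (2 ^ W) ^ t := Nat.pow_le_pow_left h1.le t
      _ = 2 ^ (t * W) := by rw [← pow_mul, mul_comm]
      _ < _ := Nat.pow_lt_pow_right (by norm_num) (by omega)
  have hquery : ∀ d < b, ∀ B : ℕ → ℕ,
      (∀ z < n * n, B z = a 0 (shuffle d n (z / n) * n + shuffle d n (z % n))) →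
        (graphOracle enc O T).answer B = ans d := by
    intro d _ B hB
    simp only [graphOracle, hans]
    rw [graphOfArray_eq_comap G (finShuffle n d)]
    intro i j
    have hn : 0 < n := i.pos
    have h1 : (i * n + j : ℕ) / n = i := by
      rw [mul_comm, Nat.mul_add_div hn, Nat.div_eq_of_lt j.2, add_zero]
    have h2 : (i * n + j : ℕ) % n = j := by
      rw [Nat.mul_add_mod', Nat.mod_eq_of_lt j.2]
    have h3 := Nat.mul_le_mul_right n (show (i : ℕ) + 1 ≤ n from i.2)
    rw [hB _ (by nlinarith [j.2]), h1, h2, hA, coe_finShuffle, coe_finShuffle]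
  obtain ⟨μ, hμ, hcost, hout⟩ := exec_vote (o := graphOracle enc O T) (v := v) (a := a) (W := W)
    (n := n) (L := t * W + 1) (K := K) (T := T) (q := q) (t := t) (w := enc (F G)) (ans := ans)
    hW h0 h23 hK hq ht htW hL (by rw [hA]; exact adjArray_lt_two G) rfl
    (fun d _ => size_enc_le_of_simulatedInTime hT _) hquery good (Finset.filter_subset _ _)
    (fun V hV => (Finset.mem_filter.1 hV).2) c
  refine ⟨μ, hμ, hcost, le_trans ?_ hout⟩
  have h1 : (1 / 2 + η) * b ≤
      (((Finset.range b).filter fun d => ans d = enc (F G)).card : ℝ) := by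
    have h2 := card_comap_finShuffle_mem_ge G S hS
    refine h2.trans (Nat.cast_le.2 (Finset.card_le_card ?_))
    intro d hd
    rw [Finset.mem_filter] at hd ⊢
    refine ⟨hd.1, ?_⟩
    simp only [hans]
    rw [hO _ hd.2, hF]
  have h2 := card_voteBalance_pos_ge ans hb0 t (enc (F G)) hη hη' h1
  have hbt : (0 : ℝ) < (b : ℝ) ^ t := by positivity
  rw [← ENNReal.ofReal_natCast, ← ENNReal.ofReal_natCast, Nat.cast_pow,
    ← ENNReal.ofReal_div_of_pos hbt]
  refine ENNReal.ofReal_le_ofReal ?_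
  rw [le_div_iff₀ hbt]
  refine le_trans ?_ h2
  gcongr

end RAM

/-! ### Estimates -/

theorem factorial_le_two_pow_choose (n : ℕ) : n.factorial ≤ 2 ^ n.choose 2 := by
  induction n with
  | zero => simp
  | succ n ih =>
    rw [Nat.factorial_succ, Nat.choose_succ_succ', Nat.choose_one_right, pow_add]
    exact Nat.mul_le_mul Nat.lt_two_pow_self ih

theorem two_le_mul_two_pow_choose {n : ℕ} (hn : 2 ≤ n) {ε : ℝ}
    (h : (n : ℝ) ^ (3 / 2 : ℝ) / √(n.factorial : ℝ) ≤ ε) : 2 ≤ ε * 2 ^ n.choose 2 := by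
  have h1 : (1 : ℝ) ≤ n.factorial := by exact_mod_cast Nat.one_le_iff_ne_zero.2 n.factorial_ne_zero
  have h2 : (n.factorial : ℝ) ≤ 2 ^ n.choose 2 := by exact_mod_cast factorial_le_two_pow_choose n
  have h3 : (1 : ℝ) ≤ √(n.factorial : ℝ) := Real.one_le_sqrt.2 h1
  have hn' : (2 : ℝ) ≤ n := by exact_mod_cast hn
  have h4 : (2 : ℝ) ≤ (n : ℝ) ^ (3 / 2 : ℝ) := by
    calc (2 : ℝ) ≤ n := hn'
      _ = (n : ℝ) ^ (1 : ℝ) := (Real.rpow_one _).symm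
      _ ≤ _ := Real.rpow_le_rpow_of_exponent_le (by linarith) (by norm_num)
  rw [div_le_iff₀ (by linarith)] at h
  have h5 : √(n.factorial : ℝ) ≤ n.factorial := Real.sqrt_le_self_iff.2 (Or.inr h1)
  have h6 : 0 < ε := by
    by_contra h6
    nlinarith
  nlinarith

namespace RAM

/-- The rounding in the size `m` and in the division matters little if `ε * 2 ^ N` is at least `2`.
-/
theorem invGap_bounds {n m : ℕ} {ε : ℝ} (hε : 0 < ε) (hε' : ε ≤ 1 / 2)
    (h2 : 2 ≤ ε * 2 ^ n.choose 2) (hm : m = ⌈(1 / 2 + ε) * 2 ^ n.choose 2⌉₊) :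
    1 / (3 * ε) ≤ invGap n m ∧ (invGap n m : ℝ) ≤ 1 / ε := by
  have h3 := Nat.le_ceil ((1 / 2 + ε) * (2 : ℝ) ^ n.choose 2)
  have h4 := Nat.ceil_lt_add_one (a := (1 / 2 + ε) * (2 : ℝ) ^ n.choose 2) (by positivity)
  rw [← hm] at h3 h4
  set M := 2 ^ n.choose 2 with hM
  have hMr : (2 : ℝ) ^ n.choose 2 = (M : ℝ) := by rw [hM]; push_cast; rfl
  rw [hMr] at h2 h3 h4
  have h5 : M ≤ m + m := by
    have : (M : ℝ) ≤ ((m + m : ℕ) : ℝ) := by push_cast; linarith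
    exact_mod_cast this
  set D := m + m - M with hD
  have hDr : (D : ℝ) = m + m - M := by rw [hD, Nat.cast_sub h5]; push_cast; rfl
  have hD1 : 2 * (ε * M) ≤ D := by linarith
  have hD2 : (D : ℝ) ≤ 3 * (ε * M) := by linarith
  have hD0 : (0 : ℝ) < D := by linarith
  have hDn : 0 < D := by exact_mod_cast hD0
  unfold invGap
  rw [← hM, ← hD]
  constructor
  · have h6 : (M : ℝ) < D * ((M / D + 1 : ℕ) : ℝ) := by
      exact_mod_cast Nat.lt_mul_div_succ M hDn
    rw [div_le_iff₀ (by positivity)]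
    have hM0 : (0 : ℝ) < M := by
      by_contra h; nlinarith
    have h7 : (0 : ℝ) ≤ ((M / D + 1 : ℕ) : ℝ) := by positivity
    nlinarith
  · have h6 : ((M / D : ℕ) : ℝ) ≤ M / D := Nat.cast_div_le
    have h7 : (M : ℝ) / D ≤ 1 / (2 * ε) := by
      rw [div_le_div_iff₀ hD0 (by positivity)]
      linarith
    have h8 : (1 : ℝ) ≤ 1 / (2 * ε) := by
      rw [le_div_iff₀ (by positivity)]; linarith
    have h9 : 1 / (2 * ε) + 1 / (2 * ε) = 1 / ε := by field_simp; norm_num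
    push_cast
    linarith

end RAM

theorem setSize_le {ε : ℕ → ℝ} {n : ℕ} (hε : ε n ≤ 1 / 2) : setSize ε n ≤ 2 ^ n.choose 2 := by
  refine Nat.ceil_le.2 ?_
  push_cast
  have : (0 : ℝ) < 2 ^ n.choose 2 := by positivity
  nlinarith

/-- Factorials grow faster than exponentials: where `h !` is at most about the square of `y n`,
`4 ^ h` is at most `y n ^ o(1)`. -/
theorem exists_tendsto_four_pow_le {y : ℕ → ℝ} (hy : Tendsto y atTop atTop) :
    ∃ e : ℕ → ℝ, Tendsto e atTop (𝓝 0) ∧ ∀ᶠ n in atTop, 0 ≤ e n ∧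
      ∀ h ≤ n, (h.factorial : ℝ) < 144 * y n ^ 2 → (4 : ℝ) ^ h ≤ y n ^ e n := by
  classical
  -- the largest `h` in question
  set g : ℕ → ℕ := fun n => Nat.findGreatest (fun h => (h.factorial : ℝ) < 144 * y n ^ 2) n with hg
  have hlog : Tendsto (fun n => Real.log (y n)) atTop atTop := Real.tendsto_log_atTop.comp hy
  have hy1 : ∀ᶠ n in atTop, 1 ≤ y n := hy.eventually_ge_atTop 1
  have hl1 : ∀ᶠ n in atTop, 1 ≤ Real.log (y n) := hlog.eventually_ge_atTop 1
  have h4 : 0 < Real.log 4 := Real.log_pos (by norm_num)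
  refine ⟨fun n => g n * Real.log 4 / Real.log (y n), ?_, ?_⟩
  · have hpos : ∀ᶠ n in atTop, 0 ≤ g n * Real.log 4 / Real.log (y n) := by
      filter_upwards [hl1] with n hn
      positivity
    rw [Metric.tendsto_nhds]
    intro x hx
    -- By `exp (Λ * h) = O(h !)`, the quotient is at most about `2 * log 4 / Λ = x / 2`.
    set Λ := 4 * Real.log 4 / x with hΛ
    have hΛ0 : 0 < Λ := by positivity
    obtain ⟨M, hM⟩ := (FloorSemiring.tendsto_pow_div_factorial_atTop (Real.exp Λ)).bddAbove_range
    have hM' : ∀ h : ℕ, h * Λ ≤ Real.log (max M 1) + Real.log h.factorial := by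
      intro h
      have h1 : Real.exp Λ ^ h / h.factorial ≤ max M 1 := (hM ⟨h, rfl⟩).trans (le_max_left _ _)
      have h2 : (0 : ℝ) < h.factorial := by exact_mod_cast h.factorial_pos
      have h3 : (0 : ℝ) < max M 1 := lt_max_of_lt_right one_pos
      rw [div_le_iff₀ h2, ← Real.exp_nat_mul] at h1
      have h5 := Real.log_le_log (Real.exp_pos _) h1
      rwa [Real.log_exp, Real.log_mul h3.ne' h2.ne'] at h5
    filter_upwards [hpos, hy1, hl1,
      hlog.eventually_ge_atTop (Real.log (max M 1) + Real.log 144)] with n h0 h1 h2 h3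
    rw [Real.dist_eq, sub_zero, abs_of_nonneg h0, div_lt_iff₀ (by linarith)]
    have h5 : ((g n).factorial : ℝ) < 144 * y n ^ 2 := by
      refine Nat.findGreatest_spec (P := fun h => (h.factorial : ℝ) < 144 * y n ^ 2)
        (Nat.zero_le n) ?_
      simp only [Nat.factorial_zero, Nat.cast_one]
      nlinarith
    have h6 : Real.log (g n).factorial ≤ Real.log 144 + 2 * Real.log (y n) := by
      have h7 : (0 : ℝ) < (g n).factorial := by exact_mod_cast (g n).factorial_pos
      have := Real.log_le_log h7 h5.le
      rwa [Real.log_mul (by norm_num) (by positivity), Real.log_pow, Nat.cast_ofNat] at this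
    have h7 : g n * Λ ≤ 3 * Real.log (y n) := by linarith [hM' (g n)]
    have h8 : g n * Real.log 4 = g n * Λ * (x / 4) := by rw [hΛ]; field_simp
    rw [h8]
    nlinarith
  · filter_upwards [hy1, hl1] with n h1 h2
    refine ⟨by positivity, fun h hh hlt => ?_⟩
    have h3 : h ≤ g n := Nat.le_findGreatest hh hlt
    have h5 : (4 : ℝ) ^ g n = y n ^ (g n * Real.log 4 / Real.log (y n)) := by
      rw [Real.rpow_def_of_pos (by linarith), mul_div_cancel₀ _ (by linarith), Real.exp_nat_mul,
        Real.exp_log (by norm_num)]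
    rw [← h5]
    exact pow_le_pow_right₀ (by norm_num) h3

theorem counting_time_le {n r K : ℕ} (hn : 1 ≤ n) :
    (n * (n * (38 * n + 40) + 40) + 12 * (n * n) + 20 * n + 114) *
        (2 * (n * n) + 20 + K + 1) ^ 2 +
      (200 * (2 ^ r * (n + 2) ^ 3) + 20 * (n * n) + 30) * (2 * (n * n) + 20 + K + 1) ^ 2 ≤
      6000 * (23 + K) ^ 2 * (n ^ 7 * 2 ^ r) := by
  have h1 : 2 * (n * n) + 20 + K + 1 ≤ (23 + K) * n ^ 2 := by
    have hnn : 0 < n * n := Nat.mul_pos hn hn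
    have hKn : K ≤ K * (n * n) := Nat.le_mul_of_pos_right _ hnn
    nlinarith
  have h2 : (2 * (n * n) + 20 + K + 1) ^ 2 ≤ (23 + K) ^ 2 * n ^ 4 :=
    (Nat.pow_le_pow_left h1 2).trans (le_of_eq (by ring))
  have hn1 : n ≤ n ^ 3 := Nat.le_self_pow (by norm_num) n
  have hn2 : n * n ≤ n ^ 3 := by
    rw [← sq]; exact Nat.pow_le_pow_right hn (by norm_num)
  have hn3 : 1 ≤ n ^ 3 := Nat.one_le_pow _ _ hn
  have h3 : n * (n * (38 * n + 40) + 40) + 12 * (n * n) + 20 * n + 114 ≤ 264 * n ^ 3 := by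
    nlinarith
  have h4 : (n + 2) ^ 3 ≤ 27 * n ^ 3 :=
    (Nat.pow_le_pow_left (show n + 2 ≤ 3 * n by omega) 3).trans (le_of_eq (by ring))
  have h5 : n ^ 3 ≤ 2 ^ r * n ^ 3 := Nat.le_mul_of_pos_left _ (by positivity)
  have h6 : 2 ^ r * (n + 2) ^ 3 ≤ 27 * (2 ^ r * n ^ 3) :=
    (Nat.mul_le_mul_left _ h4).trans (le_of_eq (by ring))
  rw [← add_mul]
  calc _ ≤ (6000 * (2 ^ r * n ^ 3)) * ((23 + K) ^ 2 * n ^ 4) :=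
        Nat.mul_le_mul (by omega) h2
    _ = _ := by ring

theorem vote_time_le {n K t T : ℕ} (hn : 1 ≤ n) (ht : 1 ≤ t) :
    (n * (n * (38 * n + 40) + 40) + 12 * (n * n) + 20 * n + 114) *
        (2 * (n * n) + 20 + K + 1) ^ 2 +
      ((16 * n + 50) * (2 * (n * n) + 20 + K + 1) ^ 2 + 6 * (t * (2 * (n * n) + 20 + K) + 2) + t *
        (12 * (t * (2 * (n * n) + 20 + K) + 2) * (2 * (n * n) + 20 + K + 1) +
          (22 * (n * n) + 30 * n + 46) * (2 * (n * n) + 20 + K + 1) ^ 2 + 10 * T + 10)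
        + 2 * T + 2) ≤
      500 * (23 + K) ^ 2 * (n ^ 8 * t ^ 2) + 12 * (t * T) := by
  set W := 2 * (n * n) + 20 + K with hW
  have h1 : W + 1 ≤ (23 + K) * n ^ 2 := by
    have hnn : 0 < n * n := Nat.mul_pos hn hn
    have hKn : K ≤ K * (n * n) := Nat.le_mul_of_pos_right _ hnn
    rw [hW]; nlinarith
  have h2 : (W + 1) ^ 2 ≤ (23 + K) ^ 2 * n ^ 4 :=
    (Nat.pow_le_pow_left h1 2).trans (le_of_eq (by ring))
  have hn1 : n ≤ n ^ 3 := Nat.le_self_pow (by norm_num) n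
  have hn2 : n * n ≤ n ^ 3 := by
    rw [← sq]; exact Nat.pow_le_pow_right hn (by norm_num)
  have hn3 : 1 ≤ n ^ 3 := Nat.one_le_pow _ _ hn
  have hn4 : n ^ 3 ≤ n ^ 4 := Nat.pow_le_pow_right hn (by norm_num)
  have htt : t ≤ t ^ 2 := Nat.le_self_pow (by norm_num) t
  have h3 : n * (n * (38 * n + 40) + 40) + 12 * (n * n) + 20 * n + 114 ≤ 264 * n ^ 3 := by
    nlinarith
  have h5 : t * W + 2 ≤ 2 * t * (W + 1) := by nlinarith
  have h6 : (t * W + 2) * (W + 1) ≤ 2 * t * (W + 1) ^ 2 :=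
    (Nat.mul_le_mul_right _ h5).trans (le_of_eq (by ring))
  have hU : W + 1 ≤ (W + 1) ^ 2 := Nat.le_self_pow (by norm_num) _
  have h7 : t * W + 2 ≤ 2 * t * (W + 1) ^ 2 := h5.trans (Nat.mul_le_mul_left _ hU)
  have hU1 : 1 ≤ (W + 1) ^ 2 := Nat.one_le_pow _ _ (by omega)
  have hT : 2 * T ≤ 2 * (t * T) := Nat.mul_le_mul_left _ (Nat.le_mul_of_pos_left _ ht)
  have h8 : 22 * (n * n) + 30 * n + 46 ≤ 98 * n ^ 3 := by omega
  have hA : t ≤ t ^ 2 * n ^ 4 := htt.trans (Nat.le_mul_of_pos_right _ (by positivity))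
  have hB : n ^ 4 ≤ t ^ 2 * n ^ 4 := Nat.le_mul_of_pos_left _ (by positivity)
  have hC : t * n ^ 3 ≤ t ^ 2 * n ^ 4 := Nat.mul_le_mul htt hn4
  have hD : t ^ 2 ≤ t ^ 2 * n ^ 4 := Nat.le_mul_of_pos_right _ (by positivity)
  calc _ ≤ 264 * n ^ 3 * (W + 1) ^ 2 + (66 * n ^ 3 * (W + 1) ^ 2 + 6 * (2 * t * (W + 1) ^ 2) +
          t * (12 * (2 * t * (W + 1) ^ 2) + 98 * n ^ 3 * (W + 1) ^ 2 + 10 * T +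
            10 * (W + 1) ^ 2) + 2 * (t * T) + 2 * (W + 1) ^ 2) := by
        have e1 : 16 * n + 50 ≤ 66 * n ^ 3 := by omega
        have e2 : 12 * (t * W + 2) * (W + 1) ≤ 12 * (2 * t * (W + 1) ^ 2) := by
          rw [mul_assoc]; exact Nat.mul_le_mul_left _ h6
        gcongr
        · omega
        · omega
    _ = (330 * n ^ 3 + 22 * t + 24 * t ^ 2 + 98 * (t * n ^ 3) + 2) * (W + 1) ^ 2 +
          12 * (t * T) := by ring
    _ ≤ (500 * (t ^ 2 * n ^ 4)) * ((23 + K) ^ 2 * n ^ 4) + 12 * (t * T) := by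
        gcongr
        omega
    _ = _ := by ring

/-- For `x = n` and `y = ε`: the time bounds increase with the exponents. -/
theorem rpow_div_rpow_le {x y p p' q q' : ℝ} (hx : 1 ≤ x) (hy : 0 < y) (hy' : y ≤ 1)
    (hp : p ≤ p') (hq : q ≤ q') : x ^ p / y ^ q ≤ x ^ p' / y ^ q' :=
  div_le_div₀ (by positivity) (Real.rpow_le_rpow_of_exponent_le hx hp) (by positivity)
    (Real.rpow_le_rpow_of_exponent_ge hy hy' hq)

/-- If the isomorphism class may be too small for a vote, the time for counting the cliques is
within the time bound `Z`. -/
theorem counting_cost_le {n r : ℕ} {ε e q Z : ℝ} (hn : (1 : ℝ) ≤ n) (hε : 0 < ε) (hε' : ε ≤ 1)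
    (hq0 : 0 ≤ q) (hq : q ≤ 1 / ε) (hZ : (n : ℝ) ^ 8 / ε ^ 4 * (n / ε) ^ e ≤ Z)
    (he : (((r + 1) / 2).factorial : ℝ) < 144 * ((n : ℝ) / ε) ^ 2 →
      (4 : ℝ) ^ ((r + 1) / 2) ≤ (n / ε) ^ e)
    (hlt : (((r + 1) / 2).factorial : ℝ) < 144 * (n * n) * (q * q)) :
    (n : ℝ) ^ 7 * 2 ^ r ≤ Z := by
  have h1 : (((r + 1) / 2).factorial : ℝ) < 144 * ((n : ℝ) / ε) ^ 2 := by
    refine hlt.trans_le ?_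
    calc 144 * ((n : ℝ) * n) * (q * q) ≤ 144 * ((n : ℝ) * n) * (1 / ε * (1 / ε)) := by gcongr
      _ = _ := by field_simp
  have h2 : (2 : ℝ) ^ r ≤ (n / ε) ^ e := by
    refine le_trans ?_ (he h1)
    calc (2 : ℝ) ^ r ≤ 2 ^ (2 * ((r + 1) / 2)) := pow_le_pow_right₀ (by norm_num) (by omega)
      _ = _ := by rw [pow_mul]; norm_num
  refine le_trans (mul_le_mul ?_ h2 (by positivity) (by positivity)) hZ
  rw [le_div_iff₀ (by positivity)]
  calc (n : ℝ) ^ 7 * ε ^ 4 ≤ (n : ℝ) ^ 7 :=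
        mul_le_of_le_one_right (by positivity) (pow_le_one₀ hε.le hε')
    _ ≤ (n : ℝ) ^ 8 := pow_le_pow_right₀ hn (by norm_num)

theorem vote_cost_le {x t K T ε Z : ℝ} (hx : 0 ≤ x) (ht0 : 0 ≤ t) (hT : 0 ≤ T) (hε : 0 < ε)
    (ht : t ≤ K / ε ^ 2) (hZ : x / ε ^ 4 ≤ Z) :
    x * t ^ 2 ≤ K ^ 2 * Z ∧ t * T ≤ K * (T / ε ^ 2) := by
  constructor
  · calc x * t ^ 2 ≤ x * (K / ε ^ 2) ^ 2 := by gcongr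
      _ = K ^ 2 * (x / ε ^ 4) := by field_simp
      _ ≤ _ := by gcongr
  · calc t * T ≤ K / ε ^ 2 * T := by gcongr
      _ = _ := by ring

/-- With `t = K * q ^ 2` samples, where `q ≥ 1 / (3 * ε)`, the vote fails with probability at most
`exp (-K / 36)`; and the isomorphism class is as large as the vote needs it. -/
theorem vote_parameters {n K q R : ℕ} {ε δ : ℝ} (hε : 0 < ε) (hδ : 0 < δ)
    (hK : -(36 * Real.log δ) ≤ K) (hq : 1 / (3 * ε) ≤ q) (hq' : (q : ℝ) ≤ 1 / ε)
    (hR : 144 * (n * n) * (q * q) ≤ R) :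
    ((K * (q * q) : ℕ) : ℝ) ≤ K / ε ^ 2 ∧ 16 * (n : ℝ) ^ 2 / ε ^ 2 ≤ R ∧
      Real.exp (-((ε / 2) ^ 2 * (K * (q * q) : ℕ))) ≤ δ := by
  have hqr : 1 ≤ (q : ℝ) * q * (9 * ε ^ 2) := by
    rw [div_le_iff₀ (by positivity)] at hq
    nlinarith
  push_cast
  refine ⟨?_, ?_, ?_⟩
  · calc (K : ℝ) * (q * q) ≤ K * (1 / ε * (1 / ε)) := by gcongr
      _ = _ := by field_simp
  · have h1 : 144 * ((n : ℝ) * n) * (q * q) ≤ R := by exact_mod_cast hR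
    refine le_trans ?_ h1
    rw [div_le_iff₀ (by positivity)]
    linear_combination 16 * (n : ℝ) ^ 2 * hqr
  · rw [← Real.le_log_iff_exp_le hδ]
    linear_combination (K : ℝ) / 36 * hqr + hK / 36

theorem theorem1 {𝔻 : Type*} (enc : 𝔻 ↪ ℕ) (k : ℕ → ℕ) (ε : ℕ → ℝ)
    (H : ∀ n, SimpleGraph (Fin n) → 𝔻)
    (hH : ∀ (n : ℕ) (G G' : SimpleGraph (Fin n)), Nonempty (G ≃g G') → H n G = H n G')
    (hε : ∀ᶠ n in atTop, 0 < ε n ∧ ε n ≤ 1 / 2)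
    (hω : (fun n : ℕ => (n : ℝ) ^ (3 / 2 : ℝ) / √(n.factorial : ℝ)) =o[atTop] ε)
    (hcomp : ComputableFromCliqueCount enc k ε H)
    (δ : ℝ) (hδ : 0 < δ) :
    ∃ (P : RAM.Prog) (c C : ℝ) (a b : ℕ → ℝ),
      0 < c ∧ Tendsto a atTop (𝓝 0) ∧ Tendsto b atTop (𝓝 0) ∧
      ∀ᶠ n : ℕ in atTop,
        1 - (2 : ℝ) ^ (-(c * (n : ℝ) ^ 2)) ≤
          probOfSet n (setSize ε n) fun S =>
            ∀ O : SimpleGraph (Fin n) → 𝔻, (∀ G ∈ S, O G = H n G) →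
              ∀ T : ℕ, SimulatedInTime enc O T →
                ∀ G : SimpleGraph (Fin n),
                  ComputesInTime P (graphOracle enc O T) G (cliqueParam n (k n)) (setSize ε n)
                    (enc (H n G)) (1 - δ)
                    (C * (((n : ℝ) ^ (8 + a n) / ε n ^ (2 + b n) + T) / ε n ^ 2)) := by
  obtain ⟨Q, C₁, a₁, b₁, ha₁, hb₁, hQ⟩ := hcomp
  have hy : Tendsto (fun n : ℕ => (n : ℝ) / ε n) atTop atTop := by
    refine tendsto_atTop_mono' _ ?_ tendsto_natCast_atTop_atTop
    filter_upwards [hε] with n hn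
    rw [le_div_iff₀ hn.1]
    have : (0 : ℝ) ≤ n := by positivity
    nlinarith
  obtain ⟨e, he, hgrowth⟩ := exists_tendsto_four_pow_le hy
  -- The vote fails with probability at most `exp (-K / 36)`.
  obtain ⟨K, hK, hK1⟩ : ∃ K : ℕ, -(36 * Real.log δ) ≤ K ∧ 1 ≤ K :=
    ⟨⌈-(36 * Real.log δ)⌉₊ + 1, (Nat.le_ceil _).trans (by push_cast; linarith), by omega⟩
  set D : ℝ := (23 + K) ^ 2 with hD
  refine ⟨RAM.countOrVote Q K, 1, 6000 * D + 3 * |C₁| + 2 + 500 * D * K ^ 2 + 12 * K,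
    fun n => max (a₁ n) (e n), fun n => max (b₁ n) (e n), one_pos,
    by simpa using ha₁.max he, by simpa using hb₁.max he, ?_⟩
  filter_upwards [hε, hω.bound one_pos, hQ, hgrowth, eventually_ge_atTop 2] with
    n ⟨hε0, hε1⟩ hωn hQn ⟨he0, hen⟩ hn2
  have hn1 : (1 : ℝ) ≤ n := by exact_mod_cast (by omega : 1 ≤ n)
  have hgap : 2 ≤ ε n * 2 ^ n.choose 2 := by
    refine two_le_mul_two_pow_choose hn2 ?_
    rw [one_mul, Real.norm_of_nonneg (by positivity), Real.norm_of_nonneg hε0.le] at hωn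
    exact hωn
  have hm := setSize_le hε1
  obtain ⟨hq1, hq2⟩ := RAM.invGap_bounds (m := setSize ε n) hε0 hε1 hgap rfl
  have hqq := RAM.invGap_sq_le n (setSize ε n)
  have hq0 : 0 < RAM.invGap n (setSize ε n) := Nat.succ_pos _
  set W := 2 * (n * n) + 20 + K with hW
  -- The bound on the running time is a constant times `Z + T / ε n ^ 2`.
  set Z := (n : ℝ) ^ (8 + max (a₁ n) (e n)) / ε n ^ (2 + max (b₁ n) (e n)) / ε n ^ 2 with hZ
  have hZ' : Z = (n : ℝ) ^ (8 + max (a₁ n) (e n)) / ε n ^ (4 + max (b₁ n) (e n)) := by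
    rw [hZ, div_div, ← Real.rpow_natCast (ε n) 2, ← Real.rpow_add hε0]
    congr 2
    push_cast; ring
  have hZ0 : 0 ≤ Z := by rw [hZ']; positivity
  have hZ₁ : (n : ℝ) ^ (8 + a₁ n) / ε n ^ (4 + b₁ n) ≤ Z := by
    rw [hZ']
    exact rpow_div_rpow_le hn1 hε0 (by linarith) (by gcongr; exact le_max_left _ _)
      (by gcongr; exact le_max_left _ _)
  have hZ₂ : (n : ℝ) ^ 8 / ε n ^ 4 * (n / ε n) ^ e n ≤ Z := by
    rw [hZ', Real.div_rpow (by positivity) hε0.le, div_mul_div_comm, ← Real.rpow_natCast _ 8,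
      ← Real.rpow_natCast _ 4, ← Real.rpow_add (by positivity), ← Real.rpow_add hε0]
    push_cast
    exact rpow_div_rpow_le hn1 hε0 (by linarith) (by gcongr; exact le_max_right _ _)
      (by gcongr; exact le_max_right _ _)
  have hy1 : 1 ≤ (n : ℝ) / ε n := by
    rw [le_div_iff₀ hε0]; linarith
  have hZ₃ : (n : ℝ) ^ 8 / ε n ^ 4 ≤ Z := by
    refine le_trans ?_ hZ₂
    exact le_mul_of_one_le_right (by positivity) (Real.one_le_rpow hy1 he0)
  have hZ₄ : 1 ≤ Z := by
    refine le_trans ?_ hZ₃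
    rw [le_div_iff₀ (by positivity), one_mul]
    calc ε n ^ 4 ≤ 1 := pow_le_one₀ hε0.le (by linarith)
      _ ≤ _ := one_le_pow₀ hn1
  refine one_sub_le_probOfSet hε0 hε1 hm (by rw [setSize]; exact Nat.le_ceil _)
    fun S hS O hO T hT G => ?_
  rw [show ∀ x y : ℝ, (x + y) / ε n ^ 2 = x / ε n ^ 2 + y / ε n ^ 2 from fun _ _ => add_div _ _ _,
    ← hZ]
  obtain ⟨r, v, arr, c, hr, hrn, hc, h0, h23, hA, hcount, hvote⟩ :=
    RAM.exec_countOrVote (orc := some (graphOracle enc O T)) (W := W) (k n) G Q K (by omega) hm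
  generalize RAM.invGap n (setSize ε n) = q at *
  have hcR : (0 : ℝ) ≤ T / ε n ^ 2 := by positivity
  rcases lt_or_ge ((r + 1) / 2).factorial (144 * (n * n) * (q * q)) with hlt | hge
  · obtain ⟨s, hs, hout, hcost⟩ := hQn G
    obtain ⟨s', hs', hout', hcost'⟩ := hcount hlt s hs
    refine ⟨_, hs', ?_, ?_⟩
    · intro s'' hs''
      rw [PMF.support_pure, Set.mem_singleton_iff] at hs''
      rw [hs'']
      have h1 : s'.cost ≤ 6000 * (23 + K) ^ 2 * (n ^ 7 * 2 ^ r) + 3 * s.cost + 2 := by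
        have := counting_time_le (r := r) (K := K) (show 1 ≤ n by omega)
        rw [← hW] at this
        omega
      have h2 : (s'.cost : ℝ) ≤ 6000 * D * (n ^ 7 * 2 ^ r) + 3 * s.cost + 2 := by
        rw [hD]; exact_mod_cast h1
      have h3 : (s.cost : ℝ) ≤ |C₁| * Z :=
        hcost.trans (mul_le_mul (le_abs_self _) hZ₁ (by positivity) (abs_nonneg _))
      have h5 : (n : ℝ) ^ 7 * 2 ^ r ≤ Z :=
        counting_cost_le hn1 hε0 (by linarith) (Nat.cast_nonneg q) hq2 hZ₂
          (hen _ (by omega)) (by exact_mod_cast hlt)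
      have hD0 : 0 ≤ D := by positivity
      have h6 : (0 : ℝ) ≤ 500 * D * K ^ 2 + 12 * K := by positivity
      have h7 : 0 ≤ 6000 * D + 3 * |C₁| + 2 := by positivity
      have h8 : 6000 * D * (n ^ 7 * 2 ^ r) ≤ 6000 * D * Z := by gcongr
      calc (s'.cost : ℝ) ≤ (6000 * D + 3 * |C₁| + 2) * Z := by linarith
        _ ≤ (6000 * D + 3 * |C₁| + 2 + 500 * D * K ^ 2 + 12 * K) * (Z + T / ε n ^ 2) := by
            refine mul_le_mul ?_ ?_ hZ0 ?_ <;> linarith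
    · rw [PMF.pure_map, hout', hout, PMF.pure_apply, if_pos rfl]
      rw [← ENNReal.ofReal_one]
      exact ENNReal.ofReal_le_ofReal (by linarith)
  · obtain ⟨t, ht⟩ : ∃ t, t = K * (q * q) := ⟨_, rfl⟩
    have ht1 : 1 ≤ t := ht ▸ Nat.mul_pos (by omega) (Nat.mul_pos hq0 hq0)
    have hKW : K < 2 ^ K := Nat.lt_two_pow_self
    have htW : t + 1 < 2 ^ W := by
      calc t + 1 ≤ 2 ^ K * 2 ^ (n * n + 2) + 1 := by
            rw [ht]; gcongr
        _ = 2 ^ (K + (n * n + 2)) + 1 := by rw [pow_add 2 K]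
        _ < 2 ^ (K + (n * n + 2)) * 2 := by
            have : 1 < 2 ^ (K + (n * n + 2)) := Nat.one_lt_two_pow (by omega)
            omega
        _ = 2 ^ (K + (n * n + 2) + 1) := by rw [pow_succ]
        _ ≤ 2 ^ W := Nat.pow_le_pow_right (by norm_num) (by omega)
    obtain ⟨htr, hbig, hfail⟩ := vote_parameters hε0 hδ hK hq1 hq2 (hge.trans hr)
    rw [← ht] at htr hfail
    obtain ⟨μ, hμ, hcost, hout⟩ := RAM.exec_vote_of_oracle (enc := enc) (W := W) (K := K) (q := q)
      (t := t) (T := T) (v := v) (a := arr) (F := H n) (O := O) (G := G) (S := S)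
      (fun σ => hH n _ _ ⟨SimpleGraph.Iso.comap σ G⟩) (fun G' hG' => hO G' hG') hT
      (η := ε n / 2) (δ := δ) (by linarith) (by linarith)
      (by have := hS G hbig; rwa [show 1 / 2 + ε n / 2 = (1 + ε n) / 2 by ring]) hfail (by omega)
      h0 h23 (hKW.trans_le (Nat.pow_le_pow_right (by norm_num) (by omega)))
      (hqq.trans_lt (Nat.pow_lt_pow_right (by norm_num) (by omega))) ht.symm htW hA c
    refine ⟨μ, hvote hge μ hμ, ?_, hout⟩
    intro s hs
    have h1 : s.cost ≤ 500 * (23 + K) ^ 2 * (n ^ 8 * t ^ 2) + 12 * (t * T) := by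
      have h2 := hcost s hs
      have h3 := vote_time_le (n := n) (K := K) (t := t) (T := T) (by omega) ht1
      rw [← hW] at h3
      omega
    have h2 : (s.cost : ℝ) ≤ 500 * D * (n ^ 8 * t ^ 2) + 12 * (t * T) := by
      rw [hD]; exact_mod_cast h1
    have hD0 : 0 ≤ D := by positivity
    obtain ⟨h3, h4⟩ := vote_cost_le (T := T) (by positivity) (by positivity) (by positivity) hε0
      htr hZ₃
    have h5 : 500 * D * (n ^ 8 * t ^ 2) ≤ 500 * D * (K ^ 2 * Z) := by gcongr
    have h6 : 0 ≤ (6000 * D + 3 * |C₁| + 2) * (Z + T / ε n ^ 2) := by positivity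
    have h7 : 0 ≤ 500 * D * K ^ 2 * (T / ε n ^ 2) := by positivity
    have h8 : 0 ≤ 12 * (K : ℝ) * Z := by positivity
    linear_combination h2 + h5 + 12 * h4 + h6 + h7 + h8
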